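/- Let $X$ be a noncompact smooth manifold without boundary (Hausdorff, second countable, finite dimensional), let $\rho\colon X\to\mathbb{R}$ be a smooth exhaustion function (all sublevel sets $\{\rho\le r\}$ are compact), and let $M_1\subset M_2\subset\cdots\subset\bigcup_{i=1}^\infty M_i=X$ be an exhaustion by regular sublevel sets $M_i=\{x\in X:\rho(x)\le c_i\}$, where $c_1\le c_2\le\cdots$ are regular values of $\rho$. Let $H_*$ and $H^*$ denote singular homology and cohomology with integer coefficients. For a tower $\cdots\to A_3\xrightarrow{p_3}A_2\xrightarrow{p_2}A_1$ of abelian groups let $\lim_i A_i$ and $\lim^1_i A_i$ be the kernel and the cokernel of the endomorphism $(a_i)_i\mapsto(a_i-p_{i+1}(a_{i+1}))_i$ of $\prod_{i=1}^\infty A_i$, and set $\mathscr{H}^k(X;\mathbb{Z})=\lim_i H^k(M_i;\mathbb{Z})$, the limit being taken along the restriction maps. Let $k\ge 1$ and let $T$ be the torsion subgroup of $H_{k-1}(X)$. Then $$\textstyle\lim^1_i H^{k-1}(M_i;\mathbb{Z})\;\cong\;\mathrm{Ext}\big(H_{k-1}(X)/T,\mathbb{Z}\big)$$ as abelian groups.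 Moreover, if $\mathrm{Ext}(H_{k-1}(X)/T,\mathbb{Z})=0$, then the natural map $H^k(X;\mathbb{Z})\to\mathscr{H}^k(X;\mathbb{Z})$, which sends a class to its restrictions to the $M_i$, is an isomorphism. -/

import Mathlib

open CategoryTheory AlgebraicTopology
open scoped Manifold ContDiff

universe u

/-! ### Integral singular homology and cohomology -/

section Singular

variable (X : Type u) [TopologicalSpace X]
variable {Y : Type u} [TopologicalSpace Y] {Z : Type u} [TopologicalSpace Z]

/-- The singular chain complex of `X` with integer coefficients (`ULift ℤ` is `ℤ` placed in the
universe of `X`). -/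
noncomputable def singChains : ChainComplex (ModuleCat.{u} ℤ) ℕ :=
  ((singularChainComplexFunctor (ModuleCat.{u} ℤ)).obj (ModuleCat.of ℤ (ULift.{u} ℤ))).obj
    (TopCat.of X)

/-- The chain map induced by a continuous map. -/
noncomputable def singChainsMap {X : Type u} [TopologicalSpace X] (f : C(X, Y)) :
    singChains X ⟶ singChains Y :=
  ((singularChainComplexFunctor (ModuleCat.{u} ℤ)).obj (ModuleCat.of ℤ (ULift.{u} ℤ))).map
    (TopCat.ofHom f)

/-- The singular homology group `H_n(X; ℤ)`. -/
noncomputable abbrev SingHomology (n : ℕ) : ModuleCat.{u} ℤ :=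
  ((singularHomologyFunctor (ModuleCat.{u} ℤ) n).obj (ModuleCat.of ℤ (ULift.{u} ℤ))).obj
    (TopCat.of X)

/-- Singular `n`-cochains: homomorphisms from the singular `n`-chains to `ℤ`. -/
abbrev SingCochain (n : ℕ) : Type u := (singChains X).X n →ₗ[ℤ] ℤ

/-- The coboundary `C^i(X) → C^j(X)`, precomposition with the boundary `C_j(X) → C_i(X)`
(the zero map unless `j = i + 1`). -/
noncomputable def singCoboundary (i j : ℕ) : SingCochain X i →ₗ[ℤ] SingCochain X j :=
  LinearMap.lcomp ℤ ℤ ((singChains X).d j i).hom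

/-- Singular `n`-cocycles. -/
noncomputable def singCocycles (n : ℕ) : Submodule ℤ (SingCochain X n) :=
  LinearMap.ker (singCoboundary X n (n + 1))

/-- Singular `n`-coboundaries: the image of `C^(n-1)(X)`. For `n = 0` the boundary map `d 0 0` of
the chain complex is zero, so this is the zero submodule, as it should be. -/
noncomputable def singCoboundaries (n : ℕ) : Submodule ℤ (SingCochain X n) :=
  LinearMap.range (singCoboundary X (n - 1) n)

/-- The singular cohomology group `H^n(X; ℤ)`: cocycles modulo coboundaries. -/
def SingCohomology (n : ℕ) : Type u :=
  singCocycles X n ⧸ (singCoboundaries X n).submoduleOf (singCocycles X n)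

noncomputable instance (n : ℕ) : AddCommGroup (SingCohomology X n) :=
  inferInstanceAs (AddCommGroup (_ ⧸ (singCoboundaries X n).submoduleOf (singCocycles X n)))

variable {X}

/-- Pullback of cochains along a continuous map. -/
noncomputable def singCochainMap (f : C(X, Y)) (n : ℕ) : SingCochain Y n →ₗ[ℤ] SingCochain X n :=
  LinearMap.lcomp ℤ ℤ ((singChainsMap f).f n).hom

theorem singCochainMap_coboundary (f : C(X, Y)) (i j : ℕ) (c : SingCochain Y i) :
    singCochainMap f j (singCoboundary Y i j c) = singCoboundary X i j (singCochainMap f i c) := by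
  have h := (singChainsMap f).comm j i
  ext x
  exact congrArg c (LinearMap.congr_fun (congrArg ModuleCat.Hom.hom h) x)

theorem singCochainMap_mem_cocycles (f : C(X, Y)) (n : ℕ) (c : SingCochain Y n)
    (hc : c ∈ singCocycles Y n) : singCochainMap f n c ∈ singCocycles X n := by
  have hc' : singCoboundary Y n (n + 1) c = 0 := hc
  change singCoboundary X n (n + 1) (singCochainMap f n c) = 0
  rw [← singCochainMap_coboundary, hc', map_zero]

/-- Pullback of cocycles along a continuous map. -/
noncomputable def singCocycleMap (f : C(X, Y)) (n : ℕ) : singCocycles Y n →ₗ[ℤ] singCocycles X n :=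
  (singCochainMap f n).restrict (singCochainMap_mem_cocycles f n)

theorem singCocycleMap_coboundaries (f : C(X, Y)) (n : ℕ) :
    (singCoboundaries Y n).submoduleOf (singCocycles Y n) ≤
      ((singCoboundaries X n).submoduleOf (singCocycles X n)).comap (singCocycleMap f n) := by
  rintro ⟨c, hc⟩ ⟨b, hb⟩
  refine ⟨singCochainMap f (n - 1) b, ?_⟩
  rw [← singCochainMap_coboundary, hb]
  rfl

/-- The map `f^* : H^n(Y; ℤ) → H^n(X; ℤ)` induced by a continuous map `f : X → Y`. -/
noncomputable def singCohomologyMap (f : C(X, Y)) (n : ℕ) :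
    SingCohomology Y n →+ SingCohomology X n :=
  (Submodule.mapQ _ ((singCoboundaries X n).submoduleOf (singCocycles X n)) (singCocycleMap f n)
    (singCocycleMap_coboundaries f n)).toAddMonoidHom

theorem singCohomologyMap_comp (g : C(Y, Z)) (f : C(X, Y)) (n : ℕ) (x : SingCohomology Z n) :
    singCohomologyMap f n (singCohomologyMap g n x) = singCohomologyMap (g.comp f) n x := by
  obtain ⟨c, rfl⟩ := Submodule.Quotient.mk_surjective _ x
  have h : singChainsMap (g.comp f) = singChainsMap f ≫ singChainsMap g :=
    ((singularChainComplexFunctor (ModuleCat.{u} ℤ)).obj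
      (ModuleCat.of ℤ (ULift.{u} ℤ))).map_comp (TopCat.ofHom f) (TopCat.ofHom g)
  have h2 : singCocycleMap f n (singCocycleMap g n c) = singCocycleMap (g.comp f) n c := by
    apply Subtype.ext
    change singCochainMap f n (singCochainMap g n c.1) = singCochainMap (g.comp f) n c.1
    simp only [singCochainMap, h]
    rfl
  change Submodule.Quotient.mk _ = Submodule.Quotient.mk _
  rw [h2]

end Singular

/-! ### Towers of abelian groups -/

section Tower

variable (A : ℕ → Type u) [∀ i, AddCommGroup (A i)]

/-- For a tower `⋯ → A 2 → A 1 → A 0` with bonding maps `p`, the endomorphism `1 - P` of the product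
`∏ A i`, that is `(a i) ↦ (a i - p i (a (i + 1)))`. -/
def oneSubBonding (p : ∀ i, A (i + 1) →+ A i) : (∀ i, A i) →+ (∀ i, A i) where
  toFun a := fun i => a i - p i (a (i + 1))
  map_zero' := by ext i; simp
  map_add' a b := by ext i; simp only [Pi.add_apply, map_add]; abel

/-- The inverse limit of a tower: the compatible sequences, i.e. the kernel of `1 - P`. -/
def TowerLim (p : ∀ i, A (i + 1) →+ A i) : AddSubgroup (∀ i, A i) :=
  (oneSubBonding A p).ker

/-- The first derived functor `lim¹` of the inverse limit: the cokernel of `1 - P`. -/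
def TowerLimOne (p : ∀ i, A (i + 1) →+ A i) : Type u :=
  (∀ i, A i) ⧸ (oneSubBonding A p).range

instance (p : ∀ i, A (i + 1) →+ A i) : AddCommGroup (TowerLimOne A p) :=
  inferInstanceAs (AddCommGroup ((∀ i, A i) ⧸ (oneSubBonding A p).range))

end Tower

/-! ### The cohomology tower of a nested sequence of subspaces -/

section Exhaustion

variable {X : Type u} [TopologicalSpace X]

/-- The inclusion of a subspace, as a continuous map. -/
def subspaceIncl (S : Set X) : C(S, X) := ⟨Subtype.val, continuous_subtype_val⟩

/-- The restriction maps `H^n(M (i+1); ℤ) → H^n(M i; ℤ)` for a nested sequence of subspaces. -/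
noncomputable def cohomologyBonding (M : ℕ → Set X) (hM : Monotone M) (n i : ℕ) :
    SingCohomology (M (i + 1)) n →+ SingCohomology (M i) n :=
  singCohomologyMap (ContinuousMap.inclusion (hM i.le_succ)) n

/-- The inverse limit `lim_i H^n(M i; ℤ)`. -/
noncomputable abbrev LimCohomology (M : ℕ → Set X) (hM : Monotone M) (n : ℕ) : Type u :=
  TowerLim (fun i => SingCohomology (M i) n) (cohomologyBonding M hM n)

/-- The group `lim¹_i H^n(M i; ℤ)`. -/
noncomputable abbrev LimOneCohomology (M : ℕ → Set X) (hM : Monotone M) (n : ℕ) : Type u :=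
  TowerLimOne (fun i => SingCohomology (M i) n) (cohomologyBonding M hM n)

theorem restrictions_mem_lim (M : ℕ → Set X) (hM : Monotone M) (n : ℕ) (x : SingCohomology X n) :
    (fun i => singCohomologyMap (subspaceIncl (M i)) n x) ∈
      TowerLim (fun i => SingCohomology (M i) n) (cohomologyBonding M hM n) := by
  refine (AddMonoidHom.mem_ker).2 (funext fun i => ?_)
  have h := singCohomologyMap_comp (subspaceIncl (M (i + 1)))
    (ContinuousMap.inclusion (hM i.le_succ)) n x
  exact sub_eq_zero.2 h.symm

/-- The natural map `H^n(X; ℤ) → lim_i H^n(M i; ℤ)`, sending a class to its restrictions. -/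
noncomputable def toLimCohomology (M : ℕ → Set X) (hM : Monotone M) (n : ℕ) :
    SingCohomology X n →+ LimCohomology M hM n :=
  AddMonoidHom.codRestrict
    (AddMonoidHom.pi fun i => singCohomologyMap (subspaceIncl (M i)) n) _
    (restrictions_mem_lim M hM n)

end Exhaustion

/-- The sublevel sets `{ρ ≤ c i}`. -/
def sublevels {X : Type u} (ρ : X → ℝ) (c : ℕ → ℝ) (i : ℕ) : Set X := {x | ρ x ≤ c i}

theorem sublevels_monotone {X : Type u} (ρ : X → ℝ) {c : ℕ → ℝ} (hc : Monotone c) :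
    Monotone (sublevels ρ c) :=
  fun _ _ hij _ hx => le_trans hx (hc hij)


/-- The group `Ext(A / T, ℤ) = Ext¹(A / T, ℤ)`, where `T` is the torsion subgroup of the abelian
group `A`. -/
abbrev ExtModTorsion (A : ModuleCat.{u} ℤ) : Type u :=
  Abelian.Ext (ModuleCat.of ℤ (A ⧸ Submodule.torsion ℤ A)) (ModuleCat.of ℤ (ULift.{u} ℤ)) 1

/-!
Write `H_n` for the homology of `X` and let `k = n + 1`. Three facts about the exhaustion by the
sublevel sets `M i` are used: `X` being noncompact and `ρ` proper, the `c i` are unbounded, so that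
every compact set lies in some `M i`; each `M i` is compact; and each `M i` lies in the interior of
a later `M j`.

**Finiteness.** The image of `H_n(M i) → H_n(M j)` is finitely generated as soon as `M i` lies in
the interior of `M j`: the space `X` is metrizable, and each of its points has arbitrarily small
acyclic neighbourhoods (`exists_acyclic_nhds`, by coning off in charts). A cycle of `M i` is
subdivided until its simplices are small; then, by induction over the skeleta, its simplices are
replaced by fillings that depend only on the faces already replaced, starting from a finite net of
vertices. Since finitely many chains arise, the cycle is homologous, within `M j`, to an element of
a fixed finitely generated group (`exists_fg_cycles_modulo_bdry`).

**From cohomology to homology.** The Kronecker map `H^n(M i) → Hom(H_n(M i), ℤ)` is surjective. By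
the finiteness, restriction from `M j` to `M i` has finite image on the kernels, because the kernel
is an `Ext¹` and `Ext¹` of a finitely generated group is finite (`finite_image_ker_kronecker`). A
tower of groups whose transition maps eventually have finite image has vanishing `lim¹`, so `lim¹
H^n(M i) ≅ lim¹ Hom(H_n(M i), ℤ)` (`nonempty_limOneCohomology_equiv_dual`).

**From homology to `Ext`.** Let `Q = H_n / T`, and let `S i` be the image of `H_n(M i)` in `Q`. It
is finitely generated and torsion-free, hence free, and `Q` is the union of the `S i`. The towers
`Hom(S i, ℤ)` and `Hom(H_n(M i), ℤ)` are pro-isomorphic, since by the finiteness a class that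
becomes torsion in `H_n` does so at a stage that can be chosen uniformly
(`IndSystem.nonempty_limOne_dual_equiv_ext`). The telescope `0 → ⨁ S i → ⨁ S i → Q → 0` is a
projective resolution, and applying `Hom(-, ℤ)` to it turns the identity minus the shift into the
endomorphism whose cokernel is `lim¹`; hence `lim¹ Hom(S i, ℤ) ≅ Ext¹(Q, ℤ)`
(`nonempty_ext_equiv_limOne`).

**The limit map.** Every chain of `X` lies in some `M i`, so compatible cochains on the `M i` glue,
and so do, after corrections, cochains that are compatible up to coboundaries
(`exists_glue_of_compatible_mod_coboundaries`). This makes `H^k(X) → lim H^k(M i)` surjective. If a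
class restricts to zero on all `M i`, primitives of a representing cocycle differ by cocycles of
degree `n`, and the class of this sequence in `lim¹ H^n(M i)` is the obstruction to gluing them. It
vanishes when the `Ext` group does.
-/

/-! ### Augmented singular chains -/

section AugmentedChains

/-- Singular simplices with `k` vertices in `X`. Indexing by the number of vertices gives the
augmented complex for free: for `k = 0` the source is empty, so there is exactly one simplex. -/
abbrev SingSimplex (k : ℕ) (X : Type*) [TopologicalSpace X] := C(stdSimplex ℝ (Fin k), X)

/-- Augmented singular chains on simplices with `k` vertices. -/
abbrev AugChain (k : ℕ) (X : Type*) [TopologicalSpace X] := SingSimplex k X →₀ ℤ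

/-- The inclusion of the `i`-th face of the standard simplex. -/
noncomputable def stdFace {k : ℕ} (i : Fin (k + 1)) :
    C(stdSimplex ℝ (Fin k), stdSimplex ℝ (Fin (k + 1))) :=
  ⟨stdSimplex.map i.succAbove, stdSimplex.continuous_map _⟩

/-- The boundary map of the augmented singular chain complex. -/
noncomputable def augBdry (k : ℕ) (X : Type*) [TopologicalSpace X] :
    AugChain (k + 1) X →ₗ[ℤ] AugChain k X :=
  Finsupp.linearCombination ℤ fun σ : SingSimplex (k + 1) X =>
    ∑ i : Fin (k + 1), (-1 : ℤ) ^ (i : ℕ) • Finsupp.single (σ.comp (stdFace i)) 1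

/-- The map on augmented singular chains induced by a continuous map. -/
noncomputable def augMap {X Y : Type*} [TopologicalSpace X] [TopologicalSpace Y] (f : C(X, Y))
    (k : ℕ) : AugChain k X →ₗ[ℤ] AugChain k Y :=
  Finsupp.lmapDomain ℤ ℤ f.comp

theorem augBdry_single {k : ℕ} {X : Type*} [TopologicalSpace X] (σ : SingSimplex (k + 1) X) :
    augBdry k X (Finsupp.single σ 1) =
      ∑ i : Fin (k + 1), (-1 : ℤ) ^ (i : ℕ) • Finsupp.single (σ.comp (stdFace i)) 1 := by
  simp [augBdry]

theorem augMap_single {X Y : Type*} [TopologicalSpace X] [TopologicalSpace Y] (f : C(X, Y))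
    {k : ℕ} (σ : SingSimplex k X) (a : ℤ) :
    augMap f k (Finsupp.single σ a) = Finsupp.single (f.comp σ) a := by
  simp [augMap]

theorem augMap_bdry {X Y : Type*} [TopologicalSpace X] [TopologicalSpace Y] (f : C(X, Y))
    (k : ℕ) (c : AugChain (k + 1) X) :
    augMap f k (augBdry k X c) = augBdry k Y (augMap f (k + 1) c) := by
  refine LinearMap.congr_fun (f := (augMap f k).comp (augBdry k X))
    (g := (augBdry k Y).comp (augMap f (k + 1))) ?_ c
  refine Finsupp.lhom_ext' fun σ => LinearMap.ext_ring ?_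
  simp only [LinearMap.comp_apply, Finsupp.lsingle_apply, augBdry_single, augMap_single, map_sum,
    map_smul, ContinuousMap.comp_assoc]

end AugmentedChains

/-! ### Comparison with Mathlib's singular chain complex -/

section Comparison

variable (X : Type u) [TopologicalSpace X] {Y : Type u} [TopologicalSpace Y]

/-- The generator of Mathlib's singular chains given by a singular simplex. -/
noncomputable def singGen (n : ℕ) (σ : SingSimplex (n + 1) X) : (singChains X).X n :=
  ((TopCat.toSSet.obj (TopCat.of X)).ιChainComplex (R := ModuleCat.of ℤ (ULift.{u} ℤ))
    ((TopCat.toSSetObjEquiv (TopCat.of X) (Opposite.op (SimplexCategory.mk n))).symm σ)).hom ⟨1⟩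

/-- The comparison map from concrete chains to Mathlib's singular chains. -/
noncomputable def toSing (n : ℕ) : AugChain (n + 1) X →ₗ[ℤ] (singChains X).X n :=
  Finsupp.linearCombination ℤ (singGen X n)

/-- The inverse comparison map. -/
noncomputable def ofSing (n : ℕ) : (singChains X).X n →ₗ[ℤ] AugChain (n + 1) X :=
  (Limits.Cofan.IsColimit.desc
    ((TopCat.toSSet.obj (TopCat.of X)).isColimitChainComplexXCofan
      (ModuleCat.of ℤ (ULift.{u} ℤ)) n)
    (fun x => ModuleCat.ofHom (Y := AugChain (n + 1) X)
      ((Finsupp.lsingle (TopCat.toSSetObjEquiv (TopCat.of X)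
        (Opposite.op (SimplexCategory.mk n)) x)).comp
        (ULift.moduleEquiv (R := ℤ) (M := ℤ)).toLinearMap))).hom

variable {X}

theorem ofSing_singGen (n : ℕ) (σ : SingSimplex (n + 1) X) :
    ofSing X n (singGen X n σ) = Finsupp.single σ 1 := by
  have h := Limits.Cofan.IsColimit.fac
    ((TopCat.toSSet.obj (TopCat.of X)).isColimitChainComplexXCofan
      (ModuleCat.of ℤ (ULift.{u} ℤ)) n)
    (fun x => ModuleCat.ofHom (Y := AugChain (n + 1) X)
      ((Finsupp.lsingle (TopCat.toSSetObjEquiv (TopCat.of X)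
        (Opposite.op (SimplexCategory.mk n)) x)).comp
        (ULift.moduleEquiv (R := ℤ) (M := ℤ)).toLinearMap))
    ((TopCat.toSSetObjEquiv (TopCat.of X) (Opposite.op (SimplexCategory.mk n))).symm σ)
  have h' := LinearMap.congr_fun (congrArg ModuleCat.Hom.hom h) (⟨1⟩ : ULift.{u} ℤ)
  refine h'.trans ?_
  simp

theorem singChains_hom_ext {n : ℕ} {N : Type u} [AddCommGroup N] [Module ℤ N]
    {f g : (singChains X).X n →ₗ[ℤ] N} (h : ∀ σ, f (singGen X n σ) = g (singGen X n σ)) :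
    f = g := by
  have : ModuleCat.ofHom f = ModuleCat.ofHom g := by
    refine SSet.chainComplex_hom_ext (X := TopCat.toSSet.obj (TopCat.of X))
      (R := ModuleCat.of ℤ (ULift.{u} ℤ)) (n := n) fun x => ?_
    ext y
    obtain ⟨σ, rfl⟩ := (TopCat.toSSetObjEquiv (TopCat.of X)
      (Opposite.op (SimplexCategory.mk n))).symm.surjective x
    have hy : y = y.down • (⟨1⟩ : ULift.{u} ℤ) := by ext; simp
    rw [hy, map_zsmul, map_zsmul]
    congr 1
    exact h σ
  exact congrArg ModuleCat.Hom.hom this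

/-- Mathlib's singular chains are free on the singular simplices. -/
noncomputable def singEquiv (n : ℕ) : (singChains X).X n ≃ₗ[ℤ] AugChain (n + 1) X :=
  LinearEquiv.ofLinearMap (ofSing X n) (toSing X n)
    (by
      refine Finsupp.lhom_ext' fun σ => LinearMap.ext_ring ?_
      simp [toSing, ofSing_singGen])
    (by
      refine singChains_hom_ext fun σ => ?_
      simp only [LinearMap.comp_apply, ofSing_singGen, toSing, Finsupp.linearCombination_single]
      exact @one_smul ℤ _ _ ((singChains X).X n).isModule.toMulAction _)

theorem singEquiv_singGen (n : ℕ) (σ : SingSimplex (n + 1) X) :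
    singEquiv n (singGen X n σ) = Finsupp.single σ 1 := ofSing_singGen n σ

theorem singEquiv_d (n : ℕ) (c : (singChains X).X (n + 1)) :
    singEquiv n (((singChains X).d (n + 1) n).hom c) = augBdry (n + 1) X (singEquiv (n + 1) c) := by
  refine LinearMap.congr_fun
    (f := (singEquiv n).toLinearMap.comp ((singChains X).d (n + 1) n).hom)
    (g := (augBdry (n + 1) X).comp (singEquiv (n + 1)).toLinearMap) ?_ c
  refine singChains_hom_ext fun σ => ?_
  simp only [LinearMap.comp_apply, LinearEquiv.coe_coe, singEquiv_singGen, augBdry_single]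
  have h := (TopCat.toSSet.obj (TopCat.of X)).ιChainComplex_d (ModuleCat.of ℤ (ULift.{u} ℤ))
    ((TopCat.toSSetObjEquiv (TopCat.of X) (Opposite.op (SimplexCategory.mk (n + 1)))).symm σ)
  have h' : ((singChains X).d (n + 1) n).hom (singGen X (n + 1) σ) =
      ∑ i : Fin (n + 2), (-1 : ℤ) ^ (i : ℕ) • singGen X n (σ.comp (stdFace i)) := by
    refine (LinearMap.congr_fun (congrArg ModuleCat.Hom.hom h) (⟨1⟩ : ULift.{u} ℤ)).trans ?_
    simp only [ModuleCat.hom_sum, LinearMap.sum_apply, ModuleCat.hom_zsmul]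
    rfl
  rw [h', map_sum]
  simp only [map_zsmul, singEquiv_singGen]

theorem singEquiv_map (f : C(X, Y)) (n : ℕ) (c : (singChains X).X n) :
    singEquiv n (((singChainsMap f).f n).hom c) = augMap f (n + 1) (singEquiv n c) := by
  refine LinearMap.congr_fun
    (f := (singEquiv n).toLinearMap.comp ((singChainsMap f).f n).hom)
    (g := (augMap f (n + 1)).comp (singEquiv n).toLinearMap) ?_ c
  refine singChains_hom_ext fun σ => ?_
  simp only [LinearMap.comp_apply, LinearEquiv.coe_coe, singEquiv_singGen, augMap_single]
  have h := SSet.ι_chainComplexMap_f (TopCat.toSSet.obj (TopCat.of X))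
    (TopCat.toSSet.obj (TopCat.of Y)) (TopCat.toSSet.map (TopCat.ofHom f))
    (ModuleCat.of ℤ (ULift.{u} ℤ))
    ((TopCat.toSSetObjEquiv (TopCat.of X) (Opposite.op (SimplexCategory.mk n))).symm σ)
  have h' : ((singChainsMap f).f n).hom (singGen X n σ) = singGen Y n (f.comp σ) :=
    LinearMap.congr_fun (congrArg ModuleCat.Hom.hom h) (⟨1⟩ : ULift.{u} ℤ)
  rw [h', singEquiv_singGen]

end Comparison

/-! ### Barycentric subdivision of tuples -/

section Tuples

variable {E E' : Type*}

/-- The alternating sum of the faces of a tuple. -/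
noncomputable def tupBdry (E : Type*) (k : ℕ) : ((Fin (k + 1) → E) →₀ ℤ) →ₗ[ℤ] ((Fin k → E) →₀ ℤ) :=
  Finsupp.linearCombination ℤ fun v : Fin (k + 1) → E =>
    ∑ i : Fin (k + 1), (-1 : ℤ) ^ (i : ℕ) • Finsupp.single (v ∘ i.succAbove) 1

theorem tupBdry_single {k : ℕ} (v : Fin (k + 1) → E) :
    tupBdry E k (Finsupp.single v 1) =
      ∑ i : Fin (k + 1), (-1 : ℤ) ^ (i : ℕ) • Finsupp.single (v ∘ i.succAbove) 1 := by
  simp [tupBdry]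

/-- The cone operator: adding a new first vertex to a tuple. -/
noncomputable def tupCone (b : E) (k : ℕ) : ((Fin k → E) →₀ ℤ) →ₗ[ℤ] ((Fin (k + 1) → E) →₀ ℤ) :=
  Finsupp.lmapDomain ℤ ℤ fun v : Fin k → E => (Fin.cons b v : Fin (k + 1) → E)

theorem tupCone_single (b : E) {k : ℕ} (v : Fin k → E) (a : ℤ) :
    tupCone b k (Finsupp.single v a) = Finsupp.single (Fin.cons b v : Fin (k + 1) → E) a := by
  simp [tupCone]

theorem tupBdry_cone_zero (b : E) (c : (Fin 0 → E) →₀ ℤ) :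
    tupBdry E 0 (tupCone b 0 c) = c := by
  refine LinearMap.congr_fun (f := (tupBdry E 0).comp (tupCone b 0)) (g := LinearMap.id) ?_ c
  refine Finsupp.lhom_ext' fun v => LinearMap.ext_ring ?_
  simp only [LinearMap.comp_apply, Finsupp.lsingle_apply, tupCone_single, tupBdry_single,
    LinearMap.id_apply]
  rw [Fin.sum_univ_succ, Finset.univ_eq_empty, Finset.sum_empty, add_zero, Fin.val_zero, pow_zero,
    one_smul]
  congr 1

theorem tupBdry_cone (b : E) (k : ℕ) (c : (Fin (k + 1) → E) →₀ ℤ) :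
    tupBdry E (k + 1) (tupCone b (k + 1) c) = c - tupCone b k (tupBdry E k c) := by
  refine LinearMap.congr_fun (f := (tupBdry E (k + 1)).comp (tupCone b (k + 1)))
    (g := LinearMap.id - (tupCone b k).comp (tupBdry E k)) ?_ c
  refine Finsupp.lhom_ext' fun v => LinearMap.ext_ring ?_
  simp only [LinearMap.comp_apply, Finsupp.lsingle_apply, tupCone_single, tupBdry_single,
    LinearMap.id_apply, LinearMap.sub_apply, map_sum, map_smul]
  rw [Fin.sum_univ_succ, sub_eq_add_neg, ← Finset.sum_neg_distrib]
  congr 1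
  · simp only [Fin.val_zero, pow_zero, one_smul]
    congr 1
  · refine Finset.sum_congr rfl fun i _ => ?_
    rw [Fin.val_succ, pow_succ, mul_neg_one, neg_smul]
    congr 3
    funext j
    refine Fin.cases ?_ (fun j => ?_) j <;> simp

/-- Every tuple is a cone, so `∂ ∂ = 0` follows by induction from the cone formula. -/
theorem tupBdry_bdry (k : ℕ) (c : (Fin (k + 2) → E) →₀ ℤ) :
    tupBdry E k (tupBdry E (k + 1) c) = 0 := by
  induction k with
  | zero =>
    refine LinearMap.congr_fun (f := (tupBdry E 0).comp (tupBdry E 1)) (g := 0) ?_ c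
    refine Finsupp.lhom_ext' fun v => LinearMap.ext_ring ?_
    simp only [LinearMap.comp_apply, Finsupp.lsingle_apply, LinearMap.zero_apply]
    rw [← Fin.cons_self_tail v, ← tupCone_single, tupBdry_cone, map_sub, tupBdry_cone_zero,
      sub_self]
  | succ k ih =>
    refine LinearMap.congr_fun (f := (tupBdry E (k + 1)).comp (tupBdry E (k + 2))) (g := 0) ?_ c
    refine Finsupp.lhom_ext' fun v => LinearMap.ext_ring ?_
    simp only [LinearMap.comp_apply, Finsupp.lsingle_apply, LinearMap.zero_apply]
    rw [← Fin.cons_self_tail v, ← tupCone_single, tupBdry_cone, map_sub, tupBdry_cone, ih,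
      map_zero, sub_zero, sub_self]

/-- The map on chains of tuples induced by a map of vertices. -/
noncomputable def tupMap (f : E → E') (k : ℕ) : ((Fin k → E) →₀ ℤ) →ₗ[ℤ] ((Fin k → E') →₀ ℤ) :=
  Finsupp.lmapDomain ℤ ℤ (f ∘ ·)

theorem tupMap_single (f : E → E') {k : ℕ} (v : Fin k → E) (a : ℤ) :
    tupMap f k (Finsupp.single v a) = Finsupp.single (f ∘ v) a := by
  simp [tupMap]

theorem tupMap_bdry (f : E → E') (k : ℕ) (c : (Fin (k + 1) → E) →₀ ℤ) :
    tupMap f k (tupBdry E k c) = tupBdry E' k (tupMap f (k + 1) c) := by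
  refine LinearMap.congr_fun (f := (tupMap f k).comp (tupBdry E k))
    (g := (tupBdry E' k).comp (tupMap f (k + 1))) ?_ c
  refine Finsupp.lhom_ext' fun v => LinearMap.ext_ring ?_
  simp only [LinearMap.comp_apply, Finsupp.lsingle_apply, tupBdry_single, tupMap_single, map_sum,
    map_smul, Function.comp_assoc]

theorem tupMap_cone (f : E → E') (b : E) (k : ℕ) (c : (Fin k → E) →₀ ℤ) :
    tupMap f (k + 1) (tupCone b k c) = tupCone (f b) k (tupMap f k c) := by
  refine LinearMap.congr_fun (f := (tupMap f (k + 1)).comp (tupCone b k))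
    (g := (tupCone (f b) k).comp (tupMap f k)) ?_ c
  refine Finsupp.lhom_ext' fun v => LinearMap.ext_ring ?_
  simp only [LinearMap.comp_apply, Finsupp.lsingle_apply, tupCone_single, tupMap_single]
  congr 1
  funext j
  refine Fin.cases ?_ (fun j => ?_) j <;> simp

variable (bary : ∀ k : ℕ, (Fin (k + 1) → E) → E) (bary' : ∀ k : ℕ, (Fin (k + 1) → E') → E')

/-- The subdivision operator attached to a choice of barycenters: cone off the subdivided boundary
from the barycenter. -/
noncomputable def tupSd : ∀ k : ℕ, ((Fin k → E) →₀ ℤ) →ₗ[ℤ] ((Fin k → E) →₀ ℤ)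
  | 0 => LinearMap.id
  | k + 1 => Finsupp.linearCombination ℤ fun v : Fin (k + 1) → E =>
      tupCone (bary k v) k (tupSd k (tupBdry E k (Finsupp.single v 1)))

/-- The chain homotopy between the identity and subdivision. -/
noncomputable def tupHt : ∀ k : ℕ, ((Fin k → E) →₀ ℤ) →ₗ[ℤ] ((Fin (k + 1) → E) →₀ ℤ)
  | 0 => 0
  | k + 1 => Finsupp.linearCombination ℤ fun v : Fin (k + 1) → E =>
      tupCone (bary k v) (k + 1)
        (Finsupp.single v 1 - tupHt k (tupBdry E k (Finsupp.single v 1)))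

theorem tupSd_single {k : ℕ} (v : Fin (k + 1) → E) :
    tupSd bary (k + 1) (Finsupp.single v 1) =
      tupCone (bary k v) k (tupSd bary k (tupBdry E k (Finsupp.single v 1))) := by
  simp [tupSd]

theorem tupHt_single {k : ℕ} (v : Fin (k + 1) → E) :
    tupHt bary (k + 1) (Finsupp.single v 1) = tupCone (bary k v) (k + 1)
        (Finsupp.single v 1 - tupHt bary k (tupBdry E k (Finsupp.single v 1))) := by
  simp [tupHt]

theorem tupBdry_sd (k : ℕ) (c : (Fin (k + 1) → E) →₀ ℤ) :
    tupBdry E k (tupSd bary (k + 1) c) = tupSd bary k (tupBdry E k c) := by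
  refine LinearMap.congr_fun (f := (tupBdry E k).comp (tupSd bary (k + 1)))
    (g := (tupSd bary k).comp (tupBdry E k)) ?_ c
  refine Finsupp.lhom_ext' fun v => LinearMap.ext_ring ?_
  simp only [LinearMap.comp_apply, Finsupp.lsingle_apply, tupSd_single]
  induction k with
  | zero => rw [tupBdry_cone_zero]
  | succ k ih =>
    have ih' : ∀ c, tupBdry E k (tupSd bary (k + 1) c) = tupSd bary k (tupBdry E k c) := by
      intro c
      refine LinearMap.congr_fun (f := (tupBdry E k).comp (tupSd bary (k + 1)))
        (g := (tupSd bary k).comp (tupBdry E k)) ?_ c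
      refine Finsupp.lhom_ext' fun v => LinearMap.ext_ring ?_
      simp only [LinearMap.comp_apply, Finsupp.lsingle_apply, tupSd_single]
      exact ih (Finsupp.single v 1) v
    rw [tupBdry_cone, ih', tupBdry_bdry, map_zero, map_zero, sub_zero]

theorem tupBdry_ht (k : ℕ) (c : (Fin (k + 1) → E) →₀ ℤ) :
    tupBdry E (k + 1) (tupHt bary (k + 1) c) =
      c - tupSd bary (k + 1) c - tupHt bary k (tupBdry E k c) := by
  refine LinearMap.congr_fun (f := (tupBdry E (k + 1)).comp (tupHt bary (k + 1)))
    (g := LinearMap.id - tupSd bary (k + 1) - (tupHt bary k).comp (tupBdry E k)) ?_ c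
  induction k with
  | zero =>
    refine Finsupp.lhom_ext' fun v => LinearMap.ext_ring ?_
    simp only [LinearMap.comp_apply, Finsupp.lsingle_apply, LinearMap.sub_apply,
      LinearMap.id_apply]
    rw [tupHt_single, tupBdry_cone, tupSd_single]
    simp only [tupSd, tupHt, LinearMap.zero_apply, sub_zero, LinearMap.id_apply]
  | succ k ih =>
    refine Finsupp.lhom_ext' fun v => LinearMap.ext_ring ?_
    have ih' := fun c => LinearMap.congr_fun (ih 0) c
    simp only [LinearMap.comp_apply, LinearMap.sub_apply, LinearMap.id_apply] at ih'
    simp only [LinearMap.comp_apply, Finsupp.lsingle_apply, LinearMap.sub_apply,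
      LinearMap.id_apply]
    rw [tupHt_single, tupBdry_cone, map_sub, ih', tupBdry_bdry, map_zero, sub_zero,
      sub_sub_cancel, ← tupSd_single]
    abel

variable {bary bary'}

theorem tupMap_sd {f : E → E'} (hf : ∀ k v, f (bary k v) = bary' k (f ∘ v)) (k : ℕ)
    (c : (Fin k → E) →₀ ℤ) : tupMap f k (tupSd bary k c) = tupSd bary' k (tupMap f k c) := by
  refine LinearMap.congr_fun (f := (tupMap f k).comp (tupSd bary k))
    (g := (tupSd bary' k).comp (tupMap f k)) ?_ c
  induction k with
  | zero => rfl
  | succ k ih =>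
    refine Finsupp.lhom_ext' fun v => LinearMap.ext_ring ?_
    have ih' := fun c => LinearMap.congr_fun (ih 0) c
    simp only [LinearMap.comp_apply] at ih'
    simp only [LinearMap.comp_apply, Finsupp.lsingle_apply, tupMap_single, tupSd_single,
      tupMap_cone, ih', tupMap_bdry, hf]

theorem tupMap_ht {f : E → E'} (hf : ∀ k v, f (bary k v) = bary' k (f ∘ v)) (k : ℕ)
    (c : (Fin k → E) →₀ ℤ) :
    tupMap f (k + 1) (tupHt bary k c) = tupHt bary' k (tupMap f k c) := by
  refine LinearMap.congr_fun (f := (tupMap f (k + 1)).comp (tupHt bary k))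
    (g := (tupHt bary' k).comp (tupMap f k)) ?_ c
  induction k with
  | zero => simp [tupHt]
  | succ k ih =>
    refine Finsupp.lhom_ext' fun v => LinearMap.ext_ring ?_
    have ih' := fun c => LinearMap.congr_fun (ih 0) c
    simp only [LinearMap.comp_apply] at ih'
    simp only [LinearMap.comp_apply, Finsupp.lsingle_apply, tupMap_single, tupHt_single,
      tupMap_cone, ih', tupMap_bdry, hf, map_sub]

variable (bary)

/-- Iterated subdivision. -/
noncomputable def tupSdIter (N k : ℕ) : ((Fin k → E) →₀ ℤ) →ₗ[ℤ] ((Fin k → E) →₀ ℤ) :=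
  tupSd bary k ^ N

/-- The chain homotopy between the identity and iterated subdivision. -/
noncomputable def tupHtIter : ∀ _ k : ℕ, ((Fin k → E) →₀ ℤ) →ₗ[ℤ] ((Fin (k + 1) → E) →₀ ℤ)
  | 0, _ => 0
  | N + 1, k => tupHtIter N k + (tupHt bary k).comp (tupSdIter bary N k)

theorem tupSdIter_succ (N k : ℕ) (c : (Fin k → E) →₀ ℤ) :
    tupSdIter bary (N + 1) k c = tupSd bary k (tupSdIter bary N k c) := by
  simp only [tupSdIter, pow_succ', Module.End.mul_apply]

theorem tupBdry_sdIter (N k : ℕ) (c : (Fin (k + 1) → E) →₀ ℤ) :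
    tupBdry E k (tupSdIter bary N (k + 1) c) = tupSdIter bary N k (tupBdry E k c) := by
  induction N with
  | zero => rfl
  | succ N ih => rw [tupSdIter_succ, tupBdry_sd, ih, tupSdIter_succ]

theorem tupHtIter_zero_right (N : ℕ) : tupHtIter bary N 0 = 0 := by
  induction N with
  | zero => rfl
  | succ N ih => rw [tupHtIter, ih, tupHt, LinearMap.zero_comp, add_zero]

theorem tupBdry_htIter (N k : ℕ) (c : (Fin (k + 1) → E) →₀ ℤ) :
    tupBdry E (k + 1) (tupHtIter bary N (k + 1) c) =
      c - tupSdIter bary N (k + 1) c - tupHtIter bary N k (tupBdry E k c) := by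
  induction N with
  | zero => simp [tupHtIter, tupSdIter]
  | succ N ih =>
    simp only [tupHtIter, LinearMap.add_apply, LinearMap.comp_apply, map_add, ih, tupBdry_ht,
      tupBdry_sdIter, tupSdIter_succ]
    abel

variable {bary}

theorem tupMap_sdIter {f : E → E'} (hf : ∀ k v, f (bary k v) = bary' k (f ∘ v)) (N k : ℕ)
    (c : (Fin k → E) →₀ ℤ) :
    tupMap f k (tupSdIter bary N k c) = tupSdIter bary' N k (tupMap f k c) := by
  induction N with
  | zero => rfl
  | succ N ih => rw [tupSdIter_succ, tupMap_sd hf, ih, tupSdIter_succ]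

theorem tupMap_htIter {f : E → E'} (hf : ∀ k v, f (bary k v) = bary' k (f ∘ v)) (N k : ℕ)
    (c : (Fin k → E) →₀ ℤ) :
    tupMap f (k + 1) (tupHtIter bary N k c) = tupHtIter bary' N k (tupMap f k c) := by
  induction N with
  | zero => simp [tupHtIter]
  | succ N ih =>
    simp only [tupHtIter, LinearMap.add_apply, LinearMap.comp_apply, map_add, ih, tupMap_ht hf,
      tupMap_sdIter hf]

end Tuples

/-! ### The mesh of iterated subdivisions -/

section Mesh

variable {E : Type*} [PseudoMetricSpace E] {bary : ∀ k : ℕ, (Fin (k + 1) → E) → E}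

/-- The tuples `w` of mesh at most `r` whose vertices are no farther from any point than
those of `v` (this replaces membership of the convex hull). -/
def meshSet {k l : ℕ} (v : Fin l → E) (r : ℝ) : Set (Fin k → E) :=
  {w | (∀ i j, dist (w i) (w j) ≤ r) ∧
    ∀ (z : E) (R : ℝ), (∀ i, dist z (v i) ≤ R) → ∀ j, dist z (w j) ≤ R}

/-- Barycenters are compatible with the metric: balls are convex, and the barycenter of a tuple of
diameter `δ` with `k + 1` entries has distance at most `k / (k + 1) * δ` to the entries. -/
structure MetricBary (bary : ∀ k : ℕ, (Fin (k + 1) → E) → E) : Prop where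
  convex : ∀ k v (z : E) (R : ℝ), (∀ i, dist z (v i) ≤ R) → dist z (bary k v) ≤ R
  contract : ∀ k v (δ : ℝ), (∀ i j, dist (v i) (v j) ≤ δ) →
    ∀ i, dist (bary k v) (v i) ≤ (k / (k + 1) : ℝ) * δ

/-- The factor by which subdivision shrinks tuples with `k` entries, namely `(k - 1) / k` in
truncated subtraction. -/
noncomputable def meshFactor (k : ℕ) : ℝ := ((k - 1 : ℕ) : ℝ) / ((k - 1 : ℕ) + 1)

theorem meshFactor_nonneg (k : ℕ) : 0 ≤ meshFactor k := by
  unfold meshFactor; positivity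

theorem meshFactor_lt_one (k : ℕ) : meshFactor k < 1 := by
  unfold meshFactor
  rw [div_lt_one (by positivity)]
  linarith

theorem meshFactor_mono (k : ℕ) : meshFactor k ≤ meshFactor (k + 1) := by
  cases k with
  | zero => simp [meshFactor]
  | succ k =>
    simp only [meshFactor, Nat.add_sub_cancel]
    rw [div_le_div_iff₀ (by positivity) (by positivity)]
    push_cast
    nlinarith

theorem tupSd_mem_meshSet (hb : MetricBary bary) (k : ℕ) (v : Fin k → E) (δ : ℝ) (hδ : 0 ≤ δ)
    (hv : ∀ i j, dist (v i) (v j) ≤ δ) :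
    tupSd bary k (Finsupp.single v 1) ∈
      Finsupp.supported ℤ ℤ (meshSet v (meshFactor k * δ)) := by
  induction k with
  | zero =>
    refine Finsupp.single_mem_supported ℤ _ ⟨fun i => i.elim0, fun _ _ _ j => j.elim0⟩
  | succ k ih =>
    rw [tupSd_single, tupBdry_single, map_sum, map_sum]
    refine Submodule.sum_mem _ fun i _ => ?_
    rw [map_zsmul, map_zsmul]
    refine zsmul_mem ?_ _
    have h := ih (v ∘ i.succAbove) fun a b => hv _ _
    have hle : Finsupp.supported ℤ ℤ (meshSet (k := k) (v ∘ i.succAbove) (meshFactor k * δ)) ≤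
        (Finsupp.supported ℤ ℤ (meshSet v (meshFactor (k + 1) * δ))).comap
          (tupCone (bary k v) k) := by
      rw [Finsupp.supported_eq_span_single, Submodule.span_le]
      rintro _ ⟨w, ⟨hw1, hw2⟩, rfl⟩
      rw [SetLike.mem_coe, Submodule.mem_comap, tupCone_single]
      refine Finsupp.single_mem_supported ℤ _ ?_
      have hbw : ∀ j, dist (bary k v) (w j) ≤ meshFactor (k + 1) * δ := fun j =>
        hw2 _ _ (fun a => by
          have := hb.contract k v δ hv (i.succAbove a)
          simpa [meshFactor] using this) j
      have hnn : 0 ≤ meshFactor (k + 1) * δ := mul_nonneg (meshFactor_nonneg _) hδ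
      refine ⟨fun a b => ?_, fun z R hz j => ?_⟩
      · refine Fin.cases ?_ (fun a => ?_) a <;> refine Fin.cases ?_ (fun b => ?_) b
        · simpa using hnn
        · simpa using hbw b
        · simpa [dist_comm] using hbw a
        · simpa using (hw1 a b).trans
            (mul_le_mul_of_nonneg_right (meshFactor_mono k) hδ)
      · refine Fin.cases ?_ (fun j => ?_) j
        · simpa using hb.convex k v z R hz
        · simpa using hw2 z R (fun a => hz _) j
    exact hle h

theorem tupSdIter_mem_meshSet (hb : MetricBary bary) (N k : ℕ) (v : Fin k → E) (δ : ℝ) (hδ : 0 ≤ δ)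
    (hv : ∀ i j, dist (v i) (v j) ≤ δ) :
    tupSdIter bary N k (Finsupp.single v 1) ∈
      Finsupp.supported ℤ ℤ (meshSet v (meshFactor k ^ N * δ)) := by
  induction N with
  | zero =>
    refine Finsupp.single_mem_supported ℤ _ ⟨by simpa using hv, fun _ _ h => h⟩
  | succ N ih =>
    rw [tupSdIter_succ]
    have hle : Finsupp.supported ℤ ℤ (meshSet (k := k) v (meshFactor k ^ N * δ)) ≤
        (Finsupp.supported ℤ ℤ (meshSet v (meshFactor k ^ (N + 1) * δ))).comap
          (tupSd bary k) := by
      rw [Finsupp.supported_eq_span_single, Submodule.span_le]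
      rintro _ ⟨w, ⟨hw1, hw2⟩, rfl⟩
      rw [SetLike.mem_coe, Submodule.mem_comap]
      refine Finsupp.supported_mono ?_ (tupSd_mem_meshSet hb k w _
        (mul_nonneg (pow_nonneg (meshFactor_nonneg k) N) hδ) hw1)
      rintro u ⟨hu1, hu2⟩
      refine ⟨fun a b => (hu1 a b).trans (le_of_eq (by ring)), fun z R hz => ?_⟩
      exact hu2 z R (hw2 z R hz)
    exact hle ih

end Mesh

/-! ### Subdivision of singular chains -/

section Subdivision

/-- The affine map between standard simplices with prescribed vertices. -/
noncomputable def stdCombo {k m : ℕ} (v : Fin k → stdSimplex ℝ (Fin m)) :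
    C(stdSimplex ℝ (Fin k), stdSimplex ℝ (Fin m)) where
  toFun t := ⟨∑ i, t i • (v i : Fin m → ℝ),
    (convex_stdSimplex ℝ (Fin m)).sum_mem (fun i _ => t.2.1 i) t.2.2 fun i _ => (v i).2⟩
  continuous_toFun := by
    refine Continuous.subtype_mk ?_ _
    exact continuous_finsetSum _ fun i _ => Continuous.smul
      (f := fun t : stdSimplex ℝ (Fin k) => t.1 i)
      ((continuous_apply i).comp continuous_subtype_val) continuous_const

theorem stdCombo_coe {k m : ℕ} (v : Fin k → stdSimplex ℝ (Fin m)) (t : stdSimplex ℝ (Fin k)) :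
    (stdCombo v t : Fin m → ℝ) = ∑ i, t i • (v i : Fin m → ℝ) := rfl

theorem stdFace_apply_succAbove {k : ℕ} (i : Fin (k + 1)) (t : stdSimplex ℝ (Fin k)) (j : Fin k) :
    stdFace i t (i.succAbove j) = t j := by
  change FunOnFinite.linearMap ℝ ℝ i.succAbove t (i.succAbove j) = t j
  rw [FunOnFinite.linearMap_apply_apply]
  simp [Finset.filter_eq']

theorem stdFace_apply_self {k : ℕ} (i : Fin (k + 1)) (t : stdSimplex ℝ (Fin k)) :
    stdFace i t i = 0 := by
  change FunOnFinite.linearMap ℝ ℝ i.succAbove t i = 0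
  rw [FunOnFinite.linearMap_apply_apply]
  simp [Fin.succAbove_ne]

theorem stdCombo_face {k m : ℕ} (v : Fin (k + 1) → stdSimplex ℝ (Fin m)) (i : Fin (k + 1)) :
    (stdCombo v).comp (stdFace i) = stdCombo (v ∘ i.succAbove) := by
  ext t : 1
  apply Subtype.ext
  change (∑ j, stdFace i t j • (v j : Fin m → ℝ)) = ∑ j, t j • (v (i.succAbove j) : Fin m → ℝ)
  rw [Fin.sum_univ_succAbove _ i, stdFace_apply_self, zero_smul, zero_add]
  simp only [stdFace_apply_succAbove]

theorem stdFace_combo {k m : ℕ} (v : Fin k → stdSimplex ℝ (Fin m)) (i : Fin (m + 1)) :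
    (stdFace i).comp (stdCombo v) = stdCombo (stdFace i ∘ v) := by
  ext t : 1
  apply Subtype.ext
  change FunOnFinite.linearMap ℝ ℝ i.succAbove (∑ j, t j • (v j : Fin m → ℝ)) =
    ∑ j, t j • FunOnFinite.linearMap ℝ ℝ i.succAbove (v j : Fin m → ℝ)
  simp only [map_sum, map_smul]

theorem stdCombo_vertex (m : ℕ) :
    stdCombo (stdSimplex.vertex (S := ℝ) (X := Fin m)) = ContinuousMap.id _ := by
  ext t : 1
  apply Subtype.ext
  change ∑ i, t i • (Pi.single i 1 : Fin m → ℝ) = (t : Fin m → ℝ)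
  ext j
  simp [Finset.sum_apply, Pi.single_apply]

/-- The barycenter of a tuple of points of a standard simplex. -/
noncomputable def stdBary (m k : ℕ) (v : Fin (k + 1) → stdSimplex ℝ (Fin m)) :
    stdSimplex ℝ (Fin m) :=
  stdCombo v stdSimplex.barycenter

theorem stdFace_bary {m : ℕ} (i : Fin (m + 1)) (k : ℕ) (v : Fin (k + 1) → stdSimplex ℝ (Fin m)) :
    stdFace i (stdBary m k v) = stdBary (m + 1) k (stdFace i ∘ v) :=
  congrArg (fun f => f stdSimplex.barycenter) (stdFace_combo v i)

theorem dist_stdCombo_le {k m : ℕ} (v : Fin k → stdSimplex ℝ (Fin m)) (z : stdSimplex ℝ (Fin m))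
    {R : ℝ} (h : ∀ i, dist z (v i) ≤ R) (t : stdSimplex ℝ (Fin k)) : dist z (stdCombo v t) ≤ R := by
  have : (stdCombo v t : Fin m → ℝ) ∈ Metric.closedBall (z : Fin m → ℝ) R := by
    refine (convex_closedBall _ _).sum_mem (fun i _ => t.2.1 i) t.2.2 fun i _ => ?_
    rw [Metric.mem_closedBall, dist_comm]
    exact h i
  rw [Metric.mem_closedBall, dist_comm] at this
  exact this

theorem metricBary_stdBary (m : ℕ) : MetricBary (stdBary m) where
  convex k v z R h := dist_stdCombo_le v z h _
  contract k v δ h i := by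
    have hδ : 0 ≤ δ := dist_nonneg.trans (h i i)
    rw [Subtype.dist_eq, dist_eq_norm]
    have hk : ((k : ℝ) + 1) ≠ 0 := by positivity
    have h1 : ((stdBary m k v : stdSimplex ℝ (Fin m)) : Fin m → ℝ) - (v i : Fin m → ℝ) =
        ∑ j ∈ Finset.univ.erase i, ((k : ℝ) + 1)⁻¹ • ((v j : Fin m → ℝ) - (v i : Fin m → ℝ)) := by
      have h2 : ((stdBary m k v : stdSimplex ℝ (Fin m)) : Fin m → ℝ) =
          ∑ j, ((k : ℝ) + 1)⁻¹ • (v j : Fin m → ℝ) := by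
        rw [stdBary, stdCombo_coe]
        refine Finset.sum_congr rfl fun j _ => ?_
        congr 1
        change ((Fintype.card (Fin (k + 1)) : ℝ))⁻¹ = _
        simp
      have h3 : (v i : Fin m → ℝ) = ∑ j : Fin (k + 1), ((k : ℝ) + 1)⁻¹ • (v i : Fin m → ℝ) := by
        rw [Finset.sum_const, Finset.card_univ, Fintype.card_fin, ← Nat.cast_smul_eq_nsmul ℝ,
          smul_smul]
        push_cast
        rw [mul_inv_cancel₀ hk, one_smul]
      rw [h2]
      nth_rewrite 1 [h3]
      rw [← Finset.sum_sub_distrib, ← Finset.sum_erase_add _ _ (Finset.mem_univ i), sub_self,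
        add_zero]
      exact Finset.sum_congr rfl fun j _ => (smul_sub _ _ _).symm
    refine (congrArg norm h1).trans_le ?_
    refine (norm_sum_le _ _).trans ?_
    have h4 : ∀ j ∈ Finset.univ.erase i,
        ‖((k : ℝ) + 1)⁻¹ • ((v j : Fin m → ℝ) - (v i : Fin m → ℝ))‖ ≤ ((k : ℝ) + 1)⁻¹ * δ := by
      intro j _
      rw [norm_smul, Real.norm_of_nonneg (by positivity), ← dist_eq_norm]
      exact mul_le_mul_of_nonneg_left (h j i) (by positivity)
    refine (Finset.sum_le_sum h4).trans (le_of_eq ?_)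
    rw [Finset.sum_const, Finset.card_erase_of_mem (Finset.mem_univ _), Finset.card_univ,
      Fintype.card_fin, nsmul_eq_mul, Nat.add_sub_cancel]
    ring

variable {X : Type*} [TopologicalSpace X]

/-- Affine chains in a standard simplex, pushed forward along a singular simplex. -/
noncomputable def affPush {m : ℕ} (σ : SingSimplex m X) (k : ℕ) :
    ((Fin k → stdSimplex ℝ (Fin m)) →₀ ℤ) →ₗ[ℤ] AugChain k X :=
  Finsupp.lmapDomain ℤ ℤ fun v => σ.comp (stdCombo v)

theorem affPush_single {m : ℕ} (σ : SingSimplex m X) {k : ℕ} (v : Fin k → stdSimplex ℝ (Fin m))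
    (a : ℤ) : affPush σ k (Finsupp.single v a) = Finsupp.single (σ.comp (stdCombo v)) a := by
  simp [affPush]

theorem affPush_bdry {m : ℕ} (σ : SingSimplex m X) (k : ℕ)
    (c : (Fin (k + 1) → stdSimplex ℝ (Fin m)) →₀ ℤ) :
    affPush σ k (tupBdry _ k c) = augBdry k X (affPush σ (k + 1) c) := by
  refine LinearMap.congr_fun (f := (affPush σ k).comp (tupBdry _ k))
    (g := (augBdry k X).comp (affPush σ (k + 1))) ?_ c
  refine Finsupp.lhom_ext' fun v => LinearMap.ext_ring ?_
  simp only [LinearMap.comp_apply, Finsupp.lsingle_apply, tupBdry_single, affPush_single, map_sum,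
    map_smul, augBdry_single, ContinuousMap.comp_assoc, stdCombo_face]

theorem affPush_face {m : ℕ} (σ : SingSimplex (m + 1) X) (i : Fin (m + 1)) (k : ℕ)
    (c : (Fin k → stdSimplex ℝ (Fin m)) →₀ ℤ) :
    affPush σ k (tupMap (stdFace i) k c) = affPush (σ.comp (stdFace i)) k c := by
  refine LinearMap.congr_fun (f := (affPush σ k).comp (tupMap (stdFace i) k))
    (g := affPush (σ.comp (stdFace i)) k) ?_ c
  refine Finsupp.lhom_ext' fun v => LinearMap.ext_ring ?_
  simp only [LinearMap.comp_apply, Finsupp.lsingle_apply, affPush_single, tupMap_single,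
    ContinuousMap.comp_assoc, stdFace_combo]

/-- The affine chain consisting of the standard simplex itself. -/
noncomputable def stdChain (m : ℕ) : (Fin m → stdSimplex ℝ (Fin m)) →₀ ℤ :=
  Finsupp.single stdSimplex.vertex 1

theorem affPush_stdChain {m : ℕ} (σ : SingSimplex m X) :
    affPush σ m (stdChain m) = Finsupp.single σ 1 := by
  rw [stdChain, affPush_single, stdCombo_vertex, ContinuousMap.comp_id]

theorem tupBdry_stdChain (m : ℕ) : tupBdry _ m (stdChain (m + 1)) =
    ∑ i : Fin (m + 1), (-1 : ℤ) ^ (i : ℕ) • tupMap (stdFace i) m (stdChain m) := by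
  rw [stdChain, tupBdry_single]
  refine Finset.sum_congr rfl fun i _ => ?_
  rw [stdChain, tupMap_single]
  congr 2
  funext j
  exact (stdSimplex.map_vertex i.succAbove j).symm

theorem augBdry_bdry (k : ℕ) (c : AugChain (k + 2) X) :
    augBdry k X (augBdry (k + 1) X c) = 0 := by
  refine LinearMap.congr_fun (f := (augBdry k X).comp (augBdry (k + 1) X)) (g := 0) ?_ c
  refine Finsupp.lhom_ext' fun σ => LinearMap.ext_ring ?_
  simp only [LinearMap.comp_apply, Finsupp.lsingle_apply, LinearMap.zero_apply]
  rw [← affPush_stdChain, ← affPush_bdry, ← affPush_bdry, tupBdry_bdry, map_zero]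

variable (X)

/-- Iterated barycentric subdivision of singular chains. -/
noncomputable def augSd (N k : ℕ) : AugChain k X →ₗ[ℤ] AugChain k X :=
  Finsupp.linearCombination ℤ fun σ : SingSimplex k X =>
    affPush σ k (tupSdIter (stdBary k) N k (stdChain k))

/-- The chain homotopy between the identity and iterated barycentric subdivision. -/
noncomputable def augHt (N k : ℕ) : AugChain k X →ₗ[ℤ] AugChain (k + 1) X :=
  Finsupp.linearCombination ℤ fun σ : SingSimplex k X =>
    affPush σ (k + 1) (tupHtIter (stdBary k) N k (stdChain k))

variable {X}

theorem augSd_single (N : ℕ) {k : ℕ} (σ : SingSimplex k X) : augSd X N k (Finsupp.single σ 1) =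
    affPush σ k (tupSdIter (stdBary k) N k (stdChain k)) := by
  simp [augSd]

theorem augHt_single (N : ℕ) {k : ℕ} (σ : SingSimplex k X) : augHt X N k (Finsupp.single σ 1) =
    affPush σ (k + 1) (tupHtIter (stdBary k) N k (stdChain k)) := by
  simp [augHt]

theorem augHt_zero_right (N : ℕ) : augHt X N 0 = 0 := by
  refine Finsupp.lhom_ext' fun σ => LinearMap.ext_ring ?_
  simp only [LinearMap.comp_apply, Finsupp.lsingle_apply, augHt_single, tupHtIter_zero_right,
    LinearMap.zero_apply, map_zero]

theorem augBdry_ht (N k : ℕ) (c : AugChain (k + 1) X) :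
    augBdry (k + 1) X (augHt X N (k + 1) c) =
      c - augSd X N (k + 1) c - augHt X N k (augBdry k X c) := by
  refine LinearMap.congr_fun (f := (augBdry (k + 1) X).comp (augHt X N (k + 1)))
    (g := LinearMap.id - augSd X N (k + 1) - (augHt X N k).comp (augBdry k X)) ?_ c
  refine Finsupp.lhom_ext' fun σ => LinearMap.ext_ring ?_
  simp only [LinearMap.comp_apply, Finsupp.lsingle_apply, LinearMap.sub_apply, LinearMap.id_apply]
  rw [augHt_single, ← affPush_bdry, tupBdry_htIter, map_sub, map_sub, affPush_stdChain,
    augSd_single, tupBdry_stdChain, augBdry_single]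
  simp only [map_sum, map_zsmul, augHt_single]
  congr 1
  refine Finset.sum_congr rfl fun i _ => ?_
  rw [← tupMap_htIter (stdFace_bary i), affPush_face]

/-- The chains all of whose simplices lie in `A`. -/
def carriedBy (k : ℕ) (A : Set X) : Submodule ℤ (AugChain k X) :=
  Finsupp.supported ℤ ℤ {σ | ∀ t, σ t ∈ A}

theorem affPush_mem_carriedBy {m : ℕ} (σ : SingSimplex m X) {A : Set X} (hσ : ∀ t, σ t ∈ A) (k : ℕ)
    (c : (Fin k → stdSimplex ℝ (Fin m)) →₀ ℤ) : affPush σ k c ∈ carriedBy k A := by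
  induction c using Finsupp.induction_linear with
  | zero => simp
  | add c d hc hd => rw [map_add]; exact add_mem hc hd
  | single v a =>
    rw [affPush_single]
    exact Finsupp.single_mem_supported ℤ _ fun t => hσ _

theorem carriedBy_mono {k : ℕ} {A B : Set X} (h : A ⊆ B) : carriedBy k A ≤ carriedBy k B :=
  Finsupp.supported_mono fun _ hσ t => h (hσ t)

/-- A linear map out of augmented chains maps chains carried by `A` into `p` as soon as
it does so for simplices. -/
theorem map_mem_of_carriedBy {k : ℕ} {A : Set X} {N : Type*} [AddCommGroup N]
    (f : AugChain k X →ₗ[ℤ] N) (p : Submodule ℤ N)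
    (h : ∀ σ : SingSimplex k X, (∀ t, σ t ∈ A) → f (Finsupp.single σ 1) ∈ p)
    {c : AugChain k X} (hc : c ∈ carriedBy k A) : f c ∈ p := by
  have : carriedBy k A ≤ p.comap f := by
    rw [carriedBy, Finsupp.supported_eq_span_single, Submodule.span_le]
    rintro _ ⟨σ, hσ, rfl⟩
    exact h σ hσ
  exact this hc

theorem augHt_mem_carriedBy {A : Set X} (N k : ℕ) {c : AugChain k X} (hc : c ∈ carriedBy k A) :
    augHt X N k c ∈ carriedBy (k + 1) A :=
  map_mem_of_carriedBy _ _ (fun σ hσ => by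
    rw [augHt_single]; exact affPush_mem_carriedBy σ hσ _ _) hc

end Subdivision

section SmallChains

variable {X : Type*} [PseudoMetricSpace X]

/-- The chains all of whose simplices lie in `A` and have points at mutual distance less
than `ε`. -/
def smallChains (k : ℕ) (A : Set X) (ε : ℝ) : Submodule ℤ (AugChain k X) :=
  Finsupp.supported ℤ ℤ {σ | (∀ t, σ t ∈ A) ∧ ∀ s t, dist (σ s) (σ t) < ε}

theorem exists_augSd_single_small {k : ℕ} (σ : SingSimplex k X) {A : Set X} (hσ : ∀ t, σ t ∈ A)
    {ε : ℝ} (hε : 0 < ε) :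
    ∃ N₀, ∀ N ≥ N₀, augSd X N k (Finsupp.single σ 1) ∈ smallChains k A ε := by
  have huc : UniformContinuous σ := CompactSpace.uniformContinuous_of_continuous σ.continuous
  obtain ⟨δ, hδ, hσδ⟩ := Metric.uniformContinuous_iff.1 huc ε hε
  obtain ⟨D, hD⟩ : ∃ D, ∀ s t : stdSimplex ℝ (Fin k), dist s t ≤ D :=
    ⟨_, fun s t => Metric.dist_le_diam_of_mem (isCompact_univ.isBounded) (Set.mem_univ s)
      (Set.mem_univ t)⟩
  have hlim : Filter.Tendsto (fun N : ℕ => meshFactor k ^ N * |D|) Filter.atTop (nhds (0 * |D|)) :=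
    (tendsto_pow_atTop_nhds_zero_of_lt_one (meshFactor_nonneg k) (meshFactor_lt_one k)).mul_const _
  rw [zero_mul] at hlim
  obtain ⟨N₀, hN₀⟩ := Filter.eventually_atTop.1 (hlim.eventually (gt_mem_nhds hδ))
  refine ⟨N₀, fun N hN => ?_⟩
  rw [augSd_single]
  have hmem := tupSdIter_mem_meshSet (metricBary_stdBary k) N k stdSimplex.vertex |D| (abs_nonneg D)
    fun i j => (hD _ _).trans (le_abs_self D)
  have hle : Finsupp.supported ℤ ℤ (meshSet (k := k) (stdSimplex.vertex (S := ℝ) (X := Fin k))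
      (meshFactor k ^ N * |D|)) ≤ (smallChains k A ε).comap (affPush σ k) := by
    rw [Finsupp.supported_eq_span_single, Submodule.span_le]
    rintro _ ⟨w, ⟨hw, -⟩, rfl⟩
    rw [SetLike.mem_coe, Submodule.mem_comap, affPush_single]
    refine Finsupp.single_mem_supported ℤ _ ⟨fun t => hσ _, fun s t => hσδ ?_⟩
    refine lt_of_le_of_lt ?_ (hN₀ N hN)
    refine dist_stdCombo_le w _ (fun i => ?_) t
    rw [dist_comm]
    exact dist_stdCombo_le w _ (fun j => hw i j) s
  exact hle hmem

/-- Small chains suffice: a cycle carried by `A` is homologous inside `A` to one whose simplices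
are as small as desired. In the lowest degree every chain counts as a cycle. -/
theorem exists_small_homologous {k : ℕ} {A : Set X} {c : AugChain (k + 1) X}
    (hc : c ∈ carriedBy (k + 1) A) (hcyc : k = 0 ∨ augBdry k X c = 0) {ε : ℝ} (hε : 0 < ε) :
    ∃ c' ∈ smallChains (k + 1) A ε, (k = 0 ∨ augBdry k X c' = 0) ∧
      ∃ b ∈ carriedBy (k + 2) A, augBdry (k + 1) X b = c - c' := by
  have hN : ∃ N₀, ∀ N ≥ N₀, augSd X N (k + 1) c ∈ smallChains (k + 1) A ε := by
    have hc' := hc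
    rw [carriedBy, Finsupp.supported_eq_span_single] at hc'
    clear hc hcyc
    induction hc' using Submodule.span_induction with
    | mem x hx =>
      obtain ⟨σ, hσ, rfl⟩ := hx
      exact exists_augSd_single_small σ hσ hε
    | zero => exact ⟨0, fun N _ => by simp⟩
    | add x y _ _ hx hy =>
      obtain ⟨N, hN⟩ := hx
      obtain ⟨N', hN'⟩ := hy
      refine ⟨max N N', fun n hn => ?_⟩
      rw [map_add]
      exact add_mem (hN n (le_trans (le_max_left _ _) hn)) (hN' n (le_trans (le_max_right _ _) hn))
    | smul a x _ hx =>
      obtain ⟨N, hN⟩ := hx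
      refine ⟨N, fun n hn => ?_⟩
      rw [map_smul]
      exact Submodule.smul_mem _ _ (hN n hn)
  obtain ⟨N, hN⟩ := hN
  have hb : augBdry (k + 1) X (augHt X N (k + 1) c) = c - augSd X N (k + 1) c := by
    rw [augBdry_ht]
    rcases hcyc with rfl | h
    · rw [augHt_zero_right, LinearMap.zero_apply, sub_zero]
    · rw [h, map_zero, sub_zero]
  refine ⟨augSd X N (k + 1) c, hN N le_rfl, ?_, augHt X N (k + 1) c,
    augHt_mem_carriedBy N _ hc, hb⟩
  rcases hcyc with h | h
  · exact Or.inl h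
  · right
    have := congrArg (augBdry k X) hb
    rw [augBdry_bdry, map_sub, h, zero_sub, eq_comm, neg_eq_zero] at this
    exact this

end SmallChains

/-! ### Cones in convex sets -/

section Cone

variable {E : Type*} [NormedAddCommGroup E] [NormedSpace ℝ E] {S : Set E}

/-- The radial projection of a standard simplex, away from its initial vertex, to the opposite
face. -/
noncomputable def stdTail {k : ℕ} (x : stdSimplex ℝ (Fin (k + 1))) (hx : x 0 < 1) :
    stdSimplex ℝ (Fin k) :=
  ⟨fun j => x j.succ / (1 - x 0), fun j => div_nonneg (x.2.1 _) (by linarith), by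
    have h := x.2.2
    rw [Fin.sum_univ_succ] at h
    rw [← Finset.sum_div, div_eq_one_iff_eq (by linarith)]
    change x 0 + _ = 1 at h
    change ∑ j : Fin k, x.1 j.succ = 1 - x 0
    linarith⟩

theorem stdTail_apply {k : ℕ} (x : stdSimplex ℝ (Fin (k + 1))) (hx : x 0 < 1) (j : Fin k) :
    stdTail x hx j = x j.succ / (1 - x 0) := rfl

open Classical in
/-- The cone on a simplex `σ` with apex `p`, as a map to the ambient vector space. -/
noncomputable def coneFun (p : S) {k : ℕ} (σ : SingSimplex k S) (x : stdSimplex ℝ (Fin (k + 1))) :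
    E :=
  if hx : x 0 < 1 then x 0 • (p : E) + (1 - x 0) • (σ (stdTail x hx) : E) else p

theorem continuous_coord {k : ℕ} (i : Fin k) : Continuous fun x : stdSimplex ℝ (Fin k) => x i :=
  (continuous_apply i).comp continuous_subtype_val

theorem continuous_coneFun (p : S) {k : ℕ} (σ : SingSimplex k S) : Continuous (coneFun p σ) := by
  rw [continuous_iff_continuousAt]
  intro x
  by_cases hx : x 0 < 1
  · have hU : IsOpen {y : stdSimplex ℝ (Fin (k + 1)) | y 0 < 1} :=
      isOpen_lt (continuous_coord 0) continuous_const
    refine ContinuousOn.continuousAt (s := {y | y 0 < 1}) ?_ (hU.mem_nhds hx)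
    rw [continuousOn_iff_continuous_domRestrict]
    have heq : Set.domRestrict {y : stdSimplex ℝ (Fin (k + 1)) | y 0 < 1} (coneFun p σ) =
        fun y => y.1 0 • (p : E) + (1 - y.1 0) • (σ (stdTail y.1 y.2) : E) := by
      funext y
      exact dif_pos y.2
    rw [heq]
    have h0 : Continuous fun y : {y : stdSimplex ℝ (Fin (k + 1)) | y 0 < 1} => y.1 0 :=
      (continuous_coord 0).comp continuous_subtype_val
    have ht : Continuous fun y : {y : stdSimplex ℝ (Fin (k + 1)) | y 0 < 1} =>
        stdTail y.1 y.2 := by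
      refine Continuous.subtype_mk (continuous_pi fun j => ?_) _
      exact ((continuous_coord j.succ).comp continuous_subtype_val).div
        (continuous_const.sub h0) fun y => (sub_pos.2 y.2).ne'
    exact (h0.smul continuous_const).add ((continuous_const.sub h0).smul
      (continuous_subtype_val.comp (σ.continuous.comp ht)))
  · have hx1 : x 0 = 1 := le_antisymm (stdSimplex.le_one x 0) (not_lt.1 hx)
    obtain ⟨C, hC⟩ := (isCompact_univ (X := stdSimplex ℝ (Fin k))).exists_bound_of_continuousOn
      (f := fun t => (σ t : E) - p)
      ((continuous_subtype_val.comp σ.continuous).sub continuous_const).continuousOn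
    have hval : coneFun p σ x = p := dif_neg hx
    rw [ContinuousAt, hval, tendsto_iff_norm_sub_tendsto_zero]
    have hlim : Filter.Tendsto (fun y : stdSimplex ℝ (Fin (k + 1)) => (1 - y 0) * |C|) (nhds x)
        (nhds 0) := by
      have : Filter.Tendsto (fun y : stdSimplex ℝ (Fin (k + 1)) => (1 - y 0) * |C|) (nhds x)
          (nhds ((1 - x 0) * |C|)) :=
        ((continuous_const.sub (continuous_coord 0)).mul continuous_const).tendsto x
      rwa [hx1, sub_self, zero_mul] at this
    refine squeeze_zero (fun _ => norm_nonneg _) (fun y => ?_) hlim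
    have hy1 : 0 ≤ 1 - y 0 := sub_nonneg.2 (stdSimplex.le_one y 0)
    by_cases hy : y 0 < 1
    · rw [coneFun, dif_pos hy]
      have : y 0 • (p : E) + (1 - y 0) • (σ (stdTail y hy) : E) - p =
          (1 - y 0) • ((σ (stdTail y hy) : E) - p) := by module
      rw [this, norm_smul, Real.norm_of_nonneg hy1]
      exact mul_le_mul_of_nonneg_left ((hC _ (Set.mem_univ _)).trans (le_abs_self C)) hy1
    · rw [coneFun, dif_neg hy, sub_self, norm_zero]
      positivity

theorem coneFun_mem (hS : Convex ℝ S) (p : S) {k : ℕ} (σ : SingSimplex k S)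
    (x : stdSimplex ℝ (Fin (k + 1))) : coneFun p σ x ∈ S := by
  by_cases hx : x 0 < 1
  · rw [coneFun, dif_pos hx]
    exact hS p.2 (σ _).2 (x.2.1 0) (by linarith) (by ring)
  · rw [coneFun, dif_neg hx]
    exact p.2

/-- The cone on a singular simplex in a convex set. -/
noncomputable def coneSimplex (hS : Convex ℝ S) (p : S) {k : ℕ} (σ : SingSimplex k S) :
    SingSimplex (k + 1) S :=
  ⟨fun x => ⟨coneFun p σ x, coneFun_mem hS p σ x⟩, (continuous_coneFun p σ).subtype_mk _⟩

theorem coneSimplex_face_zero (hS : Convex ℝ S) (p : S) {k : ℕ} (σ : SingSimplex k S) :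
    (coneSimplex hS p σ).comp (stdFace 0) = σ := by
  ext t
  change coneFun p σ (stdFace 0 t) = σ t
  have h0 : stdFace 0 t 0 = 0 := stdFace_apply_self 0 t
  have hlt : stdFace 0 t 0 < 1 := by rw [h0]; exact one_pos
  have htail : stdTail (stdFace 0 t) hlt = t := by
    ext j
    rw [stdTail_apply, h0, sub_zero, div_one, ← Fin.succAbove_zero_apply, stdFace_apply_succAbove]
  rw [coneFun, dif_pos hlt, htail, h0]
  simp

theorem coneSimplex_face_succ (hS : Convex ℝ S) (p : S) {k : ℕ} (σ : SingSimplex (k + 1) S)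
    (i : Fin (k + 1)) :
    (coneSimplex hS p σ).comp (stdFace i.succ) = coneSimplex hS p (σ.comp (stdFace i)) := by
  ext t
  change coneFun p σ (stdFace i.succ t) = coneFun p (σ.comp (stdFace i)) t
  have h0 : stdFace i.succ t 0 = t 0 := by
    have := stdFace_apply_succAbove i.succ t 0
    rwa [Fin.succ_succAbove_zero] at this
  by_cases ht : t 0 < 1
  · have hlt : stdFace i.succ t 0 < 1 := by rwa [h0]
    have htail : stdTail (stdFace i.succ t) hlt = stdFace i (stdTail t ht) := by
      ext j
      rw [stdTail_apply, h0]
      rcases Fin.eq_self_or_eq_succAbove i j with rfl | ⟨l, rfl⟩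
      · rw [stdFace_apply_self, stdFace_apply_self, zero_div]
      · rw [stdFace_apply_succAbove, stdTail_apply, ← Fin.succ_succAbove_succ,
          stdFace_apply_succAbove]
    rw [coneFun, dif_pos hlt, htail, h0, coneFun, dif_pos ht]
    rfl
  · have hlt : ¬ stdFace i.succ t 0 < 1 := by rwa [h0]
    rw [coneFun, dif_neg hlt, coneFun, dif_neg ht]

/-- In a convex set every cycle of the augmented singular complex bounds its cone. -/
theorem exists_bdry_eq_of_convex (hS : Convex ℝ S) (hne : S.Nonempty) {k : ℕ}
    (c : AugChain (k + 1) S) (hc : augBdry k S c = 0) :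
    ∃ b : AugChain (k + 2) S, augBdry (k + 1) S b = c := by
  obtain ⟨p, hp⟩ := hne
  let cone : ∀ k, AugChain k S →ₗ[ℤ] AugChain (k + 1) S :=
    fun k => Finsupp.lmapDomain ℤ ℤ (coneSimplex hS ⟨p, hp⟩)
  have hcone : ∀ {k} (σ : SingSimplex k S),
      cone k (Finsupp.single σ 1) = Finsupp.single (coneSimplex hS ⟨p, hp⟩ σ) 1 := fun σ => by
    simp [cone]
  have hkey : augBdry (k + 1) S (cone (k + 1) c) = c - cone k (augBdry k S c) := by
    refine LinearMap.congr_fun (f := (augBdry (k + 1) S).comp (cone (k + 1)))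
      (g := LinearMap.id - (cone k).comp (augBdry k S)) ?_ c
    refine Finsupp.lhom_ext' fun σ => LinearMap.ext_ring ?_
    simp only [LinearMap.comp_apply, Finsupp.lsingle_apply, hcone, augBdry_single,
      LinearMap.id_apply, LinearMap.sub_apply, map_sum, map_smul]
    rw [Fin.sum_univ_succ, sub_eq_add_neg, ← Finset.sum_neg_distrib, coneSimplex_face_zero]
    congr 1
    · simp only [Fin.val_zero, pow_zero, one_smul]
    · refine Finset.sum_congr rfl fun i _ => ?_
      rw [Fin.val_succ, pow_succ, mul_neg_one, neg_smul, coneSimplex_face_succ]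
  exact ⟨cone (k + 1) c, by rw [hkey, hc, map_zero, sub_zero]⟩

end Cone

/-! ### Local acyclicity -/

section Acyclic

variable {X Y : Type*} [TopologicalSpace X] [TopologicalSpace Y]

/-- A subset whose reduced singular homology vanishes, at the level of chains. -/
def AcyclicSet (V : Set X) : Prop :=
  ∀ k, ∀ c ∈ carriedBy (k + 1) V, augBdry k X c = 0 →
    ∃ b ∈ carriedBy (k + 2) V, augBdry (k + 1) X b = c

theorem augMap_injective {f : C(X, Y)} (hf : Function.Injective f) (k : ℕ) :
    Function.Injective (augMap f k) :=
  Finsupp.mapDomain_injective fun σ τ h => by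
    ext t
    exact hf (congrArg (fun g : SingSimplex k Y => g t) h)

theorem augMap_mem_carriedBy {f : C(X, Y)} {V : Set Y} (hf : ∀ x, f x ∈ V) {k : ℕ}
    (c : AugChain k X) : augMap f k c ∈ carriedBy k V := by
  induction c using Finsupp.induction_linear with
  | zero => simp
  | add c d hc hd => rw [map_add]; exact add_mem hc hd
  | single v a =>
    rw [augMap_single]
    exact Finsupp.single_mem_supported ℤ _ fun t => hf _

theorem exists_augMap_eq {V : Set X} {k : ℕ} {c : AugChain k X} (hc : c ∈ carriedBy k V) :
    ∃ c' : AugChain k V, augMap (subspaceIncl V) k c' = c := by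
  have : carriedBy k V ≤ LinearMap.range (augMap (subspaceIncl V) k) := by
    rw [carriedBy, Finsupp.supported_eq_span_single, Submodule.span_le]
    rintro _ ⟨σ, hσ, rfl⟩
    refine ⟨Finsupp.single ⟨fun t => ⟨σ t, hσ t⟩, σ.continuous.subtype_mk _⟩ 1, ?_⟩
    rw [augMap_single]
    rfl
  exact this hc

theorem augMap_comp_apply {Z : Type*} [TopologicalSpace Z] (g : C(Y, Z)) (f : C(X, Y)) (k : ℕ)
    (c : AugChain k X) : augMap g k (augMap f k c) = augMap (g.comp f) k c := by
  refine LinearMap.congr_fun (f := (augMap g k).comp (augMap f k)) (g := augMap (g.comp f) k) ?_ c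
  refine Finsupp.lhom_ext' fun σ => LinearMap.ext_ring ?_
  simp only [LinearMap.comp_apply, Finsupp.lsingle_apply, augMap_single, ContinuousMap.comp_assoc]

theorem AcyclicSet.of_convex {E : Type*} [NormedAddCommGroup E] [NormedSpace ℝ E] {S : Set E}
    (hS : Convex ℝ S) (hne : S.Nonempty) {V : Set X} (r : C(V, S)) (s : C(S, X))
    (hs : ∀ y, s y ∈ V) (hsr : ∀ x : V, s (r x) = x) : AcyclicSet V := by
  intro k c hc hcyc
  obtain ⟨c, rfl⟩ := exists_augMap_eq hc
  have hinj : Function.Injective (subspaceIncl V) := Subtype.val_injective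
  have hcyc' : augBdry k V c = 0 := by
    apply augMap_injective hinj
    rw [augMap_bdry, hcyc, map_zero]
  obtain ⟨b, hb⟩ := exists_bdry_eq_of_convex hS hne (augMap r (k + 1) c) (by
    rw [← augMap_bdry, hcyc', map_zero])
  refine ⟨augMap s _ b, augMap_mem_carriedBy hs b, ?_⟩
  rw [← augMap_bdry, hb, augMap_comp_apply]
  congr 2
  ext x
  exact hsr x

theorem exists_acyclic_nhds {d : ℕ} [ChartedSpace (EuclideanSpace ℝ (Fin d)) X] (x : X) {U : Set X}
    (hU : U ∈ nhds x) : ∃ V ∈ nhds x, V ⊆ U ∧ AcyclicSet V := by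
  let e := chartAt (EuclideanSpace ℝ (Fin d)) x
  have hx : x ∈ e.source := mem_chart_source _ x
  have hW : e.target ∩ e.symm ⁻¹' U ∈ nhds (e x) := by
    refine Filter.inter_mem (e.open_target.mem_nhds (e.map_source hx)) ?_
    refine (e.continuousAt_symm (e.map_source hx)).preimage_mem_nhds ?_
    rwa [e.left_inv hx]
  obtain ⟨r, hr, hball⟩ := Metric.mem_nhds_iff.1 hW
  refine ⟨e.source ∩ e ⁻¹' Metric.ball (e x) r, ?_, ?_, ?_⟩
  · exact Filter.inter_mem (e.open_source.mem_nhds hx)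
      ((e.continuousAt hx).preimage_mem_nhds (Metric.ball_mem_nhds _ hr))
  · rintro y ⟨hy, hyb⟩
    have := (hball hyb).2
    rwa [Set.mem_preimage, e.left_inv hy] at this
  · refine AcyclicSet.of_convex (convex_ball (e x) r) ⟨e x, Metric.mem_ball_self hr⟩
      ⟨fun y => ⟨e y.1, y.2.2⟩, Continuous.subtype_mk
        (continuousOn_iff_continuous_domRestrict.1 (e.continuousOn.mono fun y hy => hy.1)) _⟩
      ⟨fun y => e.symm y.1,
        continuousOn_iff_continuous_domRestrict.1
          (e.continuousOn_symm.mono fun y hy => (hball hy).1)⟩ ?_ ?_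
    · intro y
      have := (hball y.2).1
      refine ⟨e.map_target this, ?_⟩
      change e (e.symm y.1) ∈ Metric.ball (e x) r
      rw [e.right_inv this]
      exact y.2
    · intro y
      exact e.left_inv y.2.1

end Acyclic

/-! ### Finite generation of the image of the homology of a compact set -/

section Finiteness

variable {X : Type*} [PseudoMetricSpace X]

/-- Local acyclicity is uniform on compact sets. -/
theorem exists_uniform_acyclic
    (hloc : ∀ (x : X), ∀ U ∈ nhds x, ∃ V ∈ nhds x, V ⊆ U ∧ AcyclicSet V) {K : Set X}
    (hK : IsCompact K) {ε : ℝ} (hε : 0 < ε) :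
    ∃ δ > 0, ∀ x ∈ K, ∃ V, AcyclicSet V ∧ Metric.ball x δ ⊆ V ∧ V ⊆ Metric.ball x ε := by
  choose V hV hVsub hVac using fun x => hloc x (Metric.ball x (ε / 2))
    (Metric.ball_mem_nhds x (by positivity))
  obtain ⟨δ, hδ, h⟩ := lebesgue_number_lemma_of_metric (c := fun x => interior (V x)) hK
    (fun x => isOpen_interior) fun x _ => Set.mem_iUnion.2 ⟨x, mem_interior_iff_mem_nhds.2 (hV x)⟩
  refine ⟨δ, hδ, fun y hy => ?_⟩
  obtain ⟨x, hx⟩ := h y hy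
  refine ⟨V x, hVac x, hx.trans interior_subset, fun z hz => ?_⟩
  have hyx : dist y x < ε / 2 := hVsub x (interior_subset (hx (Metric.mem_ball_self hδ)))
  have hzx : dist z x < ε / 2 := hVsub x hz
  rw [Metric.mem_ball]
  linarith [dist_triangle z x y, dist_comm x y]

/-- The metric space `X` admits a controlled filling operator over `K`: cycles in a ball
`B(x, δ)` with `x ∈ K` are filled inside `B(x, ε)`. The filling `F c` depends only on the chain `c`,
so `F` maps finite sets of chains to finite sets of chains. -/
theorem exists_filling
    (hloc : ∀ (x : X), ∀ U ∈ nhds x, ∃ V ∈ nhds x, V ⊆ U ∧ AcyclicSet V) {K : Set X}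
    (hK : IsCompact K) (k : ℕ) {ε : ℝ} (hε : 0 < ε) :
    ∃ δ > 0, ∃ F : AugChain (k + 1) X → AugChain (k + 2) X,
      ∀ x ∈ K, ∀ c ∈ carriedBy (k + 1) (Metric.ball x δ), augBdry k X c = 0 →
        F c ∈ carriedBy (k + 2) (Metric.ball x ε) ∧ augBdry (k + 1) X (F c) = c := by
  classical
  obtain ⟨δ₀, hδ₀, h⟩ := exists_uniform_acyclic hloc hK (ε := ε / 3) (by positivity)
  set δ := min δ₀ (ε / 3) with hδdef
  have hδ : 0 < δ := lt_min hδ₀ (by positivity)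
  have hfill : ∀ c : AugChain (k + 1) X, ∃ b : AugChain (k + 2) X, (c = 0 → b = 0) ∧
      ((∃ y ∈ K, c ∈ carriedBy (k + 1) (Metric.ball y δ) ∧ augBdry k X c = 0) →
        augBdry (k + 1) X b = c ∧
        ∃ y ∈ K, c ∈ carriedBy (k + 1) (Metric.ball y δ) ∧
          b ∈ carriedBy (k + 2) (Metric.ball y (ε / 3))) := by
    intro c
    by_cases hc0 : c = 0
    · refine ⟨0, fun _ => rfl, ?_⟩
      rintro ⟨y, hy, hc, -⟩
      exact ⟨by rw [hc0, map_zero], y, hy, hc, zero_mem _⟩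
    · by_cases hc : ∃ y ∈ K, c ∈ carriedBy (k + 1) (Metric.ball y δ) ∧ augBdry k X c = 0
      · obtain ⟨y, hy, hc, hcyc⟩ := hc
        obtain ⟨V, hV, h1, h2⟩ := h y hy
        obtain ⟨b, hb, hbc⟩ := hV k c
          (carriedBy_mono ((Metric.ball_subset_ball (min_le_left _ _)).trans h1) hc) hcyc
        exact ⟨b, fun h => (hc0 h).elim, fun _ => ⟨hbc, y, hy, hc, carriedBy_mono h2 hb⟩⟩
      · exact ⟨0, fun _ => rfl, fun h => (hc h).elim⟩
  choose F hF0 hF using hfill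
  refine ⟨δ, hδ, F, fun x hx c hc hcyc => ?_⟩
  obtain ⟨hb, y, hy, hcy, hFy⟩ := hF c ⟨x, hx, hc, hcyc⟩
  refine ⟨?_, hb⟩
  by_cases hc0 : c = 0
  · rw [hF0 c hc0]
    exact zero_mem _
  · obtain ⟨σ, hσ⟩ := Finsupp.support_nonempty_iff.2 hc0
    have hx' : σ (stdSimplex.vertex 0) ∈ Metric.ball x δ :=
      (Finsupp.mem_supported ℤ c).1 hc hσ _
    have hy' : σ (stdSimplex.vertex 0) ∈ Metric.ball y δ :=
      (Finsupp.mem_supported ℤ c).1 hcy hσ _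
    refine carriedBy_mono (fun z hz => ?_) hFy
    have h3 : δ ≤ ε / 3 := min_le_right _ _
    rw [Metric.mem_ball] at *
    linarith [dist_triangle z y x, dist_triangle y (σ (stdSimplex.vertex 0)) x,
      dist_comm y (σ (stdSimplex.vertex 0))]

/-- A singular simplex in `K` whose points have mutual distance less than `δ`. -/
def IsSmallSimplex (K : Set X) (δ : ℝ) {k : ℕ} (σ : SingSimplex k X) : Prop :=
  (∀ t, σ t ∈ K) ∧ ∀ s t, dist (σ s) (σ t) < δ

/-- Two consecutive levels of a chain homotopy on small simplices from the identity to
a chain map `φ` taking only finitely many values on the small simplices with `k + 1` vertices. Only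
the values on simplices in `K` of size less than `δ` matter; chains move by less than `ε`. -/
structure FiniteApprox (K : Set X) (δ ε : ℝ) (k : ℕ) (φ₀ : AugChain k X →ₗ[ℤ] AugChain k X)
    (h₀ : AugChain k X →ₗ[ℤ] AugChain (k + 1) X)
    (φ : AugChain (k + 1) X →ₗ[ℤ] AugChain (k + 1) X)
    (h : AugChain (k + 1) X →ₗ[ℤ] AugChain (k + 2) X) : Prop where
  finite : (φ '' {c | ∃ σ : SingSimplex (k + 1) X, IsSmallSimplex K δ σ ∧
    c = Finsupp.single σ 1}).Finite
  homotopy_zero : k = 0 → h₀ = 0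
  map_carried : ∀ σ : SingSimplex (k + 1) X, IsSmallSimplex K δ σ → ∀ t,
    φ (Finsupp.single σ 1) ∈ carriedBy (k + 1) (Metric.ball (σ t) ε)
  homotopy_carried : ∀ σ : SingSimplex (k + 1) X, IsSmallSimplex K δ σ → ∀ t,
    h (Finsupp.single σ 1) ∈ carriedBy (k + 2) (Metric.ball (σ t) ε)
  bdry_map : ∀ σ : SingSimplex (k + 1) X, IsSmallSimplex K δ σ →
    augBdry k X (φ (Finsupp.single σ 1)) = φ₀ (augBdry k X (Finsupp.single σ 1))
  bdry_homotopy : ∀ σ : SingSimplex (k + 1) X, IsSmallSimplex K δ σ →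
    augBdry (k + 1) X (h (Finsupp.single σ 1)) =
      Finsupp.single σ 1 - φ (Finsupp.single σ 1) - h₀ (augBdry k X (Finsupp.single σ 1))

/-- All points have the same augmentation. -/
theorem augBdry_zero_single_sub (σ τ : SingSimplex 1 X) :
    augBdry 0 X (Finsupp.single σ 1) = augBdry 0 X (Finsupp.single τ 1) := by
  rw [augBdry_single, augBdry_single]
  refine Finset.sum_congr rfl fun i _ => ?_
  congr 2
  ext t
  have h0 : ∑ x, t x = 1 := t.2.2
  simp at h0

theorem single_mem_carriedBy {k : ℕ} {A : Set X} {σ : SingSimplex k X} (h : ∀ t, σ t ∈ A) :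
    Finsupp.single σ 1 ∈ carriedBy k A :=
  Finsupp.single_mem_supported ℤ _ h

/-- On points, `φ` moves each point of `K` to a nearby point of a finite net. -/
theorem exists_finiteApprox_zero
    (hloc : ∀ (x : X), ∀ U ∈ nhds x, ∃ V ∈ nhds x, V ⊆ U ∧ AcyclicSet V) {K : Set X}
    (hK : IsCompact K) {ε : ℝ} (hε : 0 < ε) :
    ∃ δ > 0, ∃ φ₀ h₀ φ h, FiniteApprox K δ ε 0 φ₀ h₀ φ h := by
  obtain ⟨δ, hδ, F, hF⟩ := exists_filling hloc hK 0 hε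
  obtain ⟨N, hNK, hNfin, hN⟩ := hK.finite_cover_balls (e := min δ ε) (lt_min hδ hε)
  have hnear : ∀ x : X, ∃ y : X, x ∈ K → y ∈ N ∧ dist y x < min δ ε := by
    intro x
    by_cases hx : x ∈ K
    · obtain ⟨y, hy, hxy⟩ := Set.mem_iUnion₂.1 (hN hx)
      exact ⟨y, fun _ => ⟨hy, by rw [dist_comm]; exact hxy⟩⟩
    · exact ⟨x, fun h => (hx h).elim⟩
  choose p hp using hnear
  let v : stdSimplex ℝ (Fin 1) := stdSimplex.vertex 0
  let φ : AugChain 1 X →ₗ[ℤ] AugChain 1 X := Finsupp.linearCombination ℤ fun σ : SingSimplex 1 X =>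
    Finsupp.single (ContinuousMap.const _ (p (σ v))) 1
  have hφ : ∀ σ : SingSimplex 1 X, φ (Finsupp.single σ 1) =
      Finsupp.single (ContinuousMap.const _ (p (σ v))) 1 := fun σ => by simp [φ]
  let h : AugChain 1 X →ₗ[ℤ] AugChain 2 X := Finsupp.linearCombination ℤ fun σ : SingSimplex 1 X =>
    F (Finsupp.single σ 1 - φ (Finsupp.single σ 1))
  have hh : ∀ σ : SingSimplex 1 X, h (Finsupp.single σ 1) =
      F (Finsupp.single σ 1 - φ (Finsupp.single σ 1)) := fun σ => by simp [h]
  have hφc : ∀ σ : SingSimplex 1 X, IsSmallSimplex K 1 σ → ∀ t,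
      φ (Finsupp.single σ 1) ∈ carriedBy 1 (Metric.ball (σ t) (min δ ε)) := by
    intro σ hσ t
    rw [hφ]
    refine single_mem_carriedBy fun s => ?_
    rw [Subsingleton.elim t v]
    exact (hp _ (hσ.1 v)).2
  have hfill : ∀ σ : SingSimplex 1 X, IsSmallSimplex K 1 σ → ∀ t,
      F (Finsupp.single σ 1 - φ (Finsupp.single σ 1)) ∈ carriedBy 2 (Metric.ball (σ t) ε) ∧
      augBdry 1 X (F (Finsupp.single σ 1 - φ (Finsupp.single σ 1))) =
        Finsupp.single σ 1 - φ (Finsupp.single σ 1) := by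
    intro σ hσ t
    refine hF (σ t) (hσ.1 t) _ (sub_mem ?_ ?_) ?_
    · refine single_mem_carriedBy fun s => ?_
      rw [Subsingleton.elim s t]
      exact Metric.mem_ball_self hδ
    · exact carriedBy_mono (Metric.ball_subset_ball (min_le_left _ _)) (hφc σ hσ t)
    · rw [map_sub, hφ, sub_eq_zero]
      exact augBdry_zero_single_sub _ _
  refine ⟨1, one_pos, LinearMap.id, 0, φ, h, ⟨?_, fun _ => rfl, ?_, ?_, ?_, ?_⟩⟩
  · refine (hNfin.image fun y => (Finsupp.single (ContinuousMap.const _ y) 1 : AugChain 1 X)).subset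
      ?_
    rintro _ ⟨_, ⟨σ, hσ, rfl⟩, rfl⟩
    exact ⟨p (σ v), (hp _ (hσ.1 v)).1, (hφ σ).symm⟩
  · exact fun σ hσ t => carriedBy_mono (Metric.ball_subset_ball (min_le_right _ _)) (hφc σ hσ t)
  · intro σ hσ t
    rw [hh]
    exact (hfill σ hσ t).1
  · intro σ hσ
    rw [hφ]
    exact augBdry_zero_single_sub _ _
  · intro σ hσ
    rw [hh, LinearMap.zero_apply, sub_zero]
    exact (hfill σ hσ v).2

theorem IsSmallSimplex.face {K : Set X} {δ : ℝ} {k : ℕ} {σ : SingSimplex (k + 1) X}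
    (hσ : IsSmallSimplex K δ σ) (i : Fin (k + 1)) : IsSmallSimplex K δ (σ.comp (stdFace i)) :=
  ⟨fun _ => hσ.1 _, fun _ _ => hσ.2 _ _⟩

theorem IsSmallSimplex.mono {K : Set X} {δ δ' : ℝ} {k : ℕ} {σ : SingSimplex k X}
    (hσ : IsSmallSimplex K δ σ) (h : δ ≤ δ') : IsSmallSimplex K δ' σ :=
  ⟨hσ.1, fun _ _ => (hσ.2 _ _).trans_le h⟩

/-- A property closed under linear combinations which holds for all faces of a simplex
holds for its boundary. -/
theorem map_bdry_mem {k : ℕ} {N : Type*} [AddCommGroup N] (f : AugChain k X →ₗ[ℤ] N)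
    (p : Submodule ℤ N) (σ : SingSimplex (k + 1) X)
    (h : ∀ i, f (Finsupp.single (σ.comp (stdFace i)) 1) ∈ p) :
    f (augBdry k X (Finsupp.single σ 1)) ∈ p := by
  rw [augBdry_single, map_sum]
  refine Submodule.sum_mem _ fun i _ => ?_
  rw [map_zsmul]
  exact zsmul_mem (h i) _

/-- The map `φ` on a simplex is a filling of its value on the boundary; since the filling depends
only on the chain to be filled, finitely many values on the faces give finitely many values. The homotopy
is a second filling. -/
theorem exists_finiteApprox_succ
    (hloc : ∀ (x : X), ∀ U ∈ nhds x, ∃ V ∈ nhds x, V ⊆ U ∧ AcyclicSet V) {K : Set X}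
    (hK : IsCompact K) {k : ℕ}
    (ih : ∀ ε : ℝ, 0 < ε → ∃ δ > 0, ∃ φ₀ h₀ φ h, FiniteApprox K δ ε k φ₀ h₀ φ h)
    {ε : ℝ} (hε : 0 < ε) :
    ∃ δ > 0, ∃ φ₀ h₀ φ h, FiniteApprox K δ ε (k + 1) φ₀ h₀ φ h := by
  obtain ⟨δ₁, hδ₁, F₁, hF₁⟩ := exists_filling hloc hK (k + 1) hε
  obtain ⟨δ₀, hδ₀, F₀, hF₀⟩ := exists_filling hloc hK k (ε := min ε δ₁) (lt_min hε hδ₁)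
  set η := min δ₀ δ₁ with hη
  have hηpos : 0 < η := lt_min hδ₀ hδ₁
  obtain ⟨δ', hδ', ψ₀, g₀, ψ, g, H⟩ := ih (η / 2) (by positivity)
  set δ := min δ' (η / 2) with hδdef
  have hδ : 0 < δ := lt_min hδ' (by positivity)
  let φ : AugChain (k + 2) X →ₗ[ℤ] AugChain (k + 2) X :=
    Finsupp.linearCombination ℤ fun σ : SingSimplex (k + 2) X =>
      F₀ (ψ (augBdry (k + 1) X (Finsupp.single σ 1)))
  have hφ : ∀ σ : SingSimplex (k + 2) X, φ (Finsupp.single σ 1) =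
      F₀ (ψ (augBdry (k + 1) X (Finsupp.single σ 1))) := fun σ => by simp [φ]
  let h : AugChain (k + 2) X →ₗ[ℤ] AugChain (k + 3) X :=
    Finsupp.linearCombination ℤ fun σ : SingSimplex (k + 2) X =>
      F₁ (Finsupp.single σ 1 - φ (Finsupp.single σ 1) -
        g (augBdry (k + 1) X (Finsupp.single σ 1)))
  have hh : ∀ σ : SingSimplex (k + 2) X, h (Finsupp.single σ 1) =
      F₁ (Finsupp.single σ 1 - φ (Finsupp.single σ 1) -
        g (augBdry (k + 1) X (Finsupp.single σ 1))) := fun σ => by simp [h]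
  have hface : ∀ σ : SingSimplex (k + 2) X, IsSmallSimplex K δ σ → ∀ i,
      IsSmallSimplex K δ' (σ.comp (stdFace i)) := fun σ hσ i => (hσ.face i).mono (min_le_left _ _)
  -- points of a small simplex are close, so balls around points of a face lie in slightly larger
  -- balls around any point of the simplex
  have hball : ∀ σ : SingSimplex (k + 2) X, IsSmallSimplex K δ σ → ∀ t s,
      Metric.ball (σ s) (η / 2) ⊆ Metric.ball (σ t) η := by
    intro σ hσ t s z hz
    have h1 := hσ.2 s t
    have h2 : δ ≤ η / 2 := min_le_right _ _
    rw [Metric.mem_ball] at *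
    linarith [dist_triangle z (σ s) (σ t)]
  have hψc : ∀ σ : SingSimplex (k + 2) X, IsSmallSimplex K δ σ → ∀ t,
      ψ (augBdry (k + 1) X (Finsupp.single σ 1)) ∈ carriedBy (k + 1) (Metric.ball (σ t) η) :=
    fun σ hσ t => map_bdry_mem _ _ _ fun i => carriedBy_mono (hball σ hσ t _)
      (H.map_carried _ (hface σ hσ i) (stdSimplex.vertex 0))
  have hgc : ∀ σ : SingSimplex (k + 2) X, IsSmallSimplex K δ σ → ∀ t,
      g (augBdry (k + 1) X (Finsupp.single σ 1)) ∈ carriedBy (k + 2) (Metric.ball (σ t) η) :=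
    fun σ hσ t => map_bdry_mem _ _ _ fun i => carriedBy_mono (hball σ hσ t _)
      (H.homotopy_carried _ (hface σ hσ i) (stdSimplex.vertex 0))
  have hψb : ∀ σ : SingSimplex (k + 2) X, IsSmallSimplex K δ σ →
      augBdry k X (ψ (augBdry (k + 1) X (Finsupp.single σ 1))) = 0 := by
    intro σ hσ
    have : ((augBdry k X).comp ψ - ψ₀.comp (augBdry k X))
        (augBdry (k + 1) X (Finsupp.single σ 1)) ∈ (⊥ : Submodule ℤ (AugChain k X)) :=
      map_bdry_mem _ _ _ fun i => sub_eq_zero.2 (H.bdry_map _ (hface σ hσ i))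
    have h0 := sub_eq_zero.1 ((Submodule.mem_bot ℤ).1 this)
    simp only [LinearMap.comp_apply] at h0
    rw [h0, augBdry_bdry, map_zero]
  have hgb : ∀ σ : SingSimplex (k + 2) X, IsSmallSimplex K δ σ →
      augBdry (k + 1) X (g (augBdry (k + 1) X (Finsupp.single σ 1))) =
        augBdry (k + 1) X (Finsupp.single σ 1) - ψ (augBdry (k + 1) X (Finsupp.single σ 1)) := by
    intro σ hσ
    have : ((augBdry (k + 1) X).comp g - (LinearMap.id - ψ - g₀.comp (augBdry k X)) :
        AugChain (k + 1) X →ₗ[ℤ] AugChain (k + 1) X)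
        (augBdry (k + 1) X (Finsupp.single σ 1)) ∈ (⊥ : Submodule ℤ (AugChain (k + 1) X)) :=
      map_bdry_mem _ _ _ fun i => sub_eq_zero.2 (H.bdry_homotopy _ (hface σ hσ i))
    have h0 := sub_eq_zero.1 ((Submodule.mem_bot ℤ).1 this)
    simp only [LinearMap.comp_apply, LinearMap.sub_apply, LinearMap.id_apply] at h0
    rw [h0, augBdry_bdry, map_zero, sub_zero]
  have hfill₀ : ∀ σ : SingSimplex (k + 2) X, IsSmallSimplex K δ σ → ∀ t,
      φ (Finsupp.single σ 1) ∈ carriedBy (k + 2) (Metric.ball (σ t) (min ε δ₁)) ∧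
      augBdry (k + 1) X (φ (Finsupp.single σ 1)) =
        ψ (augBdry (k + 1) X (Finsupp.single σ 1)) := by
    intro σ hσ t
    rw [hφ]
    exact hF₀ (σ t) (hσ.1 t) _
      (carriedBy_mono (Metric.ball_subset_ball (min_le_left _ _)) (hψc σ hσ t)) (hψb σ hσ)
  have hfill₁ : ∀ σ : SingSimplex (k + 2) X, IsSmallSimplex K δ σ → ∀ t,
      h (Finsupp.single σ 1) ∈ carriedBy (k + 3) (Metric.ball (σ t) ε) ∧
      augBdry (k + 2) X (h (Finsupp.single σ 1)) =
        Finsupp.single σ 1 - φ (Finsupp.single σ 1) -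
          g (augBdry (k + 1) X (Finsupp.single σ 1)) := by
    intro σ hσ t
    rw [hh]
    refine hF₁ (σ t) (hσ.1 t) _ (sub_mem (sub_mem ?_ ?_) ?_) ?_
    · refine single_mem_carriedBy fun s => ?_
      have h1 := hσ.2 s t
      have h2 : δ ≤ η / 2 := min_le_right _ _
      have h3 : η ≤ δ₁ := min_le_right _ _
      rw [Metric.mem_ball]
      linarith
    · exact carriedBy_mono (Metric.ball_subset_ball (min_le_right _ _)) (hfill₀ σ hσ t).1
    · exact carriedBy_mono (Metric.ball_subset_ball (min_le_right _ _)) (hgc σ hσ t)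
    · rw [map_sub, map_sub, (hfill₀ σ hσ t).2, hgb σ hσ, sub_self]
  refine ⟨δ, hδ, ψ, g, φ, h, ⟨?_, fun h => (Nat.succ_ne_zero k h).elim, ?_, ?_, ?_, ?_⟩⟩
  · -- the boundary has `k + 2` faces, and `ψ` takes finitely many values on each of them
    have hfin := Set.Finite.pi' (fun _ : Fin (k + 2) => H.finite)
    refine (hfin.image fun a => F₀ (∑ i : Fin (k + 2), (-1 : ℤ) ^ (i : ℕ) • a i)).subset ?_
    rintro _ ⟨_, ⟨σ, hσ, rfl⟩, rfl⟩
    refine ⟨fun i => ψ (Finsupp.single (σ.comp (stdFace i)) 1),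
      fun i => ⟨_, ⟨_, hface σ hσ i, rfl⟩, rfl⟩, ?_⟩
    rw [hφ, augBdry_single, map_sum]
    simp only [map_zsmul]
  · exact fun σ hσ t => carriedBy_mono (Metric.ball_subset_ball (min_le_left _ _)) (hfill₀ σ hσ t).1
  · exact fun σ hσ t => (hfill₁ σ hσ t).1
  · exact fun σ hσ => (hfill₀ σ hσ (stdSimplex.vertex 0)).2
  · exact fun σ hσ => (hfill₁ σ hσ (stdSimplex.vertex 0)).2

theorem exists_finiteApprox
    (hloc : ∀ (x : X), ∀ U ∈ nhds x, ∃ V ∈ nhds x, V ⊆ U ∧ AcyclicSet V) {K : Set X}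
    (hK : IsCompact K) (k : ℕ) {ε : ℝ} (hε : 0 < ε) :
    ∃ δ > 0, ∃ φ₀ h₀ φ h, FiniteApprox K δ ε k φ₀ h₀ φ h := by
  induction k generalizing ε with
  | zero => exact exists_finiteApprox_zero hloc hK hε
  | succ k ih => exact exists_finiteApprox_succ hloc hK (fun ε hε => ih hε) hε

/-- In a locally acyclic metric space the homology of a compact set `K` has finitely
generated image in the homology of any neighbourhood `L`. In the lowest degree every chain counts
as a cycle. -/
theorem exists_fg_cycles_modulo_bdry
    (hloc : ∀ (x : X), ∀ U ∈ nhds x, ∃ V ∈ nhds x, V ⊆ U ∧ AcyclicSet V) {K L : Set X}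
    (hK : IsCompact K) (hL : IsOpen L) (hKL : K ⊆ L) (k : ℕ) :
    ∃ G : Submodule ℤ (AugChain (k + 1) X), G.FG ∧
      ∀ z ∈ carriedBy (k + 1) K, (k = 0 ∨ augBdry k X z = 0) →
        ∃ b ∈ carriedBy (k + 2) L, z - augBdry (k + 1) X b ∈ G := by
  obtain ⟨ε, hε, hεL⟩ := hK.exists_thickening_subset_open hL hKL
  obtain ⟨δ, hδ, φ₀, h₀, φ, h, H⟩ := exists_finiteApprox hloc hK k hε
  refine ⟨Submodule.span ℤ _, Submodule.fg_span H.finite, fun z hz hcyc => ?_⟩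
  obtain ⟨z', hz', hcyc', b, hb, hbz⟩ := exists_small_homologous hz hcyc hδ
  have hmap : ∀ {N : Type _} [AddCommGroup N] (f : AugChain (k + 1) X →ₗ[ℤ] N)
      (p : Submodule ℤ N), (∀ σ, IsSmallSimplex K δ σ → f (Finsupp.single σ 1) ∈ p) → f z' ∈ p := by
    intro N _ f p hf
    have : smallChains (k + 1) K δ ≤ p.comap f := by
      rw [smallChains, Finsupp.supported_eq_span_single, Submodule.span_le]
      rintro _ ⟨σ, hσ, rfl⟩
      exact hf σ hσ
    exact this hz'
  have hh : h z' ∈ carriedBy (k + 2) L := hmap h _ fun σ hσ => carriedBy_mono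
    ((Metric.ball_subset_thickening (hσ.1 (stdSimplex.vertex 0)) ε).trans hεL)
    (H.homotopy_carried σ hσ (stdSimplex.vertex 0))
  have hφ : φ z' ∈ Submodule.span ℤ (φ '' {c | ∃ σ : SingSimplex (k + 1) X, IsSmallSimplex K δ σ ∧
      c = Finsupp.single σ 1}) :=
    hmap φ _ fun σ hσ => Submodule.subset_span ⟨_, ⟨σ, hσ, rfl⟩, rfl⟩
  have hbd : augBdry (k + 1) X (h z') = z' - φ z' - h₀ (augBdry k X z') := by
    have : ((augBdry (k + 1) X).comp h - (LinearMap.id - φ - h₀.comp (augBdry k X)) :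
        AugChain (k + 1) X →ₗ[ℤ] AugChain (k + 1) X) z' ∈
        (⊥ : Submodule ℤ (AugChain (k + 1) X)) :=
      hmap _ _ fun σ hσ => sub_eq_zero.2 (H.bdry_homotopy _ hσ)
    exact sub_eq_zero.1 ((Submodule.mem_bot ℤ).1 this)
  have hh₀ : h₀ (augBdry k X z') = 0 := by
    rcases hcyc' with hk | h0
    · rw [H.homotopy_zero hk, LinearMap.zero_apply]
    · rw [h0, map_zero]
  refine ⟨b + h z', add_mem (carriedBy_mono hKL hb) hh, ?_⟩
  rw [map_add, hbz, hbd, hh₀]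
  convert hφ using 1
  abel

end Finiteness

/-! ### Towers of abelian groups -/

section Towers

variable {A B : ℕ → Type u} [∀ i, AddCommGroup (A i)] [∀ i, AddCommGroup (B i)]

theorem oneSubBonding_apply (p : ∀ i, A (i + 1) →+ A i) (a : ∀ i, A i) (i : ℕ) :
    oneSubBonding A p a i = a i - p i (a (i + 1)) := rfl

/-- The map on `lim¹` induced by a map of towers. -/
def towerLimOneMap (p : ∀ i, A (i + 1) →+ A i) (q : ∀ i, B (i + 1) →+ B i) (g : ∀ i, A i →+ B i)
    (hg : ∀ i a, g i (p i a) = q i (g (i + 1) a)) : TowerLimOne A p →+ TowerLimOne B q :=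
  QuotientAddGroup.map (oneSubBonding A p).range (oneSubBonding B q).range
    (AddMonoidHom.pi fun i => (g i).comp (Pi.evalAddMonoidHom A i)) (by
      rintro _ ⟨a, rfl⟩
      refine ⟨fun i => g i (a i), funext fun i => ?_⟩
      simp [oneSubBonding_apply, hg])

theorem towerLimOneMap_mk (p : ∀ i, A (i + 1) →+ A i) (q : ∀ i, B (i + 1) →+ B i)
    (g : ∀ i, A i →+ B i) (hg : ∀ i a, g i (p i a) = q i (g (i + 1) a)) (a : ∀ i, A i) :
    towerLimOneMap p q g hg (QuotientAddGroup.mk (s := (oneSubBonding A p).range) a) =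
      QuotientAddGroup.mk (s := (oneSubBonding B q).range) fun i => g i (a i) := rfl

theorem towerLimOneMap_bijective {p : ∀ i, A (i + 1) →+ A i} {q : ∀ i, B (i + 1) →+ B i}
    {g : ∀ i, A i →+ B i} (hg : ∀ i a, g i (p i a) = q i (g (i + 1) a))
    (hinj : ∀ (a : ∀ i, A i) (b : ∀ i, B i), oneSubBonding B q b = (fun i => g i (a i)) →
      ∃ a', oneSubBonding A p a' = a)
    (hsurj : ∀ b : ∀ i, B i, ∃ (a : ∀ i, A i) (b' : ∀ i, B i), ∀ i,
      b i = g i (a i) + oneSubBonding B q b' i) :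
    Function.Bijective (towerLimOneMap p q g hg) := by
  constructor
  · rw [injective_iff_map_eq_zero]
    intro x hx
    obtain ⟨a, rfl⟩ := QuotientAddGroup.mk_surjective (s := (oneSubBonding A p).range) x
    rw [towerLimOneMap_mk] at hx
    obtain ⟨b, hb⟩ := (QuotientAddGroup.eq_zero_iff _).1 hx
    exact (QuotientAddGroup.eq_zero_iff _).2 (hinj a b hb)
  · intro y
    obtain ⟨b, rfl⟩ := QuotientAddGroup.mk_surjective (s := (oneSubBonding B q).range) y
    obtain ⟨a, b', h⟩ := hsurj b
    refine ⟨QuotientAddGroup.mk (s := (oneSubBonding A p).range) a, ?_⟩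
    rw [towerLimOneMap_mk]
    refine QuotientAddGroup.eq.2 ⟨b', funext fun i => ?_⟩
    simp only [Pi.add_apply, Pi.neg_apply]
    rw [h i]
    abel

/-- A levelwise surjective map of towers whose kernel tower has vanishing `lim¹` induces an
isomorphism on `lim¹`. -/
theorem towerLimOneMap_bijective_of_surjective {p : ∀ i, A (i + 1) →+ A i}
    {q : ∀ i, B (i + 1) →+ B i} {g : ∀ i, A i →+ B i}
    (hg : ∀ i a, g i (p i a) = q i (g (i + 1) a)) (hsurj : ∀ i, Function.Surjective (g i))
    (hker : ∀ a : ∀ i, A i, (∀ i, g i (a i) = 0) → ∃ x, oneSubBonding A p x = a) :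
    Function.Bijective (towerLimOneMap p q g hg) := by
  refine towerLimOneMap_bijective hg (fun a b hb => ?_) fun b => ?_
  · choose a' ha' using fun i => hsurj i (b i)
    obtain ⟨x, hx⟩ := hker (a - oneSubBonding A p a') fun i => by
      have := congrFun hb i
      simp only [oneSubBonding_apply] at this
      simp only [Pi.sub_apply, oneSubBonding_apply, map_sub, ha', hg]
      rw [← this, sub_self]
    exact ⟨a' + x, by rw [map_add, hx]; abel⟩
  · choose a ha using fun i => hsurj i (b i)
    exact ⟨a, 0, fun i => by simp [ha]⟩

/-- A tower with all its transition maps `A j → A i`, not only those between neighbours. -/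
structure TowerSystem (A : ℕ → Type u) [∀ i, AddCommGroup (A i)] where
  /-- the transition maps -/
  map : ∀ i j, i ≤ j → A j →+ A i
  map_refl : ∀ i a, map i i le_rfl a = a
  map_map : ∀ i j k (hij : i ≤ j) (hjk : j ≤ k) a,
    map i j hij (map j k hjk a) = map i k (hij.trans hjk) a

/-- The bonding maps of a tower with all transition maps. -/
def TowerSystem.bonding (F : TowerSystem A) (i : ℕ) : A (i + 1) →+ A i := F.map i (i + 1) i.le_succ

theorem TowerSystem.map_mem (F : TowerSystem A) {S : ∀ i, AddSubgroup (A i)}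
    (hS : ∀ i, ∀ a ∈ S (i + 1), F.bonding i a ∈ S i) {i j : ℕ} (hij : i ≤ j) {a : A j}
    (ha : a ∈ S j) : F.map i j hij a ∈ S i := by
  induction j, hij using Nat.le_induction with
  | base => rwa [F.map_refl]
  | succ j hij ih =>
    rw [← F.map_map i j (j + 1) hij j.le_succ]
    exact ih (hS j a ha)

/-- If the transition maps eventually land in the subtower `S`, then every sequence is congruent
modulo `S` to one in the image of `1 - P`: the geometric series `∑ Pᵐ a` is finite modulo `S`. -/
theorem TowerSystem.exists_sub_oneSubBonding_mem (F : TowerSystem A) {S : ∀ i, AddSubgroup (A i)}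
    (hS : ∀ i, ∀ a ∈ S (i + 1), F.bonding i a ∈ S i)
    (hpro : ∀ i, ∃ j, ∃ hij : i ≤ j, ∀ a, F.map i j hij a ∈ S i) (a : ∀ i, A i) :
    ∃ a' : ∀ i, A i, ∀ i, a i - oneSubBonding A F.bonding a' i ∈ S i := by
  choose N hN hNS using hpro
  let g : ∀ i, ℕ → A i := fun i m => if h : i ≤ m then F.map i m h (a m) else 0
  have hgS : ∀ i m, N i ≤ m → g i m ∈ S i := by
    intro i m hm
    have him : i ≤ m := (hN i).trans hm
    simp only [g, dif_pos him]
    rw [← F.map_map i (N i) m (hN i) hm]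
    exact hNS i _
  have htail : ∀ i M, N i ≤ M →
      (∑ m ∈ Finset.Ico i M, g i m) - ∑ m ∈ Finset.Ico i (N i), g i m ∈ S i := by
    intro i M hM
    rw [← Finset.sum_Ico_consecutive _ (hN i) hM, add_sub_cancel_left]
    exact sum_mem fun m hm => hgS i m (Finset.mem_Ico.1 hm).1
  refine ⟨fun i => ∑ m ∈ Finset.Ico i (N i), g i m, fun i => ?_⟩
  rw [oneSubBonding_apply]
  set M := max (N i) (N (i + 1)) with hM
  have hiM : i < M := lt_of_lt_of_le (lt_of_lt_of_le (Nat.lt_succ_self i) (hN (i + 1)))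
    (le_max_right _ _)
  have h1 := htail i M (le_max_left _ _)
  have h2 := hS i _ (htail (i + 1) M (le_max_right _ _))
  have h3 : F.bonding i (∑ m ∈ Finset.Ico (i + 1) M, g (i + 1) m) =
      ∑ m ∈ Finset.Ico (i + 1) M, g i m := by
    rw [map_sum]
    refine Finset.sum_congr rfl fun m hm => ?_
    have hm1 := (Finset.mem_Ico.1 hm).1
    have hm0 : i ≤ m := i.le_succ.trans hm1
    simp only [g, dif_pos hm1, dif_pos hm0, TowerSystem.bonding, F.map_map]
  have h4 : ∑ m ∈ Finset.Ico i M, g i m = a i + ∑ m ∈ Finset.Ico (i + 1) M, g i m := by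
    rw [Finset.sum_eq_sum_Ico_succ_bot hiM]
    simp only [g, dif_pos le_rfl, F.map_refl]
  rw [map_sub, h3] at h2
  rw [h4] at h1
  convert sub_mem h1 h2 using 1
  abel

/-- A levelwise injective map of towers which is pro-surjective induces an isomorphism on
`lim¹`. -/
theorem towerLimOneMap_bijective_of_injective (F : TowerSystem B) {p : ∀ i, A (i + 1) →+ A i}
    {g : ∀ i, A i →+ B i} (hg : ∀ i a, g i (p i a) = F.bonding i (g (i + 1) a))
    (hinj : ∀ i, Function.Injective (g i))
    (hpro : ∀ i, ∃ j, ∃ hij : i ≤ j, ∀ b, F.map i j hij b ∈ (g i).range) :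
    Function.Bijective (towerLimOneMap p F.bonding g hg) := by
  have hS : ∀ i, ∀ b ∈ (g (i + 1)).range, F.bonding i b ∈ (g i).range := by
    rintro i _ ⟨a, rfl⟩
    exact ⟨p i a, hg i a⟩
  refine towerLimOneMap_bijective hg (fun a b hb => ?_) fun b => ?_
  · have hb' : ∀ i, b i - F.bonding i (b (i + 1)) ∈ (g i).range := fun i =>
      ⟨a i, (congrFun hb i).symm⟩
    have hmem : ∀ i j (hij : i ≤ j), b i - F.map i j hij (b j) ∈ (g i).range := by
      intro i j hij
      induction j, hij using Nat.le_induction with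
      | base => rw [F.map_refl, sub_self]; exact zero_mem _
      | succ j hij ih =>
        have h1 := F.map_mem (S := fun i => (g i).range) hS hij (hb' j)
        rw [map_sub, TowerSystem.bonding, F.map_map] at h1
        convert add_mem ih h1 using 1
        abel
    have hb'' : ∀ i, ∃ a', g i a' = b i := by
      intro i
      obtain ⟨j, hij, hj⟩ := hpro i
      have := add_mem (hmem i j hij) (hj (b j))
      rwa [sub_add_cancel] at this
    choose a' ha' using hb''
    refine ⟨a', funext fun i => hinj i ?_⟩
    rw [oneSubBonding_apply, map_sub, hg, ha', ha']
    exact congrFun hb i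
  · obtain ⟨b', hb'⟩ := F.exists_sub_oneSubBonding_mem hS hpro b
    choose a ha using hb'
    exact ⟨a, b', fun i => by rw [ha]; abel⟩

/-- The Mittag-Leffler argument: `1 - P` is surjective if the transition maps eventually have
finite image, because then the images stabilise. -/
theorem TowerSystem.oneSubBonding_surjective_of_finite (F : TowerSystem A)
    (hfin : ∀ i, ∃ j, ∃ hij : i ≤ j, (Set.range (F.map i j hij)).Finite) :
    Function.Surjective (oneSubBonding A F.bonding) := by
  have hanti : ∀ i j k (hij : i ≤ j) (hjk : j ≤ k),
      (F.map i k (hij.trans hjk)).range ≤ (F.map i j hij).range := by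
    rintro i j k hij hjk _ ⟨a, rfl⟩
    exact ⟨F.map j k hjk a, F.map_map i j k hij hjk a⟩
  have hstab : ∀ i, ∃ j, ∃ hij : i ≤ j, ∀ k (hjk : j ≤ k),
      (F.map i k (hij.trans hjk)).range = (F.map i j hij).range := by
    intro i
    obtain ⟨j₀, h₀, hf⟩ := hfin i
    -- an image of minimal cardinality is stable
    let P : ℕ → Prop := fun n => ∃ j, ∃ hj : j₀ ≤ j,
      Nat.card (F.map i j (h₀.trans hj)).range = n
    have hP : ∃ n, P n := ⟨_, j₀, le_rfl, rfl⟩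
    classical
    obtain ⟨j, hj, hcard⟩ := Nat.find_spec hP
    refine ⟨j, h₀.trans hj, fun k hjk => ?_⟩
    have hle := hanti i j k (h₀.trans hj) hjk
    have hfinj : ((F.map i j (h₀.trans hj)).range : Set (A i)).Finite :=
      Set.Finite.subset hf (hanti i j₀ j h₀ hj)
    refine SetLike.coe_injective (Set.eq_of_subset_of_ncard_le hle ?_ hfinj)
    have hmin : Nat.find hP ≤ Nat.card (F.map i k (h₀.trans (hj.trans hjk))).range :=
      Nat.find_min' hP ⟨k, hj.trans hjk, rfl⟩
    rw [← hcard] at hmin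
    exact hmin
  choose N hN hNstab using hstab
  let S : ∀ i, AddSubgroup (A i) := fun i => (F.map i (N i) (hN i)).range
  have hSeq : ∀ i k (hk : N i ≤ k), S i = (F.map i k ((hN i).trans hk)).range :=
    fun i k hk => (hNstab i k hk).symm
  have hS : ∀ i, (S (i + 1)).map (F.bonding i) = S i := by
    intro i
    set k := max (N i) (N (i + 1))
    have hk : i + 1 ≤ k := (hN (i + 1)).trans (le_max_right _ _)
    rw [hSeq i k (le_max_left _ _), hSeq (i + 1) k (le_max_right _ _)]
    ext x
    constructor
    · rintro ⟨_, ⟨a, rfl⟩, rfl⟩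
      exact ⟨a, (F.map_map i (i + 1) k i.le_succ hk a).symm⟩
    · rintro ⟨a, rfl⟩
      exact ⟨_, ⟨a, rfl⟩, F.map_map i (i + 1) k i.le_succ hk a⟩
  intro a
  obtain ⟨a', ha'⟩ := F.exists_sub_oneSubBonding_mem (S := S)
    (fun i x hx => by rw [← hS i]; exact ⟨x, hx, rfl⟩)
    (fun i => ⟨N i, hN i, fun x => ⟨x, rfl⟩⟩) a
  -- on the stable images the bonding maps are surjective, so `1 - P` is inverted recursively
  have hstep : ∀ i (x : S i), ∃ y : S (i + 1),
      F.bonding i y = x - (a i - oneSubBonding A F.bonding a' i) := by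
    intro i x
    have : (x : A i) - (a i - oneSubBonding A F.bonding a' i) ∈ (S (i + 1)).map (F.bonding i) := by
      rw [hS i]
      exact sub_mem x.2 (ha' i)
    obtain ⟨y, hy, hyx⟩ := this
    exact ⟨⟨y, hy⟩, hyx⟩
  choose next hnext using hstep
  let x : ∀ i, S i := fun i => Nat.rec (0 : S 0) (fun i y => next i y) i
  refine ⟨a' + fun i => (x i).1, funext fun i => ?_⟩
  have hx : F.bonding i (x (i + 1)).1 = (x i).1 - (a i - oneSubBonding A F.bonding a' i) :=
    hnext i (x i)
  rw [map_add, Pi.add_apply, oneSubBonding_apply _ (fun i => (x i).1), hx]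
  abel

end Towers

/-! ### `Ext¹` of an increasing union of finitely generated free modules -/

section ExtUnion

variable {R : Type} [CommRing R]

/-- The map `⨁ S i → ⨁ S i`, identity minus shift, for an increasing sequence of submodules. -/
noncomputable def telescope {Q : Type u} [AddCommGroup Q] [Module R Q] {S : ℕ → Submodule R Q}
    (hS : Monotone S) : DirectSum ℕ (fun i => S i) →ₗ[R] DirectSum ℕ (fun i => S i) :=
  DirectSum.toModule R ℕ _ fun i => DirectSum.lof R ℕ (fun i => S i) i -
    (DirectSum.lof R ℕ (fun i => S i) (i + 1)).comp (Submodule.inclusion (hS i.le_succ))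

/-- The sum map `⨁ S i → Q`. -/
noncomputable def telescopeSum {Q : Type u} [AddCommGroup Q] [Module R Q] (S : ℕ → Submodule R Q) :
    DirectSum ℕ (fun i => S i) →ₗ[R] Q :=
  DirectSum.toModule R ℕ _ fun i => (S i).subtype

variable {Q : Type u} [AddCommGroup Q] [Module R Q] {S : ℕ → Submodule R Q} (hS : Monotone S)

theorem telescope_lof (i : ℕ) (q : S i) : telescope hS (DirectSum.lof R ℕ (fun i => S i) i q) =
    DirectSum.lof R ℕ (fun i => S i) i q -
      DirectSum.lof R ℕ (fun i => S i) (i + 1) (Submodule.inclusion (hS i.le_succ) q) := by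
  simp only [telescope, DirectSum.toModule_lof, LinearMap.sub_apply, LinearMap.comp_apply]

theorem telescopeSum_lof (i : ℕ) (q : S i) :
    telescopeSum S (DirectSum.lof R ℕ (fun i => S i) i q) = q := by
  simp only [telescopeSum, DirectSum.toModule_lof, Submodule.subtype_apply]

theorem telescopeSum_telescope (x : DirectSum ℕ (fun i => S i)) :
    telescopeSum S (telescope hS x) = 0 := by
  refine LinearMap.congr_fun (f := (telescopeSum S).comp (telescope hS)) (g := 0) ?_ x
  refine DirectSum.linearMap_ext R fun i => LinearMap.ext fun q => ?_
  simp only [LinearMap.comp_apply, telescope_lof, map_sub, telescopeSum_lof,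
    Submodule.coe_inclusion, sub_self, LinearMap.zero_apply]

theorem telescope_injective : Function.Injective (telescope hS) := by
  classical
  rw [injective_iff_map_eq_zero]
  intro x hx
  -- summing the components of index at most `N` recovers the component of index `N`
  have key : ∀ N, (x N : Q) = 0 := by
    intro N
    let ψ : DirectSum ℕ (fun i => S i) →ₗ[R] Q :=
      DirectSum.toModule R ℕ _ fun i => if i ≤ N then (S i).subtype else 0
    have h : ψ.comp (telescope hS) =
        (S N).subtype.comp (DirectSum.component R ℕ (fun i => S i) N) := by
      refine DirectSum.linearMap_ext R fun i => LinearMap.ext fun q => ?_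
      simp only [LinearMap.comp_apply, telescope_lof, map_sub, ψ, DirectSum.toModule_lof]
      rcases lt_trichotomy i N with h | rfl | h
      · rw [if_pos h.le, if_pos (Nat.succ_le_of_lt h), DirectSum.component.of, dif_neg h.ne]
        simp
      · rw [if_pos le_rfl, if_neg (by omega), DirectSum.component.of, dif_pos rfl]
        simp
      · rw [if_neg (by omega), if_neg (by omega), DirectSum.component.of, dif_neg h.ne']
        simp
    have h' := LinearMap.congr_fun h x
    rw [LinearMap.comp_apply, hx, map_zero] at h'
    exact h'.symm
  refine DFinsupp.ext fun N => ?_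
  exact Subtype.ext (key N)

/-- Modulo the image of the telescope map every element is concentrated in one index. -/
theorem exists_telescope_eq_sub_lof (x : DirectSum ℕ (fun i => S i)) :
    ∃ N, ∀ M ≥ N, ∃ h : telescopeSum S x ∈ S M, ∃ y,
      telescope hS y = x - DirectSum.lof R ℕ (fun i => S i) M ⟨telescopeSum S x, h⟩ := by
  classical
  induction x using DirectSum.induction_on with
  | zero =>
    refine ⟨0, fun M _ => ⟨by rw [map_zero]; exact zero_mem _, 0, ?_⟩⟩
    have : (⟨telescopeSum S 0, by rw [map_zero]; exact zero_mem _⟩ : S M) = 0 :=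
      Subtype.ext (map_zero _)
    rw [this]
    simp
  | of i q =>
    refine ⟨i, fun M hM => ?_⟩
    have hq : telescopeSum S (DirectSum.of (fun i => S i) i q) = q := telescopeSum_lof i q
    rw [hq]
    refine ⟨hS hM q.2, ?_⟩
    induction M, hM using Nat.le_induction with
    | base => exact ⟨0, by rw [map_zero]; exact (sub_self _).symm⟩
    | succ M hM ih =>
      obtain ⟨y, hy⟩ := ih
      refine ⟨y + DirectSum.lof R ℕ (fun i => S i) M ⟨q, hS hM q.2⟩, ?_⟩
      rw [map_add, hy, telescope_lof, sub_add_sub_cancel]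
      rfl
  | add x y hx hy =>
    obtain ⟨N, hN⟩ := hx
    obtain ⟨N', hN'⟩ := hy
    refine ⟨max N N', fun M hM => ?_⟩
    obtain ⟨h, a, ha⟩ := hN M (le_trans (le_max_left _ _) hM)
    obtain ⟨h', b, hb⟩ := hN' M (le_trans (le_max_right _ _) hM)
    refine ⟨by rw [map_add]; exact add_mem h h', a + b, ?_⟩
    have : (⟨telescopeSum S (x + y), by rw [map_add]; exact add_mem h h'⟩ : S M) =
        ⟨telescopeSum S x, h⟩ + ⟨telescopeSum S y, h'⟩ := Subtype.ext (map_add _ _ _)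
    rw [this, map_add, map_add, ha, hb]
    abel

theorem telescope_exact : Function.Exact (telescope hS) (telescopeSum S) := by
  intro x
  constructor
  · intro hx
    obtain ⟨N, hN⟩ := exists_telescope_eq_sub_lof hS x
    obtain ⟨h, y, hy⟩ := hN N le_rfl
    have : (⟨telescopeSum S x, h⟩ : S N) = 0 := Subtype.ext hx
    rw [this, map_zero, sub_zero] at hy
    exact ⟨y, hy⟩
  · rintro ⟨y, rfl⟩
    exact telescopeSum_telescope hS y

/-- The tower of duals of an increasing sequence of submodules. -/
def dualBonding (i : ℕ) : (S (i + 1) →ₗ[R] R) →+ (S i →ₗ[R] R) :=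
  (LinearMap.lcomp R R (Submodule.inclusion (hS i.le_succ))).toAddMonoidHom

/-- The short exact sequence `0 → ⨁ S i → ⨁ S i → Q → 0` computes `Ext¹(Q, R)` as the `lim¹` of
the duals when all `S i` are projective. -/
theorem nonempty_ext_equiv_limOne [∀ i, Module.Projective R (S i)] (hcov : ∀ q, ∃ i, q ∈ S i) :
    Nonempty (TowerLimOne (fun i => S i →ₗ[R] R) (dualBonding hS) ≃+
      Abelian.Ext (ModuleCat.of R Q) (ModuleCat.of R (ULift.{u} R)) 1) := by
  classical
  let D : ModuleCat.{u} R := ModuleCat.of R (DirectSum ℕ (fun i => S i))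
  let Y : ModuleCat.{u} R := ModuleCat.of R (ULift.{u} R)
  let Z : ShortComplex (ModuleCat.{u} R) :=
    ShortComplex.mk (X₁ := D) (X₂ := D) (X₃ := ModuleCat.of R Q) (ModuleCat.ofHom (telescope hS))
      (ModuleCat.ofHom (telescopeSum S)) 
      (ModuleCat.hom_ext (LinearMap.ext fun x => telescopeSum_telescope hS x))
  have hZ : Z.ShortExact := ModuleCat.shortComplex_shortExact Z (telescope_exact hS)
    (telescope_injective hS) fun q => by
      obtain ⟨i, hi⟩ := hcov q
      exact ⟨DirectSum.lof R ℕ (fun i => S i) i ⟨q, hi⟩, telescopeSum_lof i _⟩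
  have hproj : Projective D := (IsProjective.iff_projective _).1 inferInstance
  -- families of functionals on the `S i` are maps from the direct sum
  let dual : (∀ i, S i →ₗ[R] R) ≃+ (D ⟶ Y) :=
    { toFun := fun a => ModuleCat.ofHom
        (DirectSum.toModule R ℕ _ fun i => ULift.moduleEquiv.symm.toLinearMap.comp (a i))
      invFun := fun f i => ULift.moduleEquiv.toLinearMap.comp
        (f.hom.comp (DirectSum.lof R ℕ (fun i => S i) i))
      left_inv := fun a => by
        funext i
        ext q
        change ((DirectSum.toModule R ℕ (ULift.{u} R) fun i =>
          ULift.moduleEquiv.symm.toLinearMap.comp (a i))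
            (DirectSum.lof R ℕ (fun i => S i) i q)).down = a i q
        rw [DirectSum.toModule_lof]
        rfl
      right_inv := fun f => by
        apply ModuleCat.hom_ext
        refine DirectSum.linearMap_ext R fun i => LinearMap.ext fun q => ?_
        simp only [LinearMap.comp_apply, ModuleCat.hom_ofHom, DirectSum.toModule_lof]
        rfl
      map_add' := fun a b => by
        apply ModuleCat.hom_ext
        refine DirectSum.linearMap_ext R fun i => LinearMap.ext fun q => ?_
        simp only [LinearMap.comp_apply, ModuleCat.hom_ofHom, DirectSum.toModule_lof,
          ModuleCat.hom_add, LinearMap.add_apply, Pi.add_apply, map_add] }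
  have hdual : ∀ a, ModuleCat.ofHom (telescope hS) ≫ dual a =
      dual (oneSubBonding (fun i => S i →ₗ[R] R) (dualBonding hS) a) := by
    intro a
    apply ModuleCat.hom_ext
    refine DirectSum.linearMap_ext R fun i => LinearMap.ext fun q => ?_
    change (DirectSum.toModule R ℕ _ fun i => ULift.moduleEquiv.symm.toLinearMap.comp (a i))
      (telescope hS (DirectSum.lof R ℕ (fun i => S i) i q)) = (DirectSum.toModule R ℕ _ fun i =>
        ULift.moduleEquiv.symm.toLinearMap.comp (oneSubBonding _ (dualBonding hS) a i))
      (DirectSum.lof R ℕ (fun i => S i) i q)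
    rw [telescope_lof, map_sub, DirectSum.toModule_lof, DirectSum.toModule_lof,
      DirectSum.toModule_lof]
    rfl
  let Φ : (∀ i, S i →ₗ[R] R) →+ Abelian.Ext (ModuleCat.of R Q) Y 1 :=
    { toFun := fun a => hZ.extClass.comp (Abelian.Ext.mk₀ (dual a)) rfl
      map_zero' := by rw [map_zero, Abelian.Ext.mk₀_zero, Abelian.Ext.comp_zero]
      map_add' := fun a b => by rw [map_add, Abelian.Ext.mk₀_add, Abelian.Ext.comp_add] }
  have hΦsurj : Function.Surjective Φ := by
    intro e
    obtain ⟨x, hx⟩ := Abelian.Ext.contravariant_sequence_exact₃ hZ Y e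
      (Abelian.Ext.eq_zero_of_projective (P := D) _) (n₀ := 0) rfl
    obtain ⟨f, rfl⟩ := Abelian.Ext.addEquiv₀.symm.surjective x
    refine ⟨dual.symm f, ?_⟩
    change hZ.extClass.comp (Abelian.Ext.mk₀ (dual (dual.symm f))) rfl = e
    rw [dual.apply_symm_apply]
    exact hx
  have hΦker : Φ.ker = (oneSubBonding (fun i => S i →ₗ[R] R) (dualBonding hS)).range := by
    ext a
    constructor
    · intro ha
      obtain ⟨x, hx⟩ := Abelian.Ext.contravariant_sequence_exact₁ hZ Y
        (Abelian.Ext.mk₀ (dual a)) (n₁ := 1) rfl ha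
      obtain ⟨f, rfl⟩ := Abelian.Ext.addEquiv₀.symm.surjective x
      obtain ⟨b, rfl⟩ := dual.surjective f
      refine ⟨b, dual.injective ?_⟩
      rw [← hdual]
      have hx' : (Abelian.Ext.mk₀ Z.f).comp (Abelian.Ext.mk₀ (dual b)) (zero_add 0) =
        Abelian.Ext.mk₀ (dual a) := hx
      rw [Abelian.Ext.mk₀_comp_mk₀] at hx'
      exact Abelian.Ext.addEquiv₀.symm.injective hx'
    · rintro ⟨b, rfl⟩
      change hZ.extClass.comp (Abelian.Ext.mk₀ (dual (oneSubBonding _ _ b))) rfl = 0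
      rw [← hdual, ← Abelian.Ext.mk₀_comp_mk₀]
      exact hZ.extClass_comp_assoc _
  exact ⟨(QuotientAddGroup.quotientAddEquivOfEq hΦker.symm).trans
    (QuotientAddGroup.quotientKerEquivOfSurjective Φ hΦsurj)⟩

end ExtUnion

/-! ### `lim¹` of the duals of an inductive system -/

section DualSystem

variable {R : Type} [CommRing R] {H : ℕ → Type u} [∀ i, AddCommGroup (H i)] [∀ i, Module R (H i)]

/-- A sequence of modules `H 0 → H 1 → ⋯` with all its transition maps. -/
structure IndSystem (R : Type) [CommRing R] (H : ℕ → Type u) [∀ i, AddCommGroup (H i)]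
    [∀ i, Module R (H i)] where
  /-- the transition maps -/
  map : ∀ i j, i ≤ j → H i →ₗ[R] H j
  map_refl : ∀ i a, map i i le_rfl a = a
  map_map : ∀ i j k (hij : i ≤ j) (hjk : j ≤ k) a,
    map j k hjk (map i j hij a) = map i k (hij.trans hjk) a

/-- The tower of dual modules. -/
def IndSystem.dual (t : IndSystem R H) : TowerSystem fun i => H i →ₗ[R] R where
  map i j hij := (LinearMap.lcomp R R (t.map i j hij)).toAddMonoidHom
  map_refl i φ := LinearMap.ext fun a => congrArg φ (t.map_refl i a)
  map_map i j k hij hjk φ := LinearMap.ext fun a => congrArg φ (t.map_map i j k hij hjk a)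

theorem IndSystem.dual_apply (t : IndSystem R H) {i j : ℕ} (hij : i ≤ j) (φ : H j →ₗ[R] R)
    (a : H i) : t.dual.map i j hij φ a = φ (t.map i j hij a) := rfl

variable [IsDomain R] [IsPrincipalIdealRing R]

/-- If the torsion-free module `Q` is the colimit of the `H i` modulo torsion, and the transition
maps eventually have finitely generated image, then `lim¹ Hom(H i, R)` is `Ext¹(Q, R)`: the dual
tower is pro-isomorphic to the dual tower of the images of the `H i` in `Q`, which are free. -/
theorem IndSystem.nonempty_limOne_dual_equiv_ext (t : IndSystem R H) {Q : Type u} [AddCommGroup Q]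
    [Module R Q] [Module.IsTorsionFree R Q] (π : ∀ i, H i →ₗ[R] Q)
    (hπ : ∀ i j (hij : i ≤ j) a, π j (t.map i j hij a) = π i a)
    (hcov : ∀ q, ∃ i a, π i a = q)
    (hfg : ∀ i, ∃ j, ∃ hij : i ≤ j, (LinearMap.range (t.map i j hij)).FG)
    (htors : ∀ i a, π i a = 0 → ∃ r : R, r ≠ 0 ∧ ∃ j, ∃ hij : i ≤ j, r • t.map i j hij a = 0) :
    Nonempty (TowerLimOne (fun i => H i →ₗ[R] R) t.dual.bonding ≃+
      Abelian.Ext (ModuleCat.of R Q) (ModuleCat.of R (ULift.{u} R)) 1) := by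
  classical
  let S : ℕ → Submodule R Q := fun i => LinearMap.range (π i)
  have hS : Monotone S := by
    rintro i j hij _ ⟨a, rfl⟩
    exact ⟨t.map i j hij a, hπ i j hij a⟩
  have hproj : ∀ i, Module.Projective R (S i) := by
    intro i
    obtain ⟨j, hij, hj⟩ := hfg i
    have hSi : S i = (LinearMap.range (t.map i j hij)).map (π j) := by
      rw [← LinearMap.range_comp]
      exact congrArg LinearMap.range (LinearMap.ext fun a => (hπ i j hij a).symm)
    have : Module.Finite R (S i) := Module.Finite.iff_fg.2 (hSi ▸ hj.map (π j))
    have := Module.free_of_finite_type_torsion_free' (R := R) (M := S i)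
    infer_instance
  obtain ⟨e⟩ := nonempty_ext_equiv_limOne hS (R := R) fun q => by
    obtain ⟨i, a, h⟩ := hcov q
    exact ⟨i, a, h⟩
  let g : ∀ i, (S i →ₗ[R] R) →+ (H i →ₗ[R] R) := fun i =>
    (LinearMap.lcomp R R (π i).rangeRestrict).toAddMonoidHom
  have hg : ∀ i φ, g i (dualBonding hS i φ) = t.dual.bonding i (g (i + 1) φ) := by
    intro i φ
    refine LinearMap.ext fun a => congrArg φ (Subtype.ext ?_)
    exact (hπ i (i + 1) i.le_succ a).symm
  have hinj : ∀ i, Function.Injective (g i) := by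
    intro i φ ψ h
    refine LinearMap.ext fun q => ?_
    obtain ⟨a, rfl⟩ := (π i).surjective_rangeRestrict q
    exact LinearMap.congr_fun h a
  have hpro : ∀ i, ∃ j, ∃ hij : i ≤ j, ∀ φ, t.dual.map i j hij φ ∈ (g i).range := by
    intro i
    obtain ⟨j, hij, hj⟩ := hfg i
    -- the image of `ker (π i)` in `H j` is finitely generated, hence torsion in a single `H k`
    have hN : ((LinearMap.ker (π i)).map (t.map i j hij)).FG := by
      have : IsNoetherian R (LinearMap.range (t.map i j hij)) :=
        isNoetherian_of_fg_of_noetherian _ hj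
      exact isNoetherian_submodule.1 this _ LinearMap.map_le_range
    obtain ⟨s, hs⟩ := hN
    have hk : ∀ n ∈ s, ∃ k, ∃ hjk : j ≤ k, ∀ l (hkl : k ≤ l),
        t.map j l (hjk.trans hkl) n ∈ Submodule.torsion R (H l) := by
      intro n hn
      obtain ⟨a, ha, rfl⟩ : n ∈ (LinearMap.ker (π i)).map (t.map i j hij) :=
        hs ▸ Submodule.subset_span hn
      obtain ⟨r, hr, k, hik, hrk⟩ := htors i a ha
      refine ⟨max j k, le_max_left _ _, fun l hl => ?_⟩
      rw [Submodule.mem_torsion_iff]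
      refine ⟨⟨r, mem_nonZeroDivisors_of_ne_zero hr⟩, ?_⟩
      change r • t.map j l _ (t.map i j hij a) = 0
      rw [t.map_map, ← t.map_map i k l hik ((le_max_right _ _).trans hl), ← map_smul, hrk, map_zero]
    choose! k hjk hk using hk
    let K := max j (s.sup k)
    have hjK : j ≤ K := le_max_left _ _
    have hle : (LinearMap.ker (π i)).map (t.map i j hij) ≤
        (Submodule.torsion R (H K)).comap (t.map j K hjK) := by
      rw [← hs, Submodule.span_le]
      exact fun n hn => hk n hn K ((Finset.le_sup hn).trans (le_max_right _ _))
    refine ⟨K, hij.trans hjK, fun φ => ?_⟩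
    have hker : LinearMap.ker (π i) ≤ LinearMap.ker (t.dual.map i K (hij.trans hjK) φ) := by
      intro a ha
      have h1 := hle ⟨a, ha, rfl⟩
      rw [Submodule.mem_comap, t.map_map, Submodule.mem_torsion_iff] at h1
      obtain ⟨r, hr⟩ := h1
      rw [LinearMap.mem_ker, t.dual_apply]
      have h2 : (r : R) * φ (t.map i K (hij.trans hjK) a) = 0 := by
        rw [← smul_eq_mul, ← map_smul]
        exact (congrArg φ hr).trans (map_zero φ)
      exact (mul_eq_zero.1 h2).resolve_left (nonZeroDivisors.coe_ne_zero r)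
    refine ⟨((LinearMap.ker (π i)).liftQ _ hker).comp
      (π i).quotKerEquivRange.symm.toLinearMap, LinearMap.ext fun a => ?_⟩
    change (LinearMap.ker (π i)).liftQ _ hker ((π i).quotKerEquivRange.symm
      ⟨π i a, LinearMap.mem_range_self _ a⟩) = _
    rw [LinearMap.quotKerEquivRange_symm_apply_image, Submodule.mkQ_apply, Submodule.liftQ_apply]
  exact ⟨(AddEquiv.ofBijective _
    (towerLimOneMap_bijective_of_injective t.dual hg hinj hpro)).symm.trans e⟩

end DualSystem

/-! ### Functionals on submodules -/

section Functionals

variable {R : Type} [CommRing R] [IsDomain R] [IsPrincipalIdealRing R]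
  {A B : Type u} [AddCommGroup A] [Module R A] [AddCommGroup B] [Module R B]

/-- Submodules of free modules over a principal ideal domain are free, also in infinite rank: for
a well-ordered basis, elements whose leading coefficients generate the ideals of all leading
coefficients form a basis of the submodule. -/
theorem free_submodule [Module.Free R B] (N : Submodule R B) : Module.Free R N := by
  classical
  let ι := Module.Free.ChooseBasisIndex R B
  let β : Module.Basis ι R B := Module.Free.chooseBasis R B
  obtain ⟨_, _⟩ := exists_wellFoundedLT ι
  let L : ι → Submodule R B := fun i =>
    N ⊓ (Finsupp.supported R R (Set.Iic i)).comap β.repr.toLinearMap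
  have hL : ∀ i y, y ∈ L i ↔ y ∈ N ∧ ∀ j, β.coord j y ≠ 0 → j ≤ i := fun i y =>
    and_congr_right fun _ => forall_congr' fun j => imp_congr Finsupp.mem_support_iff Iff.rfl
  let a : ι → R := fun i => Submodule.IsPrincipal.generator ((L i).map (β.coord i))
  have hx : ∀ i, ∃ x ∈ L i, β.coord i x = a i := fun i =>
    Submodule.IsPrincipal.generator_mem ((L i).map (β.coord i))
  choose x hxL hxa using hx
  have hxlt : ∀ i j, i < j → β.coord j (x i) = 0 := fun i j hij => by
    by_contra h
    exact absurd (((hL i _).1 (hxL i)).2 j h) (not_le.2 hij)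
  let v : {i // a i ≠ 0} → N := fun i => ⟨x i, (hxL i).1⟩
  have hli : LinearIndependent R v := by
    rw [linearIndependent_iff']
    intro s g hg
    by_contra! hne
    obtain ⟨j₀, hj₀, hg₀⟩ := hne
    obtain ⟨j, hj, hmax⟩ := (s.filter fun j => g j ≠ 0).exists_maximal
      ⟨j₀, Finset.mem_filter.2 ⟨hj₀, hg₀⟩⟩
    obtain ⟨hjs, hgj⟩ := Finset.mem_filter.1 hj
    have h1 := congrArg ((β.coord j).comp N.subtype) hg
    rw [map_sum, map_zero, Finset.sum_eq_single_of_mem j hjs, map_smul] at h1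
    · refine mul_ne_zero hgj ?_ h1
      change β.coord j (x j) ≠ 0
      rw [hxa]
      exact j.2
    · intro b hb hbj
      by_cases hgb : g b = 0
      · rw [hgb, zero_smul, map_zero]
      · rcases lt_or_ge b j with h | h
        · have h0 : ((β.coord j).comp N.subtype) (v b) = 0 := hxlt _ _ h
          rw [map_smul, h0, smul_zero]
        · exact absurd (le_antisymm (hmax (Finset.mem_filter.2 ⟨hb, hgb⟩) h) h) hbj
  -- every nonzero element has a leading index
  have hlead : ∀ y : B, y ≠ 0 → ∃ i, β.coord i y ≠ 0 ∧ ∀ j, β.coord j y ≠ 0 → j ≤ i := by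
    intro y hy
    have hne : (β.repr y).support.Nonempty := Finsupp.support_nonempty_iff.2 fun h =>
      hy (β.repr.map_eq_zero_iff.1 h)
    exact ⟨(β.repr y).support.max' hne, Finsupp.mem_support_iff.1 (Finset.max'_mem _ hne),
      fun j hj => Finset.le_max' _ _ (Finsupp.mem_support_iff.2 hj)⟩
  have hspan : ∀ i, ∀ y : N, (∀ j, β.coord j y ≠ 0 → j ≤ i) →
      y ∈ Submodule.span R (Set.range v) := by
    intro i
    induction i using WellFoundedLT.induction with
    | ind i ih =>
      have hzero : ∀ y : N, (∀ j, β.coord j y ≠ 0 → j ≤ i) → β.coord i y = 0 →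
          y ∈ Submodule.span R (Set.range v) := by
        intro y hy hyi
        by_cases hy0 : (y : B) = 0
        · have hy1 : y = 0 := Subtype.ext hy0
          rw [hy1]
          exact zero_mem _
        · obtain ⟨l, hl, hmax⟩ := hlead y hy0
          refine ih l (lt_of_le_of_ne (hy l hl) fun h => ?_) y hmax
          rw [h] at hl
          exact hl hyi
      intro y hy
      have hyI : β.coord i y ∈ (L i).map (β.coord i) := ⟨y, (hL i _).2 ⟨y.2, hy⟩, rfl⟩
      obtain ⟨r, hr⟩ := (Submodule.IsPrincipal.mem_iff_eq_smul_generator _).1 hyI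
      by_cases hai : a i = 0
      · exact hzero y hy (by rw [hr]; exact (congrArg (r • ·) hai).trans (smul_zero r))
      · have hmemL : (y : B) - r • x i ∈ L i :=
          sub_mem ((hL i _).2 ⟨y.2, hy⟩) (Submodule.smul_mem _ r (hxL i))
        have h2 := hzero (y - r • v ⟨i, hai⟩) ((hL i _).1 hmemL).2 (by
          change β.coord i ((y : B) - r • x i) = 0
          rw [map_sub, map_smul, hr, hxa]
          exact sub_self _)
        exact (Submodule.sub_mem_iff_left _ (Submodule.smul_mem _ r
          (Submodule.subset_span (Set.mem_range_self (⟨i, hai⟩ : {i // a i ≠ 0}))))).1 h2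
  refine Module.Free.of_basis (Module.Basis.mk hli fun y _ => ?_)
  by_cases hy0 : (y : B) = 0
  · have hy1 : y = 0 := Subtype.ext hy0
    rw [hy1]
    exact zero_mem _
  · obtain ⟨l, -, hmax⟩ := hlead y hy0
    exact hspan l y hmax

/-- A map to a free module over a principal ideal domain splits over its range. -/
theorem exists_section_of_range [Module.Free R B] (f : A →ₗ[R] B) :
    ∃ s : LinearMap.range f →ₗ[R] A, ∀ y, f.rangeRestrict (s y) = y := by
  have := free_submodule (LinearMap.range f)
  obtain ⟨s, hs⟩ := Module.projective_lifting_property f.rangeRestrict LinearMap.id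
    f.surjective_rangeRestrict
  exact ⟨s, fun y => LinearMap.congr_fun hs y⟩

/-- The kernel of a map to a free module over a principal ideal domain is a direct summand, so
functionals on it extend. -/
theorem exists_extend_of_ker [Module.Free R B] (f : A →ₗ[R] B) {M : Type*} [AddCommGroup M]
    [Module R M] (φ : LinearMap.ker f →ₗ[R] M) :
    ∃ ψ : A →ₗ[R] M, ∀ x : LinearMap.ker f, ψ x = φ x := by
  obtain ⟨s, hs'⟩ := exists_section_of_range f
  let p : A →ₗ[R] LinearMap.ker f :=
    (LinearMap.id - s.comp f.rangeRestrict).codRestrict _ fun a => by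
      have := congrArg Subtype.val (hs' (f.rangeRestrict a))
      rw [LinearMap.mem_ker, LinearMap.sub_apply, map_sub, LinearMap.id_apply,
        LinearMap.comp_apply]
      exact sub_eq_zero.2 this.symm
  refine ⟨φ.comp p, fun x => congrArg φ (Subtype.ext ?_)⟩
  have hx : f.rangeRestrict x = 0 := Subtype.ext x.2
  change (x : A) - s (f.rangeRestrict x) = x
  rw [hx, map_zero, sub_zero]

/-- `Ext¹(A/W, R)` is finite for finitely generated `A/W` with `A` free, if all proper quotients of
`R` are finite. In concrete terms: there is a homomorphism from the functionals on `W` to a finite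
group, such that all functionals in its kernel extend to `A`. -/
theorem exists_finite_obstruction (hR : ∀ r : R, r ≠ 0 → Finite (R ⧸ Ideal.span {r}))
    (W : Submodule R A) [Module.Finite R (A ⧸ W)] :
    ∃ (Φ : Type u) (_ : AddCommGroup Φ) (_ : Finite Φ) (θ : (W →ₗ[R] R) →+ Φ),
      ∀ φ, θ φ = 0 → ∃ ψ : A →ₗ[R] R, ∀ w : W, ψ w = φ w := by
  classical
  let T := Submodule.torsion R (A ⧸ W)
  -- the torsion of the finitely generated module `A / W` has a common annihilator
  obtain ⟨N, hN0, hN⟩ : ∃ N : R, N ≠ 0 ∧ ∀ x ∈ T, N • x = 0 := by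
    have hT : T.FG := IsNoetherian.noetherian T
    obtain ⟨s, hs⟩ := hT
    have hr : ∀ x ∈ s, ∃ r : R, r ≠ 0 ∧ r • x = 0 := fun x hx => by
      obtain ⟨r, hr⟩ := (Submodule.mem_torsion_iff x).1 (hs ▸ Submodule.subset_span hx : x ∈ T)
      exact ⟨r, nonZeroDivisors.coe_ne_zero r, hr⟩
    choose! r hr0 hr using hr
    refine ⟨∏ x ∈ s, r x, Finset.prod_ne_zero_iff.2 hr0, fun x hx => ?_⟩
    have : T ≤ LinearMap.ker (LinearMap.lsmul R (A ⧸ W) (∏ x ∈ s, r x)) := by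
      rw [← hs, Submodule.span_le]
      intro y hy
      change (∏ x ∈ s, r x) • y = 0
      rw [← Finset.prod_erase_mul _ _ hy, mul_smul, hr y hy, smul_zero]
    exact this hx
  let W' : Submodule R A := T.comap W.mkQ
  have hNW : ∀ x : W', N • (x : A) ∈ W := fun x => by
    rw [← Submodule.Quotient.mk_eq_zero, Submodule.Quotient.mk_smul]
    exact hN _ x.2
  let m : W' →ₗ[R] W := (N • W'.subtype).codRestrict W hNW
  have hWW' : W ≤ W' := fun w hw => by
    rw [Submodule.mem_comap, Submodule.mkQ_apply, (Submodule.Quotient.mk_eq_zero W).2 hw]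
    exact zero_mem _
  -- the obstruction of `φ` is the map `T → R / N` given by `x ↦ φ (N x)`
  let q := (Ideal.span {N} : Ideal R).mkQ
  have hfinR : Finite (R ⧸ Ideal.span {N}) := hR N hN0
  have hfinT : Module.Finite R T := inferInstance
  obtain ⟨s, hs⟩ : (⊤ : Submodule R T).FG := hfinT.1
  have hlift : ∀ x : T, ∃ a : W', W.mkQ (a : A) = x := fun x => by
    obtain ⟨a, ha⟩ := W.mkQ_surjective x
    exact ⟨⟨a, by rw [Submodule.mem_comap, ha]; exact x.2⟩, ha⟩
  choose l hl using hlift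
  let θ : (W →ₗ[R] R) →+ (s → R ⧸ Ideal.span {N}) :=
    { toFun := fun φ x => q (φ (m (l x)))
      map_zero' := by ext; simp
      map_add' := fun φ ψ => by ext; simp }
  refine ⟨s → R ⧸ Ideal.span {N}, inferInstance, inferInstance, θ, fun φ hφ => ?_⟩
  have hdiv : ∀ a : W', N ∣ φ (m a) := by
    -- the classes in `T` of the elements `a` with this property form a submodule
    have hW : ∀ a : W', (a : A) ∈ W → N ∣ φ (m a) := fun a ha => by
      have : m a = N • (⟨a, ha⟩ : W) := Subtype.ext rfl
      rw [this, map_smul, smul_eq_mul]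
      exact dvd_mul_right _ _
    let P : Submodule R W' := Submodule.comap (φ.comp m) (Ideal.span {N})
    have hP : ∀ a : W', a ∈ P ↔ N ∣ φ (m a) := fun a => Ideal.mem_span_singleton
    let τ : W' →ₗ[R] T := (W.mkQ.comp W'.subtype).codRestrict T fun a => a.2
    have hτ : P.map τ = ⊤ := by
      rw [eq_top_iff, ← hs, Submodule.span_le]
      intro x hx
      refine ⟨l x, ?_, Subtype.ext (hl x)⟩
      have := congrFun hφ ⟨x, hx⟩
      exact (Submodule.Quotient.mk_eq_zero (Ideal.span {N})).1 this
    intro a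
    obtain ⟨b, hb, hba⟩ : τ a ∈ P.map τ := hτ ▸ Submodule.mem_top
    have hab : ((a - b : W') : A) ∈ W := by
      rw [← Submodule.Quotient.mk_eq_zero]
      have : W.mkQ (b : A) = W.mkQ (a : A) := congrArg Subtype.val hba
      change W.mkQ ((a : A) - b) = 0
      rw [map_sub, this, sub_self]
    have := dvd_add (hW _ hab) ((hP b).1 hb)
    rwa [← map_add, ← map_add, sub_add_cancel] at this
  choose φ' hφ' using hdiv
  have hφ'_unique : ∀ a r, φ (m a) = N * r → φ' a = r := fun a r h =>
    mul_left_cancel₀ hN0 ((hφ' a).symm.trans h)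
  let φ'' : W' →ₗ[R] R :=
    { toFun := φ'
      map_add' := fun a b => hφ'_unique _ _ (by rw [map_add, map_add, hφ', hφ', mul_add])
      map_smul' := fun r a => hφ'_unique _ _ (by
        rw [map_smul, map_smul, hφ', smul_eq_mul, RingHom.id_apply, smul_eq_mul]; ring) }
  -- `W'` is the kernel of a map to the free module `(A / W) / T`
  let f : A →ₗ[R] ((A ⧸ W) ⧸ T) := T.mkQ.comp W.mkQ
  have hf : LinearMap.ker f = W' := by
    rw [LinearMap.ker_comp, Submodule.ker_mkQ]
  have : Module.Free R ((A ⧸ W) ⧸ T) := Module.free_of_finite_type_torsion_free'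
  obtain ⟨ψ, hψ⟩ := exists_extend_of_ker f (φ''.comp (LinearEquiv.ofEq _ _ hf).toLinearMap)
  refine ⟨ψ, fun w => ?_⟩
  have hw : (w : A) ∈ LinearMap.ker f := hf ▸ hWW' w.2
  rw [hψ ⟨w, hw⟩]
  refine hφ'_unique _ _ ?_
  have : m ⟨w, hWW' w.2⟩ = N • w := Subtype.ext rfl
  change φ (m ⟨w, hWW' w.2⟩) = _
  rw [this, map_smul, smul_eq_mul]

end Functionals

/-! ### Functionals on subgroups -/

section AdditiveVersions

/-- A homomorphism of abelian groups as a `ℤ`-linear map, for any `ℤ`-module structures. -/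
def intLinear {A B : Type*} [AddCommGroup A] [AddCommGroup B] {modA : Module ℤ A}
    {modB : Module ℤ B} (f : A →+ B) : A →ₗ[ℤ] B where
  toFun := f
  map_add' := map_add f
  map_smul' n a := (congrArg f (int_smul_eq_zsmul modA n a)).trans
    ((map_zsmul f n a).trans (int_smul_eq_zsmul modB n (f a)).symm)

/-- Additive form of `exists_extend_of_ker` over `ℤ`. -/
theorem exists_extend_of_addKer {A B : Type u} [AddCommGroup A] [AddCommGroup B] [Module ℤ B]
    [Module.Free ℤ B] (f : A →+ B) (φ : f.ker →+ ℤ) :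
    ∃ ψ : A →+ ℤ, ∀ x : f.ker, ψ x = φ x := by
  obtain ⟨ψ, hψ⟩ := exists_extend_of_ker (R := ℤ) (intLinear f) (M := ℤ)
    (intLinear φ)
  exact ⟨ψ.toAddMonoidHom, hψ⟩

/-- Additive form over `ℤ` of the splitting of a map to a free module over its range. -/
theorem exists_section_of_addRange {A B : Type u} [AddCommGroup A] [AddCommGroup B] [Module ℤ B]
    [Module.Free ℤ B] (f : A →+ B) :
    ∃ s : f.range →+ A, ∀ y : f.range, f (s y) = y := by
  obtain ⟨s, hs⟩ := exists_section_of_range (R := ℤ) (intLinear f)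
  exact ⟨s.toAddMonoidHom, fun y => congrArg Subtype.val (hs y)⟩

/-- Additive form of `exists_finite_obstruction` over `ℤ`. -/
theorem exists_finite_obstruction_int {A : Type u} [AddCommGroup A] (W : AddSubgroup A)
    (hW : Module.Finite ℤ (A ⧸ W)) :
    ∃ (Φ : Type u) (_ : AddCommGroup Φ) (_ : Finite Φ) (θ : (W →+ ℤ) →+ Φ),
      ∀ φ, θ φ = 0 → ∃ ψ : A →+ ℤ, ∀ w : W, ψ w = φ w := by
  have hfin : Module.Finite ℤ (A ⧸ AddSubgroup.toIntSubmodule W) := hW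
  obtain ⟨Φ, i1, i2, θ, hθ⟩ := exists_finite_obstruction (R := ℤ) (fun r hr => by
    have : NeZero r.natAbs := ⟨Int.natAbs_ne_zero.2 hr⟩
    rw [← Int.span_natAbs]
    exact Finite.of_equiv _ (Int.quotientSpanNatEquivZMod r.natAbs).symm.toEquiv)
    (AddSubgroup.toIntSubmodule W)
  refine ⟨Φ, i1, i2, θ.comp
    { toFun := fun φ => intLinear φ
      map_zero' := rfl
      map_add' := fun _ _ => rfl }, fun φ hφ => ?_⟩
  obtain ⟨ψ, hψ⟩ := hθ _ hφ
  exact ⟨ψ.toAddMonoidHom, hψ⟩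

/-- The homology of a complex of modules, in terms of the underlying abelian groups. -/
noncomputable def quotientAddEquivHomology {R : Type*} [Ring R]
    (S : ShortComplex (ModuleCat.{u} R)) :
    (S.g.hom.toAddMonoidHom.ker ⧸
        S.f.hom.toAddMonoidHom.range.addSubgroupOf S.g.hom.toAddMonoidHom.ker) ≃+
      S.moduleCatLeftHomologyData.H :=
  let q : S.g.hom.toAddMonoidHom.ker →+ S.moduleCatLeftHomologyData.H :=
    (LinearMap.range S.moduleCatToCycles).mkQ.toAddMonoidHom
  have hq : q.ker = S.f.hom.toAddMonoidHom.range.addSubgroupOf S.g.hom.toAddMonoidHom.ker := by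
    ext z
    refine (Submodule.Quotient.mk_eq_zero (LinearMap.range S.moduleCatToCycles)).trans ?_
    constructor
    · rintro ⟨b, hb⟩
      exact ⟨b, congrArg Subtype.val hb⟩
    · rintro ⟨b, hb⟩
      exact ⟨b, Subtype.ext hb⟩
  (QuotientAddGroup.quotientAddEquivOfEq hq.symm).trans
    (QuotientAddGroup.quotientKerEquivOfSurjective q
      (LinearMap.range S.moduleCatToCycles).mkQ_surjective)

end AdditiveVersions

/-! ### Singular cycles, homology classes and the Kronecker pairing -/

section Kronecker

variable {X : Type u} [TopologicalSpace X] {Y : Type u} [TopologicalSpace Y] {Z : Type u}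
  [TopologicalSpace Z]

theorem singChainsMap_comp_apply (g : C(Y, Z)) (f : C(X, Y)) (n : ℕ) (c : (singChains X).X n) :
    ((singChainsMap g).f n).hom (((singChainsMap f).f n).hom c) =
      ((singChainsMap (g.comp f)).f n).hom c := by
  have h : singChainsMap (g.comp f) = singChainsMap f ≫ singChainsMap g :=
    ((singularChainComplexFunctor (ModuleCat.{u} ℤ)).obj
      (ModuleCat.of ℤ (ULift.{u} ℤ))).map_comp (TopCat.ofHom f) (TopCat.ofHom g)
  rw [h]
  rfl

theorem singChainsMap_id_apply (n : ℕ) (c : (singChains X).X n) :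
    ((singChainsMap (ContinuousMap.id X)).f n).hom c = c := by
  have h : singChainsMap (ContinuousMap.id X) = 𝟙 _ :=
    ((singularChainComplexFunctor (ModuleCat.{u} ℤ)).obj
      (ModuleCat.of ℤ (ULift.{u} ℤ))).map_id (TopCat.of X)
  rw [h]
  rfl

theorem singChainsMap_d_apply (f : C(X, Y)) (i j : ℕ) (c : (singChains X).X i) :
    ((singChainsMap f).f j).hom (((singChains X).d i j).hom c) =
      ((singChains Y).d i j).hom (((singChainsMap f).f i).hom c) :=
  (LinearMap.congr_fun (congrArg ModuleCat.Hom.hom ((singChainsMap f).comm i j)) c).symm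

theorem singChains_d_d_apply (i j k : ℕ) (c : (singChains X).X i) :
    ((singChains X).d j k).hom (((singChains X).d i j).hom c) = 0 :=
  LinearMap.congr_fun (congrArg ModuleCat.Hom.hom ((singChains X).d_comp_d i j k)) c

theorem singChainsMap_injective {f : C(X, Y)} (hf : Function.Injective f) (n : ℕ) :
    Function.Injective ((singChainsMap f).f n).hom := by
  intro c c' h
  apply (singEquiv n).injective
  apply augMap_injective hf
  rw [← singEquiv_map, ← singEquiv_map, h]

instance (n : ℕ) : Module.Free ℤ ((singChains X).X n) := Module.Free.of_equiv (singEquiv n).symm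

variable (X)

/-- The singular `n`-cycles. In degree `0` the map `d 0 0` is zero, so every chain is a cycle. -/
noncomputable def singCycles (n : ℕ) : AddSubgroup ((singChains X).X n) :=
  ((singChains X).d n (n - 1)).hom.toAddMonoidHom.ker

/-- The singular `n`-boundaries. -/
noncomputable def singBoundaries (n : ℕ) : AddSubgroup ((singChains X).X n) :=
  ((singChains X).d (n + 1) n).hom.toAddMonoidHom.range

/-- Singular homology as cycles modulo boundaries. -/
abbrev CycHomology (n : ℕ) : Type u :=
  singCycles X n ⧸ (singBoundaries X n).addSubgroupOf (singCycles X n)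

variable {X}

theorem singBoundaries_le_cycles (n : ℕ) : singBoundaries X n ≤ singCycles X n := by
  rintro _ ⟨b, rfl⟩
  exact singChains_d_d_apply _ _ _ b

/-- The homology class of a cycle. -/
noncomputable def homClass {n : ℕ} (z : singCycles X n) : CycHomology X n := QuotientAddGroup.mk z

theorem homClass_surjective {n : ℕ} (a : CycHomology X n) : ∃ z, homClass z = a :=
  QuotientAddGroup.mk_surjective a

theorem homClass_eq_zero_iff {n : ℕ} (z : singCycles X n) :
    homClass z = 0 ↔ (z : (singChains X).X n) ∈ singBoundaries X n :=
  (QuotientAddGroup.eq_zero_iff z).trans AddSubgroup.mem_addSubgroupOf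

/-- Cycles modulo boundaries agree with Mathlib's singular homology. -/
noncomputable def cycHomologyEquiv (X : Type u) [TopologicalSpace X] (n : ℕ) :
    CycHomology X n ≃+ SingHomology X n :=
  have hnext : (ComplexShape.down ℕ).next n = n - 1 := by
    cases n with
    | zero => exact ChainComplex.next_nat_zero
    | succ n => exact ChainComplex.next_nat_succ n
  let S := (singChains X).sc' (n + 1) n (n - 1)
  let e : SingHomology X n ≅ S.moduleCatLeftHomologyData.H :=
    (singChains X).homologyIsoSc' (n + 1) n (n - 1) (ChainComplex.prev ℕ n) hnext ≪≫
      S.moduleCatHomologyIso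
  (quotientAddEquivHomology S).trans e.toLinearEquiv.toAddEquiv.symm

/-- The map on cycles induced by a continuous map. -/
noncomputable def singCycleMap (f : C(X, Y)) (n : ℕ) : singCycles X n →+ singCycles Y n :=
  (((singChainsMap f).f n).hom.toAddMonoidHom.comp (singCycles X n).subtype).codRestrict _
    fun c => by
      have hc : ((singChains X).d n (n - 1)).hom c = 0 := c.2
      change ((singChains Y).d n (n - 1)).hom (((singChainsMap f).f n).hom c) = 0
      rw [← singChainsMap_d_apply, hc, map_zero]

/-- The map on homology induced by a continuous map. -/
noncomputable def cycHomologyMap (f : C(X, Y)) (n : ℕ) : CycHomology X n →+ CycHomology Y n :=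
  QuotientAddGroup.map _ _ (singCycleMap f n) (by
    rintro ⟨c, hc⟩ ⟨b, hb⟩
    have hb' : ((singChains X).d (n + 1) n).hom b = c := hb
    refine ⟨((singChainsMap f).f (n + 1)).hom b, ?_⟩
    change ((singChains Y).d (n + 1) n).hom (((singChainsMap f).f (n + 1)).hom b) =
      ((singChainsMap f).f n).hom c
    rw [← singChainsMap_d_apply, hb'])

theorem cycHomologyMap_class (f : C(X, Y)) (n : ℕ) (z : singCycles X n) :
    cycHomologyMap f n (homClass z) = homClass (singCycleMap f n z) := rfl

theorem cycHomologyMap_comp (g : C(Y, Z)) (f : C(X, Y)) (n : ℕ) (a : CycHomology X n) :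
    cycHomologyMap g n (cycHomologyMap f n a) = cycHomologyMap (g.comp f) n a := by
  obtain ⟨z, rfl⟩ := homClass_surjective a
  rw [cycHomologyMap_class, cycHomologyMap_class, cycHomologyMap_class]
  exact congrArg _ (Subtype.ext (singChainsMap_comp_apply g f n z))

theorem cycHomologyMap_id (n : ℕ) (a : CycHomology X n) :
    cycHomologyMap (ContinuousMap.id X) n a = a := by
  obtain ⟨z, rfl⟩ := homClass_surjective a
  rw [cycHomologyMap_class]
  exact congrArg _ (Subtype.ext (singChainsMap_id_apply n z.1))

theorem singCohomologyMap_id (n : ℕ) (x : SingCohomology X n) :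
    singCohomologyMap (ContinuousMap.id X) n x = x := by
  obtain ⟨c, rfl⟩ := Submodule.Quotient.mk_surjective _ x
  have h : singCocycleMap (ContinuousMap.id X) n c = c :=
    Subtype.ext (LinearMap.ext fun y => congrArg c.1 (singChainsMap_id_apply n y))
  change Submodule.Quotient.mk _ = Submodule.Quotient.mk _
  rw [h]

theorem singCoboundary_apply (i j : ℕ) (c : SingCochain X i) (y : (singChains X).X j) :
    singCoboundary X i j c y = c (((singChains X).d j i).hom y) := rfl

theorem singCocycle_apply_boundary {n : ℕ} (c : singCocycles X n) {z : (singChains X).X n}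
    (hz : z ∈ singBoundaries X n) : c.1 z = 0 := by
  obtain ⟨b, rfl⟩ := hz
  exact LinearMap.congr_fun (c.2 : singCoboundary X n (n + 1) c.1 = 0) b

variable (X)

/-- The value of a cocycle on homology classes. -/
noncomputable def cocycleEval (n : ℕ) : singCocycles X n →+ (CycHomology X n →ₗ[ℤ] ℤ) where
  toFun c := (QuotientAddGroup.lift _ (c.1.toAddMonoidHom.comp (singCycles X n).subtype)
    fun _ hz => singCocycle_apply_boundary c hz).toIntLinearMap
  map_zero' := LinearMap.ext fun a => by
    obtain ⟨z, rfl⟩ := homClass_surjective a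
    rfl
  map_add' c c' := LinearMap.ext fun a => by
    obtain ⟨z, rfl⟩ := homClass_surjective a
    rfl

/-- The Kronecker map `H^n(X) → Hom(H_n(X), ℤ)`. -/
noncomputable def kronecker (n : ℕ) : SingCohomology X n →+ (CycHomology X n →ₗ[ℤ] ℤ) :=
  QuotientAddGroup.lift ((singCoboundaries X n).submoduleOf (singCocycles X n)).toAddSubgroup
    (cocycleEval X n) (by
      rintro ⟨c, hc⟩ ⟨b, hb⟩
      refine LinearMap.ext fun a => ?_
      obtain ⟨z, rfl⟩ := homClass_surjective a
      have hb' : singCoboundary X (n - 1) n b = c := hb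
      have hz : ((singChains X).d n (n - 1)).hom z.1 = 0 := z.2
      change c z.1 = 0
      rw [← hb', singCoboundary_apply, hz, map_zero])

variable {X}

/-- The cohomology class of a cocycle. -/
noncomputable def cohClass {n : ℕ} (c : singCocycles X n) : SingCohomology X n :=
  Submodule.Quotient.mk c

theorem cohClass_surjective {n : ℕ} (x : SingCohomology X n) : ∃ c, cohClass c = x :=
  Submodule.Quotient.mk_surjective _ x

theorem cohClass_sub {n : ℕ} (c c' : singCocycles X n) :
    cohClass (c - c') = cohClass c - cohClass c' := rfl

theorem cohClass_eq_zero_iff {n : ℕ} (c : singCocycles X n) :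
    cohClass c = 0 ↔ ∃ b, singCoboundary X (n - 1) n b = c.1 :=
  Submodule.Quotient.mk_eq_zero _

theorem singCohomologyMap_class (f : C(X, Y)) {n : ℕ} (c : singCocycles Y n) :
    singCohomologyMap f n (cohClass c) = cohClass (singCocycleMap f n c) := rfl

theorem kronecker_map (f : C(X, Y)) (n : ℕ) (x : SingCohomology Y n) (a : CycHomology X n) :
    kronecker X n (singCohomologyMap f n x) a = kronecker Y n x (cycHomologyMap f n a) := by
  obtain ⟨c, rfl⟩ := cohClass_surjective x
  obtain ⟨z, rfl⟩ := homClass_surjective a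
  rfl

/-- The cycles are a direct summand of the chains, so functionals on homology extend to
cocycles. -/
theorem kronecker_surjective (n : ℕ) : Function.Surjective (kronecker X n) := by
  intro φ
  obtain ⟨ψ, hψ⟩ := exists_extend_of_addKer ((singChains X).d n (n - 1)).hom.toAddMonoidHom
    (φ.toAddMonoidHom.comp
      (QuotientAddGroup.mk' ((singBoundaries X n).addSubgroupOf (singCycles X n))))
  have hcoc : intLinear ψ ∈ singCocycles X n := by
    refine LinearMap.ext fun b => ?_
    have hb : ((singChains X).d (n + 1) n).hom b ∈ singBoundaries X n := ⟨b, rfl⟩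
    have h0 : homClass ⟨_, singBoundaries_le_cycles n hb⟩ = 0 := (homClass_eq_zero_iff _).2 hb
    exact ((hψ ⟨_, singBoundaries_le_cycles n hb⟩).trans (congrArg φ h0)).trans (map_zero φ)
  refine ⟨cohClass ⟨intLinear ψ, hcoc⟩, LinearMap.ext fun a => ?_⟩
  obtain ⟨z, rfl⟩ := homClass_surjective a
  exact hψ z

/-- In degree `0` every chain is a cycle and there are no coboundaries, so a class is determined by
its values. -/
theorem kronecker_zero_injective (x : SingCohomology X 0) (hx : kronecker X 0 x = 0) : x = 0 := by
  obtain ⟨c, rfl⟩ := cohClass_surjective x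
  have hc : c = 0 := by
    refine Subtype.ext (LinearMap.ext fun y => ?_)
    have hy : y ∈ singCycles X 0 := by
      change ((singChains X).d 0 0).hom y = 0
      rw [(singChains X).shape 0 0 (by simp)]
      rfl
    exact LinearMap.congr_fun hx (homClass ⟨y, hy⟩)
  rw [hc]
  rfl

/-- The restriction to `X` of cohomology classes of `Y` in the kernel of the Kronecker map takes
only finitely many values when the image of `H_n(X) → H_n(Y)` is finitely generated: this image
group has finite `Ext¹`. -/
theorem finite_image_ker_kronecker (f : C(X, Y)) (n : ℕ)
    (hfg : (LinearMap.range (cycHomologyMap f n).toIntLinearMap).FG) :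
    (singCohomologyMap f (n + 1) '' {x | kronecker Y (n + 1) x = 0}).Finite := by
  classical
  -- the cycles of `X` that bound in `Y`
  let τ : singCycles X n →+ CycHomology Y n :=
    (cycHomologyMap f n).comp (QuotientAddGroup.mk' _)
  let W : AddSubgroup (singCycles X n) := τ.ker
  have hfinW : Module.Finite ℤ (singCycles X n ⧸ W) := by
    have hN : IsNoetherian ℤ (LinearMap.range (cycHomologyMap f n).toIntLinearMap) :=
      isNoetherian_of_fg_of_noetherian _ hfg
    have hmem : ∀ z, τ z ∈ LinearMap.range (cycHomologyMap f n).toIntLinearMap := fun z =>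
      ⟨homClass z, rfl⟩
    let κ : (singCycles X n ⧸ W) →+ LinearMap.range (cycHomologyMap f n).toIntLinearMap :=
      ((QuotientAddGroup.kerLift τ).codRestrict
        (LinearMap.range (cycHomologyMap f n).toIntLinearMap).toAddSubgroup fun z => by
          obtain ⟨z, rfl⟩ := QuotientAddGroup.mk_surjective z
          exact hmem z)
    exact Module.Finite.of_injective (intLinear κ) fun a b h =>
      QuotientAddGroup.kerLift_injective τ (congrArg Subtype.val h)
  obtain ⟨Φ, _, _, θ, hθ⟩ := exists_finite_obstruction_int W hfinW
  -- an additive choice of chains in `Y` with given boundary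
  obtain ⟨s, hs⟩ : ∃ s : singBoundaries Y n →+ (singChains Y).X (n + 1), ∀ y : singBoundaries Y n,
      ((singChains Y).d (n + 1) n).hom (s y) = y :=
    exists_section_of_addRange ((singChains Y).d (n + 1) n).hom.toAddMonoidHom
  have hW : ∀ w : W, ((singChainsMap f).f n).hom w.1.1 ∈ singBoundaries Y n := fun w =>
    (homClass_eq_zero_iff (singCycleMap f n w.1)).1 w.2
  let l : W →+ singBoundaries Y n :=
    (((singChainsMap f).f n).hom.toAddMonoidHom.comp
      ((singCycles X n).subtype.comp W.subtype)).codRestrict _ hW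
  let χ : singCocycles Y (n + 1) →+ Φ := θ.comp
    { toFun := fun c => c.1.toAddMonoidHom.comp (s.comp l)
      map_zero' := rfl
      map_add' := fun _ _ => rfl }
  have key : ∀ c : singCocycles Y (n + 1), kronecker Y (n + 1) (cohClass c) = 0 → χ c = 0 →
      singCohomologyMap f (n + 1) (cohClass c) = 0 := by
    intro c hc hχ
    obtain ⟨ψ, hψ⟩ := hθ (c.1.toAddMonoidHom.comp (s.comp l)) hχ
    obtain ⟨ψ', hψ'⟩ := exists_extend_of_addKer
      ((singChains X).d n (n - 1)).hom.toAddMonoidHom ψ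
    rw [singCohomologyMap_class, cohClass_eq_zero_iff]
    refine ⟨intLinear ψ', LinearMap.ext fun y => ?_⟩
    have hy : ((singChains X).d (n + 1) n).hom y ∈ singCycles X n :=
      singBoundaries_le_cycles n ⟨y, rfl⟩
    have hyb : ((singChainsMap f).f n).hom (((singChains X).d (n + 1) n).hom y) ∈
        singBoundaries Y n := ⟨_, (singChainsMap_d_apply f (n + 1) n y).symm⟩
    have hyW : (⟨_, hy⟩ : singCycles X n) ∈ W :=
      (homClass_eq_zero_iff (singCycleMap f n ⟨_, hy⟩)).2 hyb
    have h1 : ψ' (((singChains X).d (n + 1) n).hom y) = c.1 (s ⟨_, hyb⟩) :=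
      (hψ' ⟨_, hy⟩).trans (hψ ⟨_, hyW⟩)
    have h2 : ((singChainsMap f).f (n + 1)).hom y - s ⟨_, hyb⟩ ∈ singCycles Y (n + 1) := by
      change ((singChains Y).d (n + 1) n).hom _ = 0
      rw [map_sub, hs, ← singChainsMap_d_apply]
      exact sub_self _
    have h3 : c.1 (((singChainsMap f).f (n + 1)).hom y - s ⟨_, hyb⟩) = 0 :=
      LinearMap.congr_fun hc (homClass ⟨_, h2⟩)
    rw [map_sub, sub_eq_zero] at h3
    change ψ' (((singChains X).d (n + 1) n).hom y) = c.1 (((singChainsMap f).f (n + 1)).hom y)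
    rw [h1, h3]
  -- hence the restriction of a class only depends on the obstruction of a representing cocycle
  choose r hr using cohClass_surjective (X := Y) (n := n + 1)
  have hdep : ∀ x x', kronecker Y (n + 1) x = 0 → kronecker Y (n + 1) x' = 0 →
      χ (r x) = χ (r x') → singCohomologyMap f (n + 1) x = singCohomologyMap f (n + 1) x' := by
    intro x x' hx hx' h
    have := key (r x - r x') (by rw [cohClass_sub, hr, hr, map_sub, hx, hx', sub_zero])
      (by rw [map_sub, h, sub_self])
    rwa [cohClass_sub, hr, hr, map_sub, sub_eq_zero] at this
  let pick : Φ → SingCohomology X (n + 1) := fun q =>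
    if h : ∃ x, kronecker Y (n + 1) x = 0 ∧ χ (r x) = q then singCohomologyMap f (n + 1) h.choose
    else 0
  refine (Set.finite_range pick).subset ?_
  rintro _ ⟨x, hx, rfl⟩
  refine ⟨χ (r x), ?_⟩
  have h : ∃ x', kronecker Y (n + 1) x' = 0 ∧ χ (r x') = χ (r x) := ⟨x, hx, rfl⟩
  simp only [pick, dif_pos h]
  exact hdep _ _ h.choose_spec.1 hx h.choose_spec.2

end Kronecker

/-! ### The homology and cohomology of an exhaustion -/

section ExhaustionTowers

variable {X : Type u} [TopologicalSpace X]

/-- The cohomology groups of a nested sequence of subspaces, with all restriction maps. -/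
noncomputable def cohomologyTower (M : ℕ → Set X) (hM : Monotone M) (n : ℕ) :
    TowerSystem fun i => SingCohomology (M i) n where
  map _ _ hij := singCohomologyMap (ContinuousMap.inclusion (hM hij)) n
  map_refl _ a := singCohomologyMap_id n a
  map_map _ _ _ hij hjk a :=
    singCohomologyMap_comp (ContinuousMap.inclusion (hM hjk)) (ContinuousMap.inclusion (hM hij)) n a

/-- The homology groups of a nested sequence of subspaces. -/
noncomputable def homologySystem (M : ℕ → Set X) (hM : Monotone M) (n : ℕ) :
    IndSystem ℤ fun i => CycHomology (M i) n where
  map _ _ hij := (cycHomologyMap (ContinuousMap.inclusion (hM hij)) n).toIntLinearMap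
  map_refl _ a := cycHomologyMap_id n a
  map_map _ _ _ hij hjk a :=
    cycHomologyMap_comp (ContinuousMap.inclusion (hM hjk)) (ContinuousMap.inclusion (hM hij)) n a

/-- The transition maps on homology eventually have finitely generated image. -/
def HomologyStablyFG (M : ℕ → Set X) (hM : Monotone M) : Prop :=
  ∀ n i, ∃ j, ∃ hij : i ≤ j, (LinearMap.range ((homologySystem M hM n).map i j hij)).FG

/-- The kernels of the Kronecker maps have vanishing `lim¹`. -/
theorem exists_oneSubBonding_eq_of_kronecker (M : ℕ → Set X) (hM : Monotone M)
    (hfg : HomologyStablyFG M hM) (n : ℕ) (a : ∀ i, SingCohomology (M i) n)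
    (ha : ∀ i, kronecker (M i) n (a i) = 0) :
    ∃ x, oneSubBonding _ (cohomologyTower M hM n).bonding x = a := by
  cases n with
  | zero =>
    refine ⟨0, ?_⟩
    rw [map_zero]
    exact funext fun i => (kronecker_zero_injective _ (ha i)).symm
  | succ n =>
    let F : TowerSystem fun i => (kronecker (M i) (n + 1)).ker :=
      { map := fun i j hij => ((((cohomologyTower M hM (n + 1)).map i j hij).comp
          (kronecker (M j) (n + 1)).ker.subtype).codRestrict _ fun x => by
            have hx : kronecker (M j) (n + 1) x.1 = 0 := x.2
            refine LinearMap.ext fun b => (kronecker_map _ (n + 1) x.1 b).trans ?_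
            rw [hx]
            rfl)
        map_refl := fun i x => Subtype.ext ((cohomologyTower M hM (n + 1)).map_refl i x)
        map_map := fun i j k hij hjk x =>
          Subtype.ext ((cohomologyTower M hM (n + 1)).map_map i j k hij hjk x) }
    have hF := F.oneSubBonding_surjective_of_finite fun i => by
      obtain ⟨j, hij, hj⟩ := hfg n i
      refine ⟨j, hij, Set.Finite.of_finite_image
        ((finite_image_ker_kronecker _ n hj).subset ?_) Subtype.val_injective.injOn⟩
      rintro _ ⟨_, ⟨x, rfl⟩, rfl⟩
      exact ⟨x.1, x.2, rfl⟩
    obtain ⟨x, hx⟩ := hF fun i => ⟨a i, ha i⟩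
    exact ⟨fun i => x i, funext fun i => congrArg Subtype.val (congrFun hx i)⟩

/-- `lim¹` of cohomology only depends on homology. -/
theorem nonempty_limOneCohomology_equiv_dual (M : ℕ → Set X) (hM : Monotone M)
    (hfg : HomologyStablyFG M hM) (n : ℕ) :
    Nonempty (LimOneCohomology M hM n ≃+
      TowerLimOne (fun i => CycHomology (M i) n →ₗ[ℤ] ℤ) (homologySystem M hM n).dual.bonding) := by
  have hg : ∀ i a, kronecker (M i) n (cohomologyBonding M hM n i a) =
      (homologySystem M hM n).dual.bonding i (kronecker (M (i + 1)) n a) := fun i a =>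
    LinearMap.ext fun b => kronecker_map (ContinuousMap.inclusion (hM i.le_succ)) n a b
  have hker : ∀ a : ∀ i, SingCohomology (M i) n, (∀ i, kronecker (M i) n (a i) = 0) →
      ∃ x, oneSubBonding _ (cohomologyBonding M hM n) x = a :=
    exists_oneSubBonding_eq_of_kronecker M hM hfg n
  have hbij := towerLimOneMap_bijective_of_surjective hg (fun i => kronecker_surjective n) hker
  exact ⟨AddEquiv.ofBijective _ hbij⟩

/-- Torsion-freeness modulo torsion, for the `ℤ`-module structure of the additive group: it agrees
with the quotient module structure, but not definitionally. -/
theorem isTorsionFree_int_quotient_torsion (A : Type u) [AddCommGroup A] [Module ℤ A] :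
    @Module.IsTorsionFree ℤ (A ⧸ Submodule.torsion ℤ A) _ _
      (AddCommGroup.toIntModule (A ⧸ Submodule.torsion ℤ A)) := by
  have h : AddCommGroup.toIntModule (A ⧸ Submodule.torsion ℤ A) =
      Submodule.Quotient.module (Submodule.torsion ℤ A) :=
    (AddCommGroup.uniqueIntModule.uniq _).trans (AddCommGroup.uniqueIntModule.uniq _).symm
  rw [h]
  exact Submodule.QuotientTorsion.instIsTorsionFree

theorem uLift_int_module_eq :
    (ULift.module' : Module ℤ (ULift.{u} ℤ)) = AddCommGroup.toIntModule (ULift.{u} ℤ) :=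
  (AddCommGroup.uniqueIntModule.uniq _).trans (AddCommGroup.uniqueIntModule.uniq _).symm

end ExhaustionTowers

/-! ### Homology as a colimit -/

section ExhaustionColimit

variable {X : Type u} [TopologicalSpace X]

/-- Every compact subset lies in some member of the sequence. -/
def AbsorbsCompacts (M : ℕ → Set X) : Prop := ∀ K, IsCompact K → ∃ i, K ⊆ M i

theorem AbsorbsCompacts.exists_simplex {M : ℕ → Set X} (hM' : AbsorbsCompacts M) {k : ℕ}
    (σ : SingSimplex k X) : ∃ i, ∀ t, σ t ∈ M i := by
  obtain ⟨i, hi⟩ := hM' _ (isCompact_range σ.continuous)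
  exact ⟨i, fun t => hi ⟨t, rfl⟩⟩

theorem singChainsMap_subspaceIncl_injective (S : Set X) (n : ℕ) :
    Function.Injective ((singChainsMap (subspaceIncl S)).f n).hom :=
  singChainsMap_injective (f := subspaceIncl S) Subtype.val_injective n

/-- Every chain of `X` lies in some member of the exhaustion. -/
theorem exists_singChainsMap_eq {M : ℕ → Set X} (hM : Monotone M) (hM' : AbsorbsCompacts M)
    {n : ℕ} (c : (singChains X).X n) :
    ∃ i, ∃ c', ((singChainsMap (subspaceIncl (M i))).f n).hom c' = c := by
  have h : ∀ a : AugChain (n + 1) X, ∃ i, a ∈ carriedBy (n + 1) (M i) := by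
    intro a
    induction a using Finsupp.induction_linear with
    | zero => exact ⟨0, zero_mem _⟩
    | add a b ha hb =>
      obtain ⟨i, hi⟩ := ha
      obtain ⟨j, hj⟩ := hb
      exact ⟨max i j, add_mem (carriedBy_mono (hM (le_max_left i j)) hi)
        (carriedBy_mono (hM (le_max_right i j)) hj)⟩
    | single σ a =>
      obtain ⟨i, hi⟩ := hM'.exists_simplex σ
      exact ⟨i, Finsupp.single_mem_supported ℤ a hi⟩
  obtain ⟨i, hi⟩ := h (singEquiv n c)
  obtain ⟨c', hc'⟩ := exists_augMap_eq hi
  refine ⟨i, (singEquiv n).symm c', (singEquiv n).injective ?_⟩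
  rw [singEquiv_map, LinearEquiv.apply_symm_apply, hc']

theorem exists_singChainsMap_eq_of_le {M : ℕ → Set X} (hM : Monotone M) (hM' : AbsorbsCompacts M)
    {n : ℕ} (c : (singChains X).X n) (i : ℕ) :
    ∃ j, i ≤ j ∧ ∃ c', ((singChainsMap (subspaceIncl (M j))).f n).hom c' = c := by
  obtain ⟨j, c', rfl⟩ := exists_singChainsMap_eq hM hM' c
  refine ⟨max i j, le_max_left i j, ((singChainsMap (ContinuousMap.inclusion
    (hM (le_max_right i j)))).f n).hom c', singChainsMap_comp_apply _ _ _ _⟩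

theorem exists_cycHomologyMap_eq {M : ℕ → Set X} (hM : Monotone M) (hM' : AbsorbsCompacts M)
    {n : ℕ} (a : CycHomology X n) :
    ∃ i b, cycHomologyMap (subspaceIncl (M i)) n b = a := by
  obtain ⟨⟨z, hz⟩, rfl⟩ := homClass_surjective a
  obtain ⟨i, z', rfl⟩ := exists_singChainsMap_eq hM hM' z
  have hz' : z' ∈ singCycles (M i) n := by
    apply singChainsMap_subspaceIncl_injective (M i) (n - 1)
    exact (singChainsMap_d_apply (subspaceIncl (M i)) n (n - 1) z').trans
      ((hz : ((singChains X).d n (n - 1)).hom _ = 0).trans (map_zero _).symm)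
  exact ⟨i, homClass ⟨z', hz'⟩, rfl⟩

theorem exists_map_eq_zero_of_cycHomologyMap_eq_zero {M : ℕ → Set X} (hM : Monotone M)
    (hM' : AbsorbsCompacts M) {n i : ℕ} (a : CycHomology (M i) n)
    (ha : cycHomologyMap (subspaceIncl (M i)) n a = 0) :
    ∃ j, ∃ hij : i ≤ j, cycHomologyMap (ContinuousMap.inclusion (hM hij)) n a = 0 := by
  obtain ⟨z, rfl⟩ := homClass_surjective a
  obtain ⟨b, hb⟩ := (homClass_eq_zero_iff _).1 ha
  have hb' : ((singChains X).d (n + 1) n).hom b =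
    ((singChainsMap (subspaceIncl (M i))).f n).hom z := hb
  obtain ⟨j, hij, b', rfl⟩ := exists_singChainsMap_eq_of_le hM hM' b i
  refine ⟨j, hij, (homClass_eq_zero_iff _).2 ⟨b', ?_⟩⟩
  apply singChainsMap_subspaceIncl_injective (M j) n
  exact (singChainsMap_d_apply (subspaceIncl (M j)) (n + 1) n b').trans (hb'.trans
    (singChainsMap_comp_apply (subspaceIncl (M j)) (ContinuousMap.inclusion (hM hij)) n z).symm)

/-- `lim¹` of the cohomology of an exhaustion is `Ext` of the homology modulo torsion. -/
theorem nonempty_limOneCohomology_equiv_ext {M : ℕ → Set X} (hM : Monotone M)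
    (hM' : AbsorbsCompacts M) (hfg : HomologyStablyFG M hM) (n : ℕ) :
    Nonempty (LimOneCohomology M hM n ≃+ ExtModTorsion (SingHomology X n)) := by
  obtain ⟨e₁⟩ := nonempty_limOneCohomology_equiv_dual M hM hfg n
  let Q : Type u := SingHomology X n ⧸ Submodule.torsion ℤ (SingHomology X n)
  have : Module.IsTorsionFree ℤ Q := isTorsionFree_int_quotient_torsion (SingHomology X n)
  let ε : CycHomology X n →+ Q :=
    (Submodule.torsion ℤ (SingHomology X n)).mkQ.toAddMonoidHom.comp
      (cycHomologyEquiv X n).toAddMonoidHom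
  have hε : ∀ a, ε a = 0 → ∃ r : ℤ, r ≠ 0 ∧ r • a = 0 := by
    intro a ha
    have h := (Submodule.Quotient.mk_eq_zero (Submodule.torsion ℤ (SingHomology X n))).1 ha
    rw [Submodule.mem_torsion_iff] at h
    obtain ⟨r, hr⟩ := h
    refine ⟨r, nonZeroDivisors.coe_ne_zero r, (cycHomologyEquiv X n).injective ?_⟩
    rw [map_zsmul, map_zero]
    exact (int_smul_eq_zsmul _ _ _).symm.trans hr
  obtain ⟨e₂⟩ := (homologySystem M hM n).nonempty_limOne_dual_equiv_ext (Q := Q)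
    (fun i => (ε.comp (cycHomologyMap (subspaceIncl (M i)) n)).toIntLinearMap)
    (fun i j hij a => congrArg ε (cycHomologyMap_comp (subspaceIncl (M j))
      (ContinuousMap.inclusion (hM hij)) n a))
    (fun q => by
      obtain ⟨h, rfl⟩ := Submodule.mkQ_surjective _ q
      obtain ⟨a, rfl⟩ := (cycHomologyEquiv X n).surjective h
      obtain ⟨i, b, rfl⟩ := exists_cycHomologyMap_eq hM hM' a
      exact ⟨i, b, rfl⟩)
    (hfg n)
    (fun i a ha => by
      obtain ⟨r, hr, hra⟩ := hε _ ha
      rw [← map_zsmul] at hra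
      obtain ⟨j, hij, hj⟩ := exists_map_eq_zero_of_cycHomologyMap_eq_zero hM hM' (r • a) hra
      exact ⟨r, hr, j, hij, (map_zsmul _ r a).symm.trans hj⟩)
  have h : (ULift.module' : Module ℤ (ULift.{u} ℤ)) = AddCommGroup.toIntModule (ULift.{u} ℤ) :=
    uLift_int_module_eq
  rw [h] at e₂
  exact ⟨e₁.trans e₂⟩

end ExhaustionColimit

/-! ### Gluing cochains along an exhaustion -/

section Gluing

variable {X : Type u} [TopologicalSpace X] {Y : Type u} [TopologicalSpace Y] {Z : Type u}
  [TopologicalSpace Z]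

theorem singCoboundary_coboundary (i j k : ℕ) (c : SingCochain X i) :
    singCoboundary X j k (singCoboundary X i j c) = 0 :=
  LinearMap.ext fun y =>
    (congrArg c (singChains_d_d_apply k j i y)).trans (map_zero c)

theorem singCochainMap_comp (g : C(Y, Z)) (f : C(X, Y)) (n : ℕ) (c : SingCochain Z n) :
    singCochainMap f n (singCochainMap g n c) = singCochainMap (g.comp f) n c :=
  LinearMap.ext fun y => congrArg c (singChainsMap_comp_apply g f n y)

/-- Cochains on a family of subspaces glue if they agree on common chains: the simplices form a
basis of the chains. -/
theorem exists_glue {ι : Type*} (S : ι → Set X) (n : ℕ) (b : ∀ i, SingCochain (S i) n)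
    (hb : ∀ i j c c', ((singChainsMap (subspaceIncl (S i))).f n).hom c =
      ((singChainsMap (subspaceIncl (S j))).f n).hom c' → b i c = b j c') :
    ∃ B : SingCochain X n, ∀ i, singCochainMap (subspaceIncl (S i)) n B = b i := by
  classical
  let P : SingSimplex (n + 1) X → Prop := fun σ =>
    ∃ i c, ((singChainsMap (subspaceIncl (S i))).f n).hom c =
      (singEquiv n).symm (Finsupp.single σ 1)
  let v : SingSimplex (n + 1) X → ℤ := fun σ =>
    if h : P σ then b h.choose h.choose_spec.choose else 0
  have hv : ∀ i (τ : SingSimplex (n + 1) (S i)),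
      v ((subspaceIncl (S i)).comp τ) = b i ((singEquiv n).symm (Finsupp.single τ 1)) := by
    intro i τ
    have hi : ((singChainsMap (subspaceIncl (S i))).f n).hom
        ((singEquiv n).symm (Finsupp.single τ 1)) =
          (singEquiv n).symm (Finsupp.single ((subspaceIncl (S i)).comp τ) 1) := by
      apply (singEquiv n).injective
      rw [singEquiv_map, LinearEquiv.apply_symm_apply, LinearEquiv.apply_symm_apply, augMap_single]
    have h : P ((subspaceIncl (S i)).comp τ) := ⟨i, _, hi⟩
    simp only [v, dif_pos h]
    exact hb _ _ _ _ (h.choose_spec.choose_spec.trans hi.symm)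
  refine ⟨(Finsupp.linearCombination ℤ v).comp (singEquiv n).toLinearMap, fun i => ?_⟩
  have h : ((Finsupp.linearCombination ℤ v).comp (augMap (subspaceIncl (S i)) (n + 1))) =
      (b i).comp (singEquiv n).symm.toLinearMap := by
    refine Finsupp.lhom_ext' fun τ => LinearMap.ext_ring ?_
    change Finsupp.linearCombination ℤ v (augMap _ _ (Finsupp.single τ 1)) =
      b i ((singEquiv n).symm (Finsupp.single τ 1))
    rw [augMap_single, Finsupp.linearCombination_single, one_smul, hv]
  refine LinearMap.ext fun y => ?_
  have hy := LinearMap.congr_fun h (singEquiv n y)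
  refine (congrArg (Finsupp.linearCombination ℤ v) (singEquiv_map (subspaceIncl (S i)) n y)).trans
    (hy.trans ?_)
  exact congrArg (b i) ((singEquiv n).symm_apply_apply y)

theorem exists_extend_cochain (S : Set X) (n : ℕ) (b : SingCochain S n) :
    ∃ B : SingCochain X n, singCochainMap (subspaceIncl S) n B = b := by
  obtain ⟨B, hB⟩ := exists_glue (fun _ : Unit => S) n (fun _ => b) fun _ _ c c' h =>
    congrArg b (singChainsMap_subspaceIncl_injective S n h)
  exact ⟨B, hB ()⟩

variable {M : ℕ → Set X}

theorem exists_glue_of_compatible (hM : Monotone M) (n : ℕ) (b : ∀ i, SingCochain (M i) n)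
    (hb : ∀ i, singCochainMap (ContinuousMap.inclusion (hM i.le_succ)) n (b (i + 1)) = b i) :
    ∃ B : SingCochain X n, ∀ i, singCochainMap (subspaceIncl (M i)) n B = b i := by
  have hb' : ∀ i j (hij : i ≤ j),
      singCochainMap (ContinuousMap.inclusion (hM hij)) n (b j) = b i := by
    intro i j hij
    induction j, hij using Nat.le_induction with
    | base => exact LinearMap.ext fun y => congrArg (b i) (singChainsMap_id_apply n y)
    | succ j hij ih =>
      have h := singCochainMap_comp (ContinuousMap.inclusion (hM j.le_succ))
        (ContinuousMap.inclusion (hM hij)) n (b (j + 1))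
      rw [hb j] at h
      exact h.symm.trans ih
  have hle : ∀ i j (_ : i ≤ j) c c', ((singChainsMap (subspaceIncl (M i))).f n).hom c =
      ((singChainsMap (subspaceIncl (M j))).f n).hom c' → b i c = b j c' := by
    intro i j hij c c' h
    rw [← hb' i j hij]
    refine congrArg (b j) (singChainsMap_subspaceIncl_injective (M j) n ?_)
    exact (singChainsMap_comp_apply (subspaceIncl (M j)) (ContinuousMap.inclusion (hM hij)) n
      c).trans h
  refine exists_glue M n b fun i j c c' h => ?_
  rcases le_total i j with hij | hij
  · exact hle i j hij c c' h
  · exact (hle j i hij c' c h.symm).symm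

/-- Cochains on the members of an exhaustion which are compatible up to coboundaries are
restrictions of a single cochain up to coboundaries: after extending to `X`, the correcting
cochains can be summed up. -/
theorem exists_glue_of_compatible_mod_coboundaries (hM : Monotone M) (p q : ℕ)
    (b : ∀ i, SingCochain (M i) q)
    (e : ∀ i, SingCochain (M i) p)
    (hb : ∀ i, singCochainMap (ContinuousMap.inclusion (hM i.le_succ)) q (b (i + 1)) - b i =
      singCoboundary (M i) p q (e i)) :
    ∃ (B : SingCochain X q) (g : ∀ i, SingCochain (M i) p), ∀ i,
      singCochainMap (subspaceIncl (M i)) q B = b i - singCoboundary (M i) p q (g i) := by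
  choose E hE using fun i => exists_extend_cochain (M i) p (e i)
  let G : ℕ → SingCochain X p := fun i => ∑ j ∈ Finset.range i, E j
  obtain ⟨B, hB⟩ := exists_glue_of_compatible hM q
    (fun i => b i - singCoboundary (M i) p q (singCochainMap (subspaceIncl (M i)) p (G i)))
    fun i => by
      have h1 : singCochainMap (ContinuousMap.inclusion (hM i.le_succ)) p
          (singCochainMap (subspaceIncl (M (i + 1))) p (G (i + 1))) =
            singCochainMap (subspaceIncl (M i)) p (G i) + e i := by
        rw [singCochainMap_comp, ← hE i, ← map_add]
        exact congrArg (singCochainMap (subspaceIncl (M i)) p) (Finset.sum_range_succ E i)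
      rw [map_sub, singCochainMap_coboundary, h1, map_add, ← hb i]
      abel
  exact ⟨B, _, hB⟩

theorem cochain_eq_zero_of_restrict (hM : Monotone M) (hM' : AbsorbsCompacts M) {n : ℕ}
    (c : SingCochain X n)
    (hc : ∀ i, singCochainMap (subspaceIncl (M i)) n c = 0) : c = 0 := by
  refine LinearMap.ext fun y => ?_
  obtain ⟨i, y, rfl⟩ := exists_singChainsMap_eq hM hM' y
  exact LinearMap.congr_fun (hc i) y

theorem toLimCohomology_apply (hM : Monotone M) (n : ℕ) (x : SingCohomology X n) (i : ℕ) :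
    (toLimCohomology M hM n x).1 i = singCohomologyMap (subspaceIncl (M i)) n x := rfl

/-- Surjectivity in Milnor's exact sequence: representing cocycles of a compatible family of classes
are compatible up to coboundaries. -/
theorem toLimCohomology_surjective (hM : Monotone M) (hM' : AbsorbsCompacts M) (n : ℕ) :
    Function.Surjective (toLimCohomology M hM n) := by
  intro y
  choose b hb using fun i => cohClass_surjective (y.1 i)
  have hy : ∀ i, y.1 i = cohomologyBonding M hM n i (y.1 (i + 1)) := fun i =>
    sub_eq_zero.1 (congrFun (AddMonoidHom.mem_ker.1 y.2) i)
  have he : ∀ i, ∃ e, singCoboundary (M i) (n - 1) n e =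
      singCochainMap (ContinuousMap.inclusion (hM i.le_succ)) n (b (i + 1)).1 - (b i).1 := by
    intro i
    refine (cohClass_eq_zero_iff
      (singCocycleMap (ContinuousMap.inclusion (hM i.le_succ)) n (b (i + 1)) - b i)).1 ?_
    rw [cohClass_sub, ← singCohomologyMap_class, hb, hb, hy i]
    exact sub_self _
  choose e he using he
  obtain ⟨B, g, hB⟩ := exists_glue_of_compatible_mod_coboundaries hM (n - 1) n
    (fun i => (b i).1) e fun i => (he i).symm
  have hcoc : B ∈ singCocycles X n := by
    refine cochain_eq_zero_of_restrict hM hM' _ fun i => ?_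
    have hbi : singCoboundary (M i) n (n + 1) (b i).1 = 0 := (b i).2
    rw [singCochainMap_coboundary, hB, map_sub, hbi, singCoboundary_coboundary, sub_zero]
  refine ⟨cohClass ⟨B, hcoc⟩, Subtype.ext (funext fun i => ?_)⟩
  rw [toLimCohomology_apply, singCohomologyMap_class, ← hb, ← sub_eq_zero, ← cohClass_sub,
    cohClass_eq_zero_iff]
  refine ⟨-g i, ?_⟩
  rw [map_neg]
  change _ = singCochainMap (subspaceIncl (M i)) n B - (b i).1
  rw [hB]
  abel

theorem exists_oneSubBonding_eq_of_subsingleton {A : ℕ → Type u} [∀ i, AddCommGroup (A i)]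
    {p : ∀ i, A (i + 1) →+ A i} (h : Subsingleton (TowerLimOne A p)) (a : ∀ i, A i) :
    ∃ v, oneSubBonding A p v = a :=
  (QuotientAddGroup.eq_zero_iff (N := (oneSubBonding A p).range) a).1 (h.elim _ _)

/-- Injectivity from Milnor's exact sequence: the kernel is a quotient of `lim¹`, one degree
lower. -/
theorem toLimCohomology_injective (hM : Monotone M) (hM' : AbsorbsCompacts M) (n : ℕ)
    (hlim : Subsingleton (LimOneCohomology M hM n)) :
    Function.Injective (toLimCohomology M hM (n + 1)) := by
  rw [injective_iff_map_eq_zero]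
  intro x hx
  obtain ⟨w, rfl⟩ := cohClass_surjective x
  have hb : ∀ i, ∃ b, singCoboundary (M i) n (n + 1) b =
      singCochainMap (subspaceIncl (M i)) (n + 1) w.1 := fun i =>
    (cohClass_eq_zero_iff (singCocycleMap (subspaceIncl (M i)) (n + 1) w)).1
      (congrFun (congrArg Subtype.val hx) i)
  choose b hb using hb
  -- the differences of the primitives `b i` are cocycles
  let z : ∀ i, singCocycles (M i) n := fun i =>
    ⟨singCochainMap (ContinuousMap.inclusion (hM i.le_succ)) n (b (i + 1)) - b i, by
      change singCoboundary (M i) n (n + 1) _ = 0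
      rw [map_sub, ← singCochainMap_coboundary, hb, hb, singCochainMap_comp]
      exact sub_self _⟩
  -- vanishing of `lim¹` allows to correct the `b i` such that these become coboundaries
  obtain ⟨v, hv⟩ := exists_oneSubBonding_eq_of_subsingleton hlim fun i => cohClass (z i)
  choose r hr using fun i => cohClass_surjective (v i)
  have he : ∀ i, ∃ e, singCoboundary (M i) (n - 1) n e =
      singCochainMap (ContinuousMap.inclusion (hM i.le_succ)) n (b (i + 1) + (r (i + 1)).1) -
        (b i + (r i).1) := by
    intro i
    have h0 : cohClass (z i -
        (r i - singCocycleMap (ContinuousMap.inclusion (hM i.le_succ)) n (r (i + 1)))) = 0 := by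
      rw [cohClass_sub, cohClass_sub, ← singCohomologyMap_class, hr, hr]
      exact sub_eq_zero.2 (congrFun hv i).symm
    obtain ⟨e, he⟩ := (cohClass_eq_zero_iff _).1 h0
    refine ⟨e, he.trans ?_⟩
    rw [map_add]
    change (singCochainMap (ContinuousMap.inclusion (hM i.le_succ)) n (b (i + 1)) - b i) -
      ((r i).1 - singCochainMap (ContinuousMap.inclusion (hM i.le_succ)) n (r (i + 1)).1) = _
    abel
  choose e he using he
  obtain ⟨B, g, hB⟩ := exists_glue_of_compatible_mod_coboundaries hM (n - 1) n
    (fun i => b i + (r i).1) e fun i => (he i).symm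
  rw [cohClass_eq_zero_iff]
  refine ⟨B, sub_eq_zero.1 (cochain_eq_zero_of_restrict hM hM' _ fun i => ?_)⟩
  have hri : singCoboundary (M i) n (n + 1) (r i).1 = 0 := (r i).2
  change singCochainMap (subspaceIncl (M i)) (n + 1) (singCoboundary X n (n + 1) B - w.1) = 0
  rw [map_sub, singCochainMap_coboundary, hB, map_sub, map_add, hri, hb, singCoboundary_coboundary]
  abel

end Gluing

/-! ### Exhaustions of manifolds by sublevel sets -/

section Sublevels

/-- If each member of the exhaustion is compact and contained in the interior of a later one, then
the transition maps on homology have finitely generated image eventually. -/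
theorem homologyStablyFG_of_compact {X : Type u} [PseudoMetricSpace X]
    (hloc : ∀ x : X, ∀ U ∈ nhds x, ∃ V ∈ nhds x, V ⊆ U ∧ AcyclicSet V)
    {M : ℕ → Set X} (hM : Monotone M) (hcpt : ∀ i, IsCompact (M i))
    (hint : ∀ i, ∃ j, i ≤ j ∧ M i ⊆ interior (M j)) : HomologyStablyFG M hM := by
  intro n i
  obtain ⟨j, hij, hL⟩ := hint i
  refine ⟨j, hij, ?_⟩
  obtain ⟨G, hG, hcyc⟩ :=
    exists_fg_cycles_modulo_bdry hloc (hcpt i) isOpen_interior hL n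
  have hNoeth : IsNoetherian ℤ G := isNoetherian_of_fg_of_noetherian _ hG
  -- the cycles of `M j` that lie in `G`
  let toX : singCycles (M j) n →+ AugChain (n + 1) X :=
    ((singEquiv n).toLinearMap.toAddMonoidHom.comp
      ((singChainsMap (subspaceIncl (M j))).f n).hom.toAddMonoidHom).comp
      (singCycles (M j) n).subtype
  have htoX : Function.Injective toX :=
    (singEquiv n).injective.comp ((singChainsMap_subspaceIncl_injective (M j) n).comp
      Subtype.val_injective)
  let P : AddSubgroup (singCycles (M j) n) := G.toAddSubgroup.comap toX
  have hP : Module.Finite ℤ P := by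
    let κ : P →+ G := (toX.comp P.subtype).codRestrict G.toAddSubgroup fun z => z.2
    exact Module.Finite.of_injective (intLinear κ) fun a b h =>
      Subtype.ext (htoX (congrArg Subtype.val h))
  let κ : P →+ CycHomology (M j) n := (QuotientAddGroup.mk' _).comp P.subtype
  have hκ : IsNoetherian ℤ (LinearMap.range κ.toIntLinearMap) :=
    isNoetherian_of_fg_of_noetherian _ (Module.Finite.iff_fg.1 inferInstance)
  refine isNoetherian_submodule.1 hκ _ ?_
  rintro _ ⟨a, rfl⟩
  obtain ⟨z, rfl⟩ := homClass_surjective a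
  let zX : (singChains X).X n := ((singChainsMap (subspaceIncl (M i))).f n).hom z
  have hzcar : singEquiv n zX ∈ carriedBy (n + 1) (M i) := by
    rw [singEquiv_map]
    exact augMap_mem_carriedBy (fun x => x.2) _
  have hzcyc : n = 0 ∨ augBdry n X (singEquiv n zX) = 0 := by
    cases n with
    | zero => exact Or.inl rfl
    | succ m =>
      right
      have hz : ((singChains (M i)).d (m + 1) m).hom z = 0 := z.2
      rw [← singEquiv_d, ← singChainsMap_d_apply, hz, map_zero, map_zero]
  obtain ⟨b, hb, hbG⟩ := hcyc _ hzcar hzcyc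
  obtain ⟨b, rfl⟩ := exists_augMap_eq (carriedBy_mono interior_subset hb)
  obtain ⟨b, rfl⟩ := (singEquiv (n + 1)).surjective b
  have hdb : ((singChains (M j)).d (n + 1) n).hom b ∈ singCycles (M j) n :=
    singBoundaries_le_cycles n ⟨b, rfl⟩
  let w : singCycles (M j) n := singCycleMap (ContinuousMap.inclusion (hM hij)) n z - ⟨_, hdb⟩
  have hw : w ∈ P := by
    change toX w ∈ G
    rw [← singEquiv_map, ← singEquiv_d, ← map_sub, ← singChainsMap_d_apply] at hbG
    have h1 := singChainsMap_comp_apply (subspaceIncl (M j)) (ContinuousMap.inclusion (hM hij)) n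
      z.1
    convert hbG using 1
    rw [map_sub, map_sub]
    exact congrArg (fun t => singEquiv n t - _) h1
  refine ⟨⟨w, hw⟩, ?_⟩
  have h0 : homClass ⟨_, hdb⟩ = 0 := (homClass_eq_zero_iff _).2 ⟨b, rfl⟩
  have h2 : homClass w = homClass (singCycleMap (ContinuousMap.inclusion (hM hij)) n z) -
      homClass ⟨_, hdb⟩ := rfl
  rw [h0, sub_zero] at h2
  exact h2

variable {X : Type u} {ρ : X → ℝ} {c : ℕ → ℝ}

theorem exists_lt_of_exhaustion [TopologicalSpace X] [NoncompactSpace X]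
    (hexh : ∀ r : ℝ, IsCompact {x | ρ x ≤ r}) (hcover : ⋃ i, sublevels ρ c i = Set.univ) (r : ℝ) :
    ∃ i, r < c i := by
  by_contra! h
  refine noncompact_univ X ((hexh r).of_isClosed_subset isClosed_univ fun x _ => ?_)
  obtain ⟨i, hi⟩ := Set.mem_iUnion.1 (hcover ▸ Set.mem_univ x)
  exact le_trans (hi : ρ x ≤ c i) (h i)

theorem sublevels_absorbsCompacts [TopologicalSpace X] [NoncompactSpace X] (hρ : Continuous ρ)
    (hexh : ∀ r : ℝ, IsCompact {x | ρ x ≤ r}) (hcover : ⋃ i, sublevels ρ c i = Set.univ) :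
    AbsorbsCompacts (sublevels ρ c) := by
  intro K hK
  obtain ⟨r, hr⟩ := hK.bddAbove_image hρ.continuousOn
  obtain ⟨i, hi⟩ := exists_lt_of_exhaustion hexh hcover r
  exact ⟨i, fun x hx => (hr ⟨x, hx, rfl⟩).trans hi.le⟩

theorem exists_sublevels_subset_interior [TopologicalSpace X] [NoncompactSpace X]
    (hρ : Continuous ρ) (hexh : ∀ r : ℝ, IsCompact {x | ρ x ≤ r}) (hc : Monotone c)
    (hcover : ⋃ i, sublevels ρ c i = Set.univ) (i : ℕ) :
    ∃ j, i ≤ j ∧ sublevels ρ c i ⊆ interior (sublevels ρ c j) := by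
  obtain ⟨j, hj⟩ := exists_lt_of_exhaustion hexh hcover (c i)
  refine ⟨j, le_of_not_gt fun h => absurd (hc h.le) (not_le.2 hj), fun x hx => ?_⟩
  exact mem_interior.2 ⟨{x | ρ x < c j}, fun y (hy : ρ y < c j) => (hy.le : ρ y ≤ c j),
    isOpen_lt hρ continuous_const, lt_of_le_of_lt hx hj⟩

end Sublevels

theorem proposition6p2 (d : ℕ) (X : Type u) [TopologicalSpace X] [T2Space X]
    [SecondCountableTopology X] [NoncompactSpace X]
    [ChartedSpace (EuclideanSpace ℝ (Fin d)) X] [IsManifold (𝓡 d) ∞ X]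
    (ρ : X → ℝ) (hρ : ContMDiff (𝓡 d) 𝓘(ℝ, ℝ) ∞ ρ)
    (hexh : ∀ r : ℝ, IsCompact {x | ρ x ≤ r})
    (c : ℕ → ℝ) (hc : Monotone c)
    (hreg : ∀ i x, ρ x = c i → mfderiv (𝓡 d) 𝓘(ℝ, ℝ) ρ x ≠ 0)
    (hcover : ⋃ i, sublevels ρ c i = Set.univ)
    (k : ℕ) (hk : 1 ≤ k) :
    Nonempty (LimOneCohomology (sublevels ρ c) (sublevels_monotone ρ hc) (k - 1) ≃+
        ExtModTorsion (SingHomology X (k - 1))) ∧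
      (Subsingleton (ExtModTorsion (SingHomology X (k - 1))) →
        Function.Bijective (toLimCohomology (sublevels ρ c) (sublevels_monotone ρ hc) k)) := by
  obtain ⟨n, rfl⟩ : ∃ n, k = n + 1 := ⟨k - 1, (Nat.sub_add_cancel hk).symm⟩
  rw [Nat.add_sub_cancel]
  have habs := sublevels_absorbsCompacts hρ.continuous hexh hcover
  have hfg : HomologyStablyFG (sublevels ρ c) (sublevels_monotone ρ hc) := by
    have : LocallyCompactSpace X := ChartedSpace.locallyCompactSpace (EuclideanSpace ℝ (Fin d)) X
    let _ : MetricSpace X := TopologicalSpace.metrizableSpaceMetric X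
    exact homologyStablyFG_of_compact (fun x U hU => exists_acyclic_nhds (d := d) x hU) _
      (fun i => hexh (c i))
      (exists_sublevels_subset_interior hρ.continuous hexh hc hcover)
  obtain ⟨e⟩ := nonempty_limOneCohomology_equiv_ext (sublevels_monotone ρ hc) habs hfg n
  refine ⟨⟨e⟩, fun hext => ⟨?_, toLimCohomology_surjective _ habs _⟩⟩
  exact toLimCohomology_injective _ habs n e.toEquiv.subsingleton
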